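/- For $u\in\mathbb C^n$ put $A(u)=\prod_{1\le i<j\le n}(u_i-u_j)$, $\bar u=u_1+\dots+u_n$, and for $u\in\mathbb C^k$, $v\in\mathbb C^l$ put $A(u,v)=\prod_{i=1}^k\prod_{j=1}^l(u_i-v_j)$. Let $m\ge 0$ be an integer. The rational Baker–Akhiezer (BA) function of type $A_{n-1}$ with multiplicity $m$ is the function $$\Psi^{(n)}_m(x,\lambda)=\frac{P(x,\lambda)}{A(x)^mA(\lambda)^m}\,e^{\lambda_1x_1+\dots+\lambda_nx_n}$$ where $P$ is a polynomial in $x,\lambda\in\mathbb C^n$ with leading term $A(x)^mA(\lambda)^m$ (that is, every monomial of $P-A(x)^mA(\lambda)^m$ has degree less than $mn(n-1)/2$ in $x$ and degree less than $mn(n-1)/2$ in $\lambda$), such that, for all $x$ with distinct coordinates and all $\lambda$ with distinct coordinates, $$\Big(-\sum_{i=1}^n\frac{\partial^2}{\partial x_i^2}+\sum_{i<j}\frac{2m(m+1)}{(x_i-x_j)^2}\Big)\Psi^{(n)}_m=-(\lambda_1^2+\dots+\lambda_n^2)\,\Psi^{(n)}_m .$$ Theorem. Let $k\ge0$ and $m\ge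 0$ be integers. For $n=k$ and for $n=k+1$ there is exactly one such polynomial $P$, and the BA functions with $k$ and $k+1$ particles are related as follows. Let $x_1,\dots,x_{k+1}\in\mathbb C$ be distinct, let $\lambda_1,\dots,\lambda_{k+1}\in\mathbb C$ be distinct, and let $\epsilon>0$ satisfy $\epsilon<|x_i-x_j|$ for all $1\le i\le k$, $1\le j\le k+1$, $j\ne i$. Let $\sigma$ be the product of the positively oriented circles $|z_i-x_i|=\epsilon$, $i=1,\dots,k$, and $dz=dz_1\wedge\dots\wedge dz_k$. Then the integrand below is integrable on $\sigma$ and $$\oint_\sigma\frac{A(x)^{m+1}A(z)^{m+1}}{A(z,x)^{m+1}}\,e^{\lambda_{k+1}(\bar x-\bar z)}\,\Psi^{(k)}_m(z,\lambda_1,\dots,\lambda_k)\,dz=C_1\,\Psi^{(k+1)}_m(x,\lambda_1,\dots,\lambda_{k+1}),$$ $$C_1=(-1)^{(m+1)k(k-1)/2}\,\frac{(2\pi i)^k}{(m!)^k}\prod_{i=1}^k(\lambda_i-\lambda_{k+1})^m .$$ -/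

import Mathlib

noncomputable section

/-- `A(u) = ∏_{i<j} (u_i - u_j)`, over any commutative ring. -/
def vandA {R : Type*} [CommRing R] {n : ℕ} (u : Fin n → R) : R :=
  ∏ i : Fin n, ∏ j ∈ Finset.Ioi i, (u i - u j)

/-- `A(u, v) = ∏_i ∏_j (u_i - v_j)`. -/
def crossA {k l : ℕ} (u : Fin k → ℂ) (v : Fin l → ℂ) : ℂ :=
  ∏ i : Fin k, ∏ j : Fin l, (u i - v j)

/-- The complex Laplacian `Δ f = ∑_i ∂² f / ∂x_i²` of a function of `n` complex variables. -/
def complexLaplacian {n : ℕ} (f : (Fin n → ℂ) → ℂ) (x : Fin n → ℂ) : ℂ :=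
  ∑ i : Fin n, iteratedDeriv 2 (fun t : ℂ => f (Function.update x i t)) (x i)

/-- The rational Calogero–Moser operator
`L = -Δ + ∑_{i<j} 2m(m+1)/(x_i - x_j)²` with `n` particles. -/
def calogeroMoser (n m : ℕ) (f : (Fin n → ℂ) → ℂ) (x : Fin n → ℂ) : ℂ :=
  -complexLaplacian f x +
    (∑ i : Fin n, ∑ j ∈ Finset.Ioi i,
      2 * (m : ℂ) * ((m : ℂ) + 1) / (x i - x j) ^ 2) * f x

/-- Polynomials in `x_1, …, x_n` (left summand) and `λ_1, …, λ_n` (right summand). -/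
abbrev XLPoly (n : ℕ) : Type := MvPolynomial (Fin n ⊕ Fin n) ℂ

/-- The function `P(x, λ) / (A(x)^m A(λ)^m) · exp (λ, x)`. -/
def baFunction {n : ℕ} (m : ℕ) (P : XLPoly n) (x lam : Fin n → ℂ) : ℂ :=
  MvPolynomial.eval (Sum.elim x lam) P / (vandA x ^ m * vandA lam ^ m) *
    Complex.exp (∑ i : Fin n, lam i * x i)

/-- The polynomial `A(x)^m A(λ)^m`. -/
def baLeading (n m : ℕ) : XLPoly n :=
  vandA (fun i : Fin n => (MvPolynomial.X (Sum.inl i) : XLPoly n)) ^ m *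
    vandA (fun i : Fin n => (MvPolynomial.X (Sum.inr i) : XLPoly n)) ^ m

/-- `P` is the polynomial part of the rational Baker–Akhiezer function of type `A_{n-1}` with
multiplicity `m`: its leading term, both in `x` and in `λ`, is `A(x)^m A(λ)^m` (which has degree
`m n(n-1)/2` in `x` and in `λ`), and the function `P / (A(x)^m A(λ)^m) · exp (λ, x)` satisfies the
Schrödinger equation `L Ψ = -(λ, λ) Ψ`. -/
structure IsBAPolynomial (n m : ℕ) (P : XLPoly n) : Prop where
  degree_x : ∀ d ∈ (P - baLeading n m).support, ∑ i : Fin n, d (Sum.inl i) < m * n.choose 2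
  degree_lam : ∀ d ∈ (P - baLeading n m).support, ∑ i : Fin n, d (Sum.inr i) < m * n.choose 2
  schrodinger : ∀ x lam : Fin n → ℂ, Function.Injective x → Function.Injective lam →
    calogeroMoser n m (fun y => baFunction m P y lam) x =
      -(∑ i : Fin n, lam i ^ 2) * baFunction m P x lam

/-- The integrand
`A(x)^{m+1} A(z)^{m+1} / A(z,x)^{m+1} · e^{λ_{k+1} (x̄ - z̄)} · Ψ^{(k)}(z, λ_1, …, λ_k)`,
where `Ψ^{(k)}` has polynomial part `P`, `x̄ = ∑ x_j` and `z̄ = ∑ z_i`. -/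
def addParticleIntegrand {k : ℕ} (m : ℕ) (P : XLPoly k) (x lam : Fin (k + 1) → ℂ)
    (z : Fin k → ℂ) : ℂ :=
  vandA x ^ (m + 1) * vandA z ^ (m + 1) / crossA z x ^ (m + 1) *
    Complex.exp (lam (Fin.last k) * (∑ j : Fin (k + 1), x j - ∑ i : Fin k, z i)) *
    baFunction m P z (fun i : Fin k => lam i.castSucc)

end

/-!
The integral is a transmutation operator. Writing `λ = (λ', l)` with `l = λ_{k+1}`, its kernel
`A(x)^{m+1} A(z)^{m+1} / A(z, x)^{m+1} · e^{l (x̄ - z̄)}` satisfies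
`(L_x - L_z) K = -l² K`, where `L_x` and `L_z` are the Calogero–Moser operators in the `k + 1`
variables `x` and the `k` variables `z`. This is the identity of the deformed Calogero–Moser system
in which the `x` have charge `1` and the `z` have charge `-1` (`sum_charge_identity`). Integration
by parts over a torus has no boundary terms, so the integral of `K` against a solution of
`L_z Ψ = -(λ', λ') Ψ` solves `L_x Φ = -((λ', λ') + l²) Φ` (`calogeroMoser_kernelIntegral`).

By residues, the integral is `N(x, λ) / A(x)^{3m+1} · e^{(λ, x)}` for an explicit polynomial `N`
(`IsContour.kernelIntegral_eq`). The Schrödinger equation only allows poles of order at most `m` on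
the hyperplanes `x_i = x_j`: the indices of the equation there are `-m` and `m + 1`
(`exists_eq_xVand_pow_mul`). So `N = ± A(x)^{2m+1} Q`, where `Q` solves the equation of the BA
function. The part of `N` of highest degree in `λ` comes from letting all the derivatives in the
residues act on the exponential, and it shows that `Q - A(x)^m A(λ)^m` has lower degree in `λ`
(`gaugeNumerator_sub_mem`). Rescaling the contour shows that `Q` has the same degree in `x` as in
`λ`, monomial by monomial (`isBalanced_of_gaugeNumerator_eq`), which bounds the degree in `x`.
This gives existence by induction on the number of particles, and it also gives the integral
formula.

For uniqueness, the difference of two such polynomials solves the equation and has degree in `x`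
less than `m n(n-1)/2`. The coefficient `q` of the highest power of `λ` in such a solution satisfies
`A ∂_λ q = m (∂_λ A) q` with `∂_λ = ∑ λ_i ∂/∂x_i`. On the line through `x` in the direction `λ` this
forces the degree of `q` to be that of `A^m`, unless `q = 0` (`eq_zero_of_schrPoly_eq_zero`).
-/

open MvPolynomial

namespace BakerAkhiezer

/-! ### The Vandermonde product -/

/-- The pairs of indices `i < j`, which number the factors of `A(u)`. -/
def pairs (n : ℕ) : Finset (Fin n × Fin n) := Finset.univ.filter fun p => p.1 < p.2

theorem mem_pairs {n : ℕ} {p : Fin n × Fin n} : p ∈ pairs n ↔ p.1 < p.2 := by simp [pairs]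

theorem prod_Ioi_eq_prod_pairs {M : Type*} [CommMonoid M] {n : ℕ} (f : Fin n → Fin n → M) :
    ∏ i : Fin n, ∏ j ∈ Finset.Ioi i, f i j = ∏ p ∈ pairs n, f p.1 p.2 := by
  rw [pairs, Finset.prod_filter, Fintype.prod_prod_type]
  refine Finset.prod_congr rfl fun i _ => ?_
  rw [← Finset.prod_filter]
  refine Finset.prod_congr ?_ fun _ _ => rfl
  ext j; simp

theorem sum_Ioi_eq_sum_pairs {M : Type*} [AddCommMonoid M] {n : ℕ} (f : Fin n → Fin n → M) :
    ∑ i : Fin n, ∑ j ∈ Finset.Ioi i, f i j = ∑ p ∈ pairs n, f p.1 p.2 := by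
  rw [pairs, Finset.sum_filter, Fintype.sum_prod_type]
  refine Finset.sum_congr rfl fun i _ => ?_
  rw [← Finset.sum_filter]
  refine Finset.sum_congr ?_ fun _ _ => rfl
  ext j; simp

theorem card_pairs (n : ℕ) : (pairs n).card = n.choose 2 := by
  have h := sum_Ioi_eq_sum_pairs (n := n) (fun _ _ => (1 : ℕ))
  simp only [Finset.sum_const, smul_eq_mul, mul_one, Fin.card_Ioi] at h
  rw [← h, Fin.sum_univ_eq_sum_range (fun i => n - 1 - i) n, Finset.sum_range_reflect (fun i => i) n,
    Finset.sum_range_id, Nat.choose_two_right]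

theorem vandA_eq_prod_pairs {R : Type*} [CommRing R] {n : ℕ} (u : Fin n → R) :
    vandA u = ∏ p ∈ pairs n, (u p.1 - u p.2) :=
  prod_Ioi_eq_prod_pairs fun i j => u i - u j

theorem map_vandA {R S : Type*} [CommRing R] [CommRing S] {n : ℕ} (f : R →+* S) (u : Fin n → R) :
    f (vandA u) = vandA fun i => f (u i) := by
  simp [vandA_eq_prod_pairs, map_prod]

theorem vandA_ne_zero_iff {R : Type*} [CommRing R] [IsDomain R] {n : ℕ} {u : Fin n → R} :
    vandA u ≠ 0 ↔ Function.Injective u := by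
  rw [vandA_eq_prod_pairs, Finset.prod_ne_zero_iff]
  constructor
  · intro h i j hij
    by_contra hne
    rcases lt_or_gt_of_ne hne with hlt | hlt
    · exact h (i, j) (mem_pairs.2 hlt) (by simp [hij])
    · exact h (j, i) (mem_pairs.2 hlt) (by simp [hij])
  · intro h p hp h0
    exact (mem_pairs.1 hp).ne (h (sub_eq_zero.1 h0))

theorem vandA_mul_left {R : Type*} [CommRing R] {n : ℕ} (s : R) (u : Fin n → R) :
    vandA (fun i => s * u i) = s ^ n.choose 2 * vandA u := by
  simp only [vandA_eq_prod_pairs, ← mul_sub, Finset.prod_mul_distrib, Finset.prod_const, card_pairs]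

/-- `A(u_1, …, u_{n+1}) = A(u_1, …, u_n) ∏ (u_i - u_{n+1})`. -/
theorem vandA_castSucc {R : Type*} [CommRing R] {n : ℕ} (u : Fin (n + 1) → R) :
    vandA u = vandA (fun i : Fin n => u i.castSucc) * ∏ i : Fin n, (u i.castSucc - u (Fin.last n)) := by
  have hI (i : Fin n) : Finset.Ioi i.castSucc =
      Finset.cons (Fin.last n) ((Finset.Ioi i).map Fin.castSuccEmb) (by simp) := by
    ext j
    refine Fin.lastCases ?_ (fun j => ?_) j
    · simp
    · simp [Fin.le_last]
  simp only [vandA]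
  rw [Fin.prod_univ_castSucc]
  have hl : Finset.Ioi (Fin.last n) = ∅ := by ext j; simp [Fin.le_last]
  rw [hl, Finset.prod_empty, mul_one, ← Finset.prod_mul_distrib]
  refine Finset.prod_congr rfl fun i _ => ?_
  rw [hI, Finset.prod_cons, Finset.prod_map, mul_comm]
  rfl

/-- The product over ordered pairs is `±A(u)²`. -/
theorem prod_prod_erase_sub {R : Type*} [CommRing R] {n : ℕ} (u : Fin n → R) :
    ∏ i : Fin n, ∏ j ∈ Finset.univ.erase i, (u i - u j) = (-1) ^ n.choose 2 * vandA u ^ 2 := by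
  have h1 : ∏ i : Fin n, ∏ j ∈ Finset.univ.erase i, (u i - u j) =
      (∏ i : Fin n, ∏ j ∈ Finset.Ioi i, (u i - u j)) *
        ∏ i : Fin n, ∏ j ∈ Finset.Iio i, (u i - u j) := by
    rw [← Finset.prod_mul_distrib]
    refine Finset.prod_congr rfl fun i _ => ?_
    rw [← Finset.prod_union (by
      rw [Finset.disjoint_left]; intro j; simp only [Finset.mem_Ioi, Finset.mem_Iio]; omega)]
    refine Finset.prod_congr ?_ fun _ _ => rfl
    ext j; simp [lt_or_lt_iff_ne, ne_comm]
  have h2 : ∏ i : Fin n, ∏ j ∈ Finset.Iio i, (u i - u j) =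
      ∏ i : Fin n, ∏ j ∈ Finset.Ioi i, (u j - u i) := by
    rw [Finset.prod_sigma', Finset.prod_sigma']
    refine Finset.prod_bij' (fun p _ => ⟨p.2, p.1⟩) (fun p _ => ⟨p.2, p.1⟩) ?_ ?_ ?_ ?_ ?_ <;> simp
  rw [h1, h2, prod_Ioi_eq_prod_pairs, prod_Ioi_eq_prod_pairs fun i j => u j - u i,
    vandA_eq_prod_pairs, sq, ← mul_assoc, mul_comm]
  congr 1
  rw [← card_pairs, ← Finset.prod_const, ← Finset.prod_mul_distrib]
  exact Finset.prod_congr rfl fun p _ => by ring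

/-! ### Functions `R(x, λ) / A(x)^s · e^{(λ, x)}` -/

/-- The polynomial `A(x)`. -/
noncomputable def xVand (n : ℕ) : XLPoly n := vandA fun i => X (Sum.inl i)

/-- The polynomial `A(λ)`. -/
noncomputable def lamVand (n : ℕ) : XLPoly n := vandA fun i => X (Sum.inr i)

theorem baLeading_eq (n m : ℕ) : baLeading n m = xVand n ^ m * lamVand n ^ m := rfl

@[simp] theorem eval_xVand {n : ℕ} (x lam : Fin n → ℂ) :
    eval (Sum.elim x lam) (xVand n) = vandA x := by
  rw [xVand, map_vandA]; simp

@[simp] theorem eval_lamVand {n : ℕ} (x lam : Fin n → ℂ) :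
    eval (Sum.elim x lam) (lamVand n) = vandA lam := by
  rw [lamVand, map_vandA]; simp

theorem xVand_ne_zero (n : ℕ) : xVand n ≠ 0 :=
  vandA_ne_zero_iff.2 fun _ _ h => Sum.inl_injective (X_injective h)

theorem lamVand_ne_zero (n : ℕ) : lamVand n ≠ 0 :=
  vandA_ne_zero_iff.2 fun _ _ h => Sum.inr_injective (X_injective h)

/-- A polynomial is determined by its values at points with distinct `x_i` and distinct `λ_i`. -/
theorem eq_zero_of_eval_injective {n : ℕ} {R : XLPoly n}
    (h : ∀ x lam : Fin n → ℂ, Function.Injective x → Function.Injective lam →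
      eval (Sum.elim x lam) R = 0) : R = 0 := by
  have h0 : R * (xVand n * lamVand n) = 0 := by
    refine MvPolynomial.funext fun y => ?_
    obtain ⟨x, lam, rfl⟩ : ∃ x lam, y = Sum.elim x lam :=
      ⟨_, _, (Sum.elim_comp_inl_inr y).symm⟩
    by_cases hx : Function.Injective x
    · by_cases hl : Function.Injective lam
      · simp [h x lam hx hl]
      · have : vandA lam = 0 := by by_contra h'; exact hl (vandA_ne_zero_iff.1 h')
        simp [this]
    · have : vandA x = 0 := by by_contra h'; exact hx (vandA_ne_zero_iff.1 h')
      simp [this]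
  exact (mul_eq_zero.1 h0).resolve_right (mul_ne_zero (xVand_ne_zero n) (lamVand_ne_zero n))

/-- The function `R(x, λ) / A(x)^s · e^{(λ, x)}`. -/
noncomputable def gaugeFn {n : ℕ} (s : ℕ) (R : XLPoly n) (x lam : Fin n → ℂ) : ℂ :=
  eval (Sum.elim x lam) R / vandA x ^ s * Complex.exp (∑ i : Fin n, lam i * x i)

theorem baFunction_eq_gaugeFn {n : ℕ} (m : ℕ) (P : XLPoly n) (x lam : Fin n → ℂ) :
    baFunction m P x lam = (vandA lam ^ m)⁻¹ * gaugeFn m P x lam := by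
  simp only [baFunction, gaugeFn, div_eq_mul_inv, mul_inv]; ring

theorem gaugeFn_mul_xVand_pow {n : ℕ} (s r : ℕ) (R : XLPoly n) {x : Fin n → ℂ}
    (lam : Fin n → ℂ) (hx : Function.Injective x) :
    gaugeFn (s + r) (xVand n ^ r * R) x lam = gaugeFn s R x lam := by
  have := vandA_ne_zero_iff.2 hx
  simp only [gaugeFn, map_mul, map_pow, eval_xVand]
  field_simp
  ring

/-- The polynomial `R'` for which `∂/∂x_i` of `R / A(x)^s · e^{(λ, x)}` is
`R' / A(x)^{s+1} · e^{(λ, x)}`. -/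
noncomputable def gaugeDeriv {n : ℕ} (s : ℕ) (i : Fin n) (R : XLPoly n) : XLPoly n :=
  xVand n * (pderiv (Sum.inl i) R + X (Sum.inr i) * R) -
    C (s : ℂ) * (pderiv (Sum.inl i) (xVand n) * R)

theorem hasDerivAt_eval_update {σ : Type*} [DecidableEq σ] (R : MvPolynomial σ ℂ) (y : σ → ℂ)
    (a : σ) (t : ℂ) :
    HasDerivAt (fun t => eval (Function.update y a t) R)
      (eval (Function.update y a t) (pderiv a R)) t := by
  induction R using MvPolynomial.induction_on with
  | C c => simpa using hasDerivAt_const t c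
  | add p q hp hq => simpa using hp.fun_add hq
  | mul_X p j hp =>
    have hj : HasDerivAt (fun t => Function.update y a t j) (if j = a then 1 else 0) t := by
      by_cases h : j = a
      · subst h; simpa using hasDerivAt_id' t
      · simpa [h] using hasDerivAt_const t (y j)
    simp only [map_mul, eval_X, Derivation.leibniz, smul_eq_mul, map_add, pderiv_X, Pi.single_apply]
    refine (hp.fun_mul hj).congr_deriv ?_
    split_ifs <;> simp <;> ring

theorem hasDerivAt_vandA_update {n : ℕ} (x : Fin n → ℂ) (i : Fin n) (t : ℂ) :
    HasDerivAt (fun t => vandA (Function.update x i t))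
      (eval (Sum.elim (Function.update x i t) 0) (pderiv (Sum.inl i) (xVand n))) t := by
  have := hasDerivAt_eval_update (xVand n) (Sum.elim x 0) (Sum.inl i) t
  simpa only [Function.update_apply, Sum.update_elim_inl, eval_xVand] using this

theorem eval_pderiv_xVand {n : ℕ} (i : Fin n) (x lam lam' : Fin n → ℂ) :
    eval (Sum.elim x lam) (pderiv (Sum.inl i) (xVand n)) =
      eval (Sum.elim x lam') (pderiv (Sum.inl i) (xVand n)) := by
  have h1 := hasDerivAt_eval_update (xVand n) (Sum.elim x lam) (Sum.inl i) (x i)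
  have h2 := hasDerivAt_eval_update (xVand n) (Sum.elim x lam') (Sum.inl i) (x i)
  simp only [Sum.update_elim_inl, eval_xVand, Function.update_eq_self] at h1 h2
  exact h1.unique h2

theorem hasDerivAt_gaugeFn {n : ℕ} (s : ℕ) (R : XLPoly n) (x lam : Fin n → ℂ) (i : Fin n) (t : ℂ)
    (ht : vandA (Function.update x i t) ≠ 0) :
    HasDerivAt (fun t => gaugeFn s R (Function.update x i t) lam)
      (gaugeFn (s + 1) (gaugeDeriv s i R) (Function.update x i t) lam) t := by
  have hR := hasDerivAt_eval_update R (Sum.elim x lam) (Sum.inl i) t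
  simp only [Sum.update_elim_inl] at hR
  have hA := hasDerivAt_vandA_update x i t
  have hE : HasDerivAt (fun t => Complex.exp (∑ j, lam j * Function.update x i t j))
      (Complex.exp (∑ j, lam j * Function.update x i t j) * lam i) t := by
    refine HasDerivAt.cexp ?_
    have : HasDerivAt (fun t => ∑ j, lam j * Function.update x i t j)
        (∑ j, lam j * if j = i then 1 else 0) t := by
      refine HasDerivAt.fun_sum fun j _ => HasDerivAt.const_mul _ ?_
      by_cases h : j = i
      · subst h; simpa using hasDerivAt_id' t
      · simpa [h] using hasDerivAt_const t (x j)
    simpa using this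
  have hAs : HasDerivAt (fun t => vandA (Function.update x i t) ^ s)
      (s * vandA (Function.update x i t) ^ s / vandA (Function.update x i t) *
      (eval (Sum.elim (Function.update x i t) 0) (pderiv (Sum.inl i) (xVand n)))) t := by
    refine (hA.fun_pow s).congr_deriv ?_
    rcases s with _ | s
    · rw [Nat.cast_zero, zero_mul, zero_mul, zero_div, zero_mul]
    · rw [Nat.add_sub_cancel, pow_succ, ← mul_assoc, mul_div_cancel_right₀ _ ht]
  refine ((hR.fun_div hAs (pow_ne_zero s ht)).fun_mul hE).congr_deriv ?_
  simp only [gaugeFn, gaugeDeriv, map_sub, map_mul, map_add, eval_xVand, eval_X, eval_C,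
    Sum.elim_inr]
  rw [eval_pderiv_xVand i _ lam 0]
  field_simp
  ring

theorem isOpen_update_vandA_ne_zero {n : ℕ} (x : Fin n → ℂ) (i : Fin n) :
    IsOpen {t : ℂ | vandA (Function.update x i t) ≠ 0} := by
  have : Continuous fun t => vandA (Function.update x i t) :=
    continuous_iff_continuousAt.2 fun t => (hasDerivAt_vandA_update x i t).continuousAt
  exact isOpen_ne_fun this continuous_const

theorem iteratedDeriv_two_eq_of_hasDerivAt {f f' : ℂ → ℂ} {f'' t : ℂ}
    (h : ∀ᶠ u in nhds t, HasDerivAt f (f' u) u) (h' : HasDerivAt f' f'' t) :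
    iteratedDeriv 2 f t = f'' := by
  rw [iteratedDeriv_succ, iteratedDeriv_one]
  have : deriv f =ᶠ[nhds t] f' := h.mono fun u hu => hu.deriv
  rw [this.deriv_eq, h'.deriv]

theorem complexLaplacian_gaugeFn {n : ℕ} (s : ℕ) (R : XLPoly n) {x : Fin n → ℂ} (lam : Fin n → ℂ)
    (hx : Function.Injective x) :
    complexLaplacian (fun y => gaugeFn s R y lam) x =
      ∑ i, gaugeFn (s + 2) (gaugeDeriv (s + 1) i (gaugeDeriv s i R)) x lam := by
  refine Finset.sum_congr rfl fun i _ => ?_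
  have h0 : vandA (Function.update x i (x i)) ≠ 0 := by
    rw [Function.update_eq_self]; exact vandA_ne_zero_iff.2 hx
  have h2 := hasDerivAt_gaugeFn (s + 1) (gaugeDeriv s i R) x lam i (x i) h0
  rw [Function.update_eq_self] at h2
  exact iteratedDeriv_two_eq_of_hasDerivAt
    (Filter.eventually_of_mem ((isOpen_update_vandA_ne_zero x i).mem_nhds h0)
      fun t ht => hasDerivAt_gaugeFn s R x lam i t ht) h2

/-! ### The Schrödinger equation as a polynomial identity -/

/-- The quotient of `A(x)` by its factor `x_i - x_j`, where `p = (i, j)`. -/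
noncomputable def xVandErase {n : ℕ} (p : Fin n × Fin n) : XLPoly n :=
  ∏ q ∈ (pairs n).erase p, (X (Sum.inl q.1) - X (Sum.inl q.2))

theorem xVand_eq_mul_xVandErase {n : ℕ} {p : Fin n × Fin n} (hp : p ∈ pairs n) :
    xVand n = (X (Sum.inl p.1) - X (Sum.inl p.2)) * xVandErase p := by
  rw [xVand, vandA_eq_prod_pairs, xVandErase, Finset.mul_prod_erase _
    (fun q : Fin n × Fin n => (X (Sum.inl q.1) - X (Sum.inl q.2) : XLPoly n)) hp]

/-- The numerator of `(Δ_x - ∑_{i<j} 2m(m+1)/(x_i - x_j)² - (λ, λ))` applied to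
`R / A(x)^s · e^{(λ, x)}`, with the denominator `A(x)^{s+2}`. -/
noncomputable def schrPoly {n : ℕ} (m s : ℕ) (R : XLPoly n) : XLPoly n :=
  ∑ i, gaugeDeriv (s + 1) i (gaugeDeriv s i R) -
    (∑ p ∈ pairs n, C (2 * (m : ℂ) * (m + 1)) * xVandErase p ^ 2) * R -
    (∑ i, X (Sum.inr i) ^ 2) * xVand n ^ 2 * R

theorem calogeroMoser_gaugeFn {n : ℕ} (m s : ℕ) (R : XLPoly n) {x : Fin n → ℂ} (lam : Fin n → ℂ)
    (hx : Function.Injective x) :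
    calogeroMoser n m (fun y => gaugeFn s R y lam) x =
      -(∑ i, lam i ^ 2) * gaugeFn s R x lam - gaugeFn (s + 2) (schrPoly m s R) x lam := by
  have hA := vandA_ne_zero_iff.2 hx
  have hU : ∑ i : Fin n, ∑ j ∈ Finset.Ioi i, 2 * (m : ℂ) * ((m : ℂ) + 1) / (x i - x j) ^ 2 =
      (∑ p ∈ pairs n, 2 * (m : ℂ) * (m + 1) * eval (Sum.elim x lam) (xVandErase p) ^ 2) /
        vandA x ^ 2 := by
    rw [sum_Ioi_eq_sum_pairs fun i j => 2 * (m : ℂ) * ((m : ℂ) + 1) / (x i - x j) ^ 2,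
      Finset.sum_div]
    refine Finset.sum_congr rfl fun p hp => ?_
    have h := congrArg (eval (Sum.elim x lam)) (xVand_eq_mul_xVandErase hp)
    simp only [eval_xVand, map_mul, map_sub, eval_X, Sum.elim_inl] at h
    have hne := hA
    rw [h] at hne ⊢
    have h1 := left_ne_zero_of_mul hne
    have h2 := right_ne_zero_of_mul hne
    field_simp
  rw [calogeroMoser, complexLaplacian_gaugeFn s R lam hx, hU]
  simp only [gaugeFn, schrPoly, map_sub, map_mul, map_sum, map_pow, eval_xVand, eval_C, eval_X,
    Sum.elim_inr, ← Finset.sum_mul, ← Finset.sum_div]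
  field_simp
  ring

theorem calogeroMoser_const_mul {n m : ℕ} (c : ℂ) (f : (Fin n → ℂ) → ℂ) (x : Fin n → ℂ) :
    calogeroMoser n m (fun y => c * f y) x = c * calogeroMoser n m f x := by
  have h : complexLaplacian (fun y => c * f y) x = c * complexLaplacian f x := by
    simp only [complexLaplacian, iteratedDeriv_const_mul_field, Finset.mul_sum]
  rw [calogeroMoser, calogeroMoser, h]; ring

theorem schrPoly_eq_zero_iff {n m s : ℕ} {R : XLPoly n} :
    schrPoly m s R = 0 ↔ ∀ x lam : Fin n → ℂ, Function.Injective x → Function.Injective lam →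
      calogeroMoser n m (fun y => gaugeFn s R y lam) x =
        -(∑ i, lam i ^ 2) * gaugeFn s R x lam := by
  constructor
  · intro h x lam hx _
    rw [calogeroMoser_gaugeFn m s R lam hx, h]; simp [gaugeFn]
  · intro h
    refine eq_zero_of_eval_injective fun x lam hx hl => ?_
    have h1 := h x lam hx hl
    rw [calogeroMoser_gaugeFn m s R lam hx, sub_eq_self, gaugeFn] at h1
    have hA := vandA_ne_zero_iff.2 hx
    simpa [hA, Complex.exp_ne_zero] using h1

theorem schrodinger_iff {n m : ℕ} {P : XLPoly n} :
    (∀ x lam : Fin n → ℂ, Function.Injective x → Function.Injective lam →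
      calogeroMoser n m (fun y => baFunction m P y lam) x =
        -(∑ i, lam i ^ 2) * baFunction m P x lam) ↔ schrPoly m m P = 0 := by
  rw [schrPoly_eq_zero_iff]
  refine forall_congr' fun x => forall_congr' fun lam => forall_congr' fun _ =>
    forall_congr' fun hl => ?_
  have hc : (vandA lam ^ m)⁻¹ ≠ 0 := inv_ne_zero (pow_ne_zero _ (vandA_ne_zero_iff.2 hl))
  simp only [baFunction_eq_gaugeFn, calogeroMoser_const_mul]
  rw [mul_left_comm, mul_right_inj' hc]

/-! ### Pole order on the hyperplanes `x_i = x_j` -/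

/-- The substitution `x_a ↦ x_b`, where `p = (a, b)`. -/
noncomputable def collapse {n : ℕ} (p : Fin n × Fin n) : XLPoly n →ₐ[ℂ] XLPoly n :=
  aeval fun v => if v = Sum.inl p.1 then X (Sum.inl p.2) else X v

theorem collapse_X_inl {n : ℕ} (p : Fin n × Fin n) (i : Fin n) :
    collapse p (X (Sum.inl i)) = X (Sum.inl (if i = p.1 then p.2 else i)) := by
  rw [collapse, aeval_X]
  split_ifs <;> simp_all

theorem sub_dvd_sub_collapse {n : ℕ} (p : Fin n × Fin n) (R : XLPoly n) :
    X (Sum.inl p.1) - X (Sum.inl p.2) ∣ R - collapse p R := by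
  induction R using MvPolynomial.induction_on with
  | C c => simp [collapse]
  | add q r hq hr =>
    rw [map_add, add_sub_add_comm]; exact dvd_add hq hr
  | mul_X q v hq =>
    have hv : (X (Sum.inl p.1) - X (Sum.inl p.2) : XLPoly n) ∣ X v - collapse p (X v) := by
      rw [collapse, aeval_X]
      split_ifs with h
      · rw [h]
      · simp
    have : q * X v - collapse p (q * X v) =
        (q - collapse p q) * X v + collapse p q * (X v - collapse p (X v)) := by
      rw [map_mul]; ring
    rw [this]
    exact dvd_add (hq.mul_right _) (hv.mul_left _)

theorem collapse_sub_ne_zero {n : ℕ} {p q : Fin n × Fin n} (hp : p ∈ pairs n) (hq : q ∈ pairs n)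
    (hpq : q ≠ p) :
    collapse p (X (Sum.inl q.1) - X (Sum.inl q.2)) ≠ 0 := by
  rw [map_sub, collapse_X_inl, collapse_X_inl, sub_ne_zero]
  intro h
  have h1 := Sum.inl_injective (X_injective h)
  have hp' := mem_pairs.1 hp
  have hq' := mem_pairs.1 hq
  apply hpq
  split_ifs at h1 with h2 h3 h3
  · omega
  · exact Prod.ext h2 h1.symm
  · omega
  · omega

theorem collapse_xVandErase_ne_zero {n : ℕ} {p : Fin n × Fin n} (hp : p ∈ pairs n) :
    collapse p (xVandErase p) ≠ 0 := by
  rw [xVandErase, map_prod, Finset.prod_ne_zero_iff]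
  intro q hq
  exact collapse_sub_ne_zero hp (Finset.mem_of_mem_erase hq) (Finset.ne_of_mem_erase hq)

theorem collapse_xVand {n : ℕ} {p : Fin n × Fin n} (hp : p ∈ pairs n) :
    collapse p (xVand n) = 0 := by
  rw [xVand_eq_mul_xVandErase hp, map_mul, map_sub, collapse_X_inl, collapse_X_inl]
  simp

/-- The exponents of a solution of the Schrödinger equation at the hyperplane `x_a = x_b` are
`-m` and `m + 1`: if the pole has order `s > m`, the leading coefficient vanishes. -/
theorem collapse_eq_zero_of_schrPoly {n m s : ℕ} {R : XLPoly n} (hs : m < s)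
    (h : schrPoly m s R = 0) {p : Fin n × Fin n} (hp : p ∈ pairs n) : collapse p R = 0 := by
  have hA := collapse_xVand hp
  have hB := collapse_xVandErase_ne_zero hp
  have hdA (i : Fin n) : collapse p (pderiv (Sum.inl i) (xVand n)) =
      ((if i = p.1 then 1 else 0) - (if i = p.2 then 1 else 0)) * collapse p (xVandErase p) := by
    rw [xVand_eq_mul_xVandErase hp, Derivation.leibniz, smul_eq_mul, smul_eq_mul, map_add, map_mul,
      map_mul, map_sub, collapse_X_inl, collapse_X_inl, map_sub, pderiv_X, pderiv_X]
    simp only [Pi.single_apply, Sum.inl.injEq, ite_true, ite_self, sub_self, zero_mul, map_sub,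
      apply_ite (collapse p), map_one, map_zero, zero_add, mul_comm (collapse p (xVandErase p)),
      eq_comm (b := i)]
  have hU : collapse p (∑ q ∈ pairs n, C (2 * (m : ℂ) * (m + 1)) * xVandErase q ^ 2) =
      C (2 * (m : ℂ) * (m + 1)) * collapse p (xVandErase p) ^ 2 := by
    rw [map_sum, Finset.sum_eq_single p]
    · simp [collapse]
    · intro q hq hqp
      have h0 := collapse_xVand hp
      rw [xVand_eq_mul_xVandErase hq, map_mul] at h0
      rw [map_mul, map_pow, (mul_eq_zero.1 h0).resolve_left (collapse_sub_ne_zero hp hq hqp)]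
      simp
    · exact fun h => absurd hp h
  have hsum : ∑ i : Fin n, ((if i = p.1 then 1 else 0) - (if i = p.2 then 1 else 0) : XLPoly n) ^ 2
      = 2 := by
    have hne := (mem_pairs.1 hp).ne
    have (i : Fin n) : ((if i = p.1 then 1 else 0) - (if i = p.2 then 1 else 0) : XLPoly n) ^ 2 =
        (if i = p.1 then 1 else 0) + (if i = p.2 then 1 else 0) := by
      split_ifs <;> simp_all
    simp only [this, Finset.sum_add_distrib, Finset.sum_ite_eq', Finset.mem_univ, if_true]
    norm_num
  have hC (c : ℂ) : collapse p (C c) = C c := by simp [collapse]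
  -- On the hyperplane, only the terms in which both derivatives act on the denominator survive.
  have hD (i : Fin n) : collapse p (gaugeDeriv (s + 1) i (gaugeDeriv s i R)) =
      ((if i = p.1 then 1 else 0) - (if i = p.2 then 1 else 0)) ^ 2 *
        (C ((s + 1 : ℕ) * (s : ℂ)) * collapse p (xVandErase p) ^ 2 * collapse p R) := by
    simp only [gaugeDeriv, map_sub, map_mul, hA, hdA, zero_mul, hC, zero_sub]
    ring
  have h1 := congrArg (collapse p) h
  rw [schrPoly, map_sub, map_sub, map_sum, map_mul (collapse p), hU, map_mul (collapse p),
    map_mul (collapse p), map_pow, hA, map_zero,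
    Finset.sum_congr rfl fun i _ => hD i, ← Finset.sum_mul, hsum] at h1
  have h2 : C (2 * ((s + 1 : ℕ) * (s : ℂ)) - 2 * (m : ℂ) * (m + 1)) *
      (collapse p (xVandErase p) ^ 2 * collapse p R) = 0 := by
    rw [← h1]
    simp only [C_sub, C_mul, map_ofNat]
    ring
  have h3 : (2 * ((s + 1 : ℕ) * (s : ℂ)) - 2 * (m : ℂ) * (m + 1)) ≠ 0 := by
    have : 2 * m * (m + 1) < 2 * ((s + 1) * s) := by nlinarith
    rw [sub_ne_zero]
    exact_mod_cast this.ne'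
  exact (mul_eq_zero.1 ((mul_eq_zero.1 h2).resolve_left
    fun h0 => h3 (C_injective _ _ (h0.trans C_0.symm)))).resolve_left
    (pow_ne_zero 2 hB)

theorem xVand_dvd_of_collapse_eq_zero {n : ℕ} {R : XLPoly n}
    (h : ∀ p ∈ pairs n, collapse p R = 0) : xVand n ∣ R := by
  suffices ∀ S ⊆ pairs n, ∏ p ∈ S, (X (Sum.inl p.1) - X (Sum.inl p.2) : XLPoly n) ∣ R by
    rw [xVand, vandA_eq_prod_pairs]; exact this _ subset_rfl
  intro S
  induction S using Finset.induction_on with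
  | empty => simp
  | insert p S hpS ih =>
    intro hS
    have hp : p ∈ pairs n := hS (Finset.mem_insert_self _ _)
    obtain ⟨R', hR'⟩ := ih fun q hq => hS (Finset.mem_insert_of_mem hq)
    have h0 := h p hp
    rw [hR', map_mul] at h0
    have hne : collapse p (∏ q ∈ S, (X (Sum.inl q.1) - X (Sum.inl q.2) : XLPoly n)) ≠ 0 := by
      rw [map_prod, Finset.prod_ne_zero_iff]
      exact fun q hq => collapse_sub_ne_zero hp (hS (Finset.mem_insert_of_mem hq))
        fun hqp => hpS (hqp ▸ hq)
    have h1 := sub_dvd_sub_collapse p R'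
    rw [(mul_eq_zero.1 h0).resolve_left hne, sub_zero] at h1
    rw [Finset.prod_insert hpS, hR', mul_comm]
    exact mul_dvd_mul_left _ h1

theorem gaugeDeriv_succ_xVand_mul {n : ℕ} (s : ℕ) (i : Fin n) (R : XLPoly n) :
    gaugeDeriv (s + 1) i (xVand n * R) = xVand n * gaugeDeriv s i R := by
  simp only [gaugeDeriv, Derivation.leibniz, smul_eq_mul, Nat.cast_add, Nat.cast_one, C_add, C_1]
  ring

theorem schrPoly_succ_xVand_mul {n : ℕ} (m s : ℕ) (R : XLPoly n) :
    schrPoly m (s + 1) (xVand n * R) = xVand n * schrPoly m s R := by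
  simp only [schrPoly, gaugeDeriv_succ_xVand_mul, mul_sub, Finset.mul_sum]
  ring

/-- A solution of the Schrödinger equation has poles of order at most `m`. -/
theorem exists_eq_xVand_pow_mul {n m : ℕ} (r : ℕ) {R : XLPoly n} (h : schrPoly m (m + r) R = 0) :
    ∃ R' : XLPoly n, R = xVand n ^ r * R' ∧ schrPoly m m R' = 0 := by
  induction r generalizing R with
  | zero => exact ⟨R, by simp, h⟩
  | succ r ih =>
    obtain ⟨R₁, rfl⟩ := xVand_dvd_of_collapse_eq_zero fun p hp =>
      collapse_eq_zero_of_schrPoly (by omega) h hp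
    rw [← add_assoc, schrPoly_succ_xVand_mul] at h
    obtain ⟨R', rfl, hR'⟩ := ih ((mul_eq_zero.1 h).resolve_left (xVand_ne_zero n))
    exact ⟨R', by ring, hR'⟩

/-! ### Gradings -/

/-- The homomorphism `X_v ↦ X_v Y^{w_v}`; its coefficients at powers of `Y` are the components of
given `w`-weight. -/
noncomputable def weightHom {σ : Type*} (w : σ → ℕ) :
    MvPolynomial σ ℂ →ₐ[ℂ] Polynomial (MvPolynomial σ ℂ) :=
  aeval fun v => Polynomial.C (X v) * Polynomial.X ^ w v

theorem weightHom_monomial {σ : Type*} [Fintype σ] (w : σ → ℕ) (d : σ →₀ ℕ) (a : ℂ) :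
    weightHom w (monomial d a) = Polynomial.C (monomial d a) * Polynomial.X ^ ∑ v, d v * w v := by
  rw [weightHom, aeval_monomial, Finsupp.prod_fintype _ _ (by simp), monomial_eq,
    Finsupp.prod_fintype _ _ (by simp)]
  simp only [mul_pow, Finset.prod_mul_distrib, ← Polynomial.C_pow, ← map_prod, ← pow_mul,
    Finset.prod_pow_eq_pow_sum, map_mul, mul_comm (w _)]
  rw [mul_assoc]; rfl

theorem coeff_coeff_weightHom {σ : Type*} [Fintype σ] (w : σ → ℕ) (R : MvPolynomial σ ℂ) (j : ℕ)
    (d : σ →₀ ℕ) :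
    ((weightHom w R).coeff j).coeff d = if ∑ v, d v * w v = j then R.coeff d else 0 := by
  classical
  induction R using MvPolynomial.induction_on' with
  | monomial u a =>
    rw [weightHom_monomial, Polynomial.coeff_C_mul_X_pow, apply_ite (coeff d), coeff_monomial,
      coeff_zero]
    split_ifs <;> simp_all
  | add p q hp hq =>
    rw [map_add, Polynomial.coeff_add, coeff_add, hp, hq, coeff_add]
    split_ifs <;> simp

theorem weightHom_injective {σ : Type*} [Fintype σ] (w : σ → ℕ) :
    Function.Injective (weightHom w) := by
  rw [injective_iff_map_eq_zero]
  intro R h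
  ext d
  have := coeff_coeff_weightHom w R (∑ v, d v * w v) d
  simpa [h] using this.symm

theorem degree_weightHom_lt_iff {σ : Type*} [Fintype σ] (w : σ → ℕ) (R : MvPolynomial σ ℂ) (N : ℕ) :
    (weightHom w R).degree < N ↔ ∀ d ∈ R.support, ∑ v, d v * w v < N := by
  rw [Polynomial.degree_lt_iff_coeff_zero]
  constructor
  · intro h d hd
    by_contra! hN
    have h1 := coeff_coeff_weightHom w R (∑ v, d v * w v) d
    rw [h _ hN, if_pos rfl, coeff_zero] at h1
    exact mem_support_iff.1 hd h1.symm
  · intro h j hj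
    ext d
    rw [coeff_coeff_weightHom, coeff_zero, ite_eq_right_iff]
    rintro rfl
    by_contra hd
    exact (h d (mem_support_iff.2 hd)).not_ge hj

/-! ### Uniqueness -/

/-- The weights that count the degree in `λ`. -/
def lamWt (n : ℕ) : Fin n ⊕ Fin n → ℕ := Sum.elim 0 1

/-- The weights that count the degree in `x`. -/
def xWt (n : ℕ) : Fin n ⊕ Fin n → ℕ := Sum.elim 1 0

theorem sum_mul_lamWt {n : ℕ} (d : Fin n ⊕ Fin n →₀ ℕ) :
    ∑ v, d v * lamWt n v = ∑ i, d (Sum.inr i) := by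
  simp [lamWt]

theorem sum_mul_xWt {n : ℕ} (d : Fin n ⊕ Fin n →₀ ℕ) :
    ∑ v, d v * xWt n v = ∑ i, d (Sum.inl i) := by
  simp [xWt]

theorem weightHom_lamWt_C {n : ℕ} (c : ℂ) :
    weightHom (lamWt n) (C c) = Polynomial.C (C c) := by
  rw [weightHom, aeval_C]; rfl

theorem weightHom_lamWt_inl {n : ℕ} (i : Fin n) :
    weightHom (lamWt n) (X (Sum.inl i)) = Polynomial.C (X (Sum.inl i)) := by
  simp [weightHom, lamWt]

theorem weightHom_lamWt_inr {n : ℕ} (i : Fin n) :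
    weightHom (lamWt n) (X (Sum.inr i)) = Polynomial.C (X (Sum.inr i)) * Polynomial.X := by
  simp [weightHom, lamWt]

theorem weightHom_lamWt_xVand (n : ℕ) :
    weightHom (lamWt n) (xVand n) = Polynomial.C (xVand n) := by
  rw [xVand, ← AlgHom.coe_toRingHom, map_vandA, map_vandA]
  simp only [AlgHom.coe_toRingHom, weightHom_lamWt_inl]

theorem weightHom_lamWt_xVandErase {n : ℕ} (p : Fin n × Fin n) :
    weightHom (lamWt n) (xVandErase p) = Polynomial.C (xVandErase p) := by
  simp only [xVandErase, map_prod, map_sub, weightHom_lamWt_inl]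

theorem coeff_weightHom_lamWt_pderiv {n : ℕ} (i : Fin n) (R : XLPoly n) (j : ℕ) :
    (weightHom (lamWt n) (pderiv (Sum.inl i) R)).coeff j =
      pderiv (Sum.inl i) ((weightHom (lamWt n) R).coeff j) := by
  ext d
  rw [coeff_coeff_weightHom, coeff_pderiv, coeff_pderiv, coeff_coeff_weightHom, sum_mul_lamWt,
    sum_mul_lamWt]
  simp [ite_mul]

theorem weightHom_lamWt_pderiv_xVand {n : ℕ} (i : Fin n) :
    weightHom (lamWt n) (pderiv (Sum.inl i) (xVand n)) =
      Polynomial.C (pderiv (Sum.inl i) (xVand n)) := by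
  refine Polynomial.ext fun j => ?_
  rw [coeff_weightHom_lamWt_pderiv, weightHom_lamWt_xVand, Polynomial.coeff_C, Polynomial.coeff_C]
  split_ifs <;> simp

/-- The part of the operator `schrPoly` that preserves the degree in `λ`. -/
noncomputable def schrPolyZero {n : ℕ} (m s : ℕ) (R : XLPoly n) : XLPoly n :=
  ∑ i, (xVand n ^ 2 * pderiv (Sum.inl i) (pderiv (Sum.inl i) R) -
    (C (2 * (s : ℂ)) * xVand n * pderiv (Sum.inl i) (xVand n)) * pderiv (Sum.inl i) R +
    (C ((s : ℂ) * (s + 1)) * pderiv (Sum.inl i) (xVand n) ^ 2 -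
      C (s : ℂ) * xVand n * pderiv (Sum.inl i) (pderiv (Sum.inl i) (xVand n))) * R) -
    (∑ p ∈ pairs n, C (2 * (m : ℂ) * (m + 1)) * xVandErase p ^ 2) * R

theorem schrPoly_eq {n : ℕ} (m s : ℕ) (R : XLPoly n) :
    schrPoly m s R = schrPolyZero m s R +
      ∑ i, X (Sum.inr i) * (2 * xVand n * (xVand n * pderiv (Sum.inl i) R -
        C (s : ℂ) * pderiv (Sum.inl i) (xVand n) * R)) := by
  have hC : (C (2 * (s : ℂ)) : XLPoly n) = 2 * C (s : ℂ) := by rw [C_mul, map_ofNat]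
  rw [schrPoly, schrPolyZero, hC]
  simp only [Finset.sum_mul _ _ (xVand n ^ 2), Finset.sum_mul _ _ R]
  rw [sub_right_comm, sub_add_eq_add_sub, ← Finset.sum_sub_distrib, ← Finset.sum_add_distrib]
  congr 1
  refine Finset.sum_congr rfl fun i _ => ?_
  simp only [gaugeDeriv, Derivation.leibniz, smul_eq_mul, map_add, map_sub, Nat.cast_add,
    Nat.cast_one, C_1, pderiv_C, C_mul, pderiv_X_of_ne (Sum.inr_ne_inl), mul_zero]
  ring

theorem coeff_weightHom_schrPolyZero {n : ℕ} (m s : ℕ) (R : XLPoly n) (j : ℕ) :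
    (weightHom (lamWt n) (schrPolyZero m s R)).coeff j =
      schrPolyZero m s ((weightHom (lamWt n) R).coeff j) := by
  have h2 (i : Fin n) : weightHom (lamWt n) (pderiv (Sum.inl i) (pderiv (Sum.inl i) (xVand n))) =
      Polynomial.C (pderiv (Sum.inl i) (pderiv (Sum.inl i) (xVand n))) := by
    refine Polynomial.ext fun j => ?_
    rw [coeff_weightHom_lamWt_pderiv, weightHom_lamWt_pderiv_xVand, Polynomial.coeff_C,
      Polynomial.coeff_C]
    split_ifs <;> simp
  have hmul {c : XLPoly n} (hc : weightHom (lamWt n) c = Polynomial.C c) (p : XLPoly n) :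
      (weightHom (lamWt n) (c * p)).coeff j = c * (weightHom (lamWt n) p).coeff j := by
    rw [map_mul, hc, Polynomial.coeff_C_mul]
  have h3 (i : Fin n) : weightHom (lamWt n)
      (C (2 * (s : ℂ)) * xVand n * pderiv (Sum.inl i) (xVand n)) =
      Polynomial.C (C (2 * (s : ℂ)) * xVand n * pderiv (Sum.inl i) (xVand n)) := by
    rw [map_mul, map_mul, weightHom_lamWt_C, weightHom_lamWt_xVand, weightHom_lamWt_pderiv_xVand,
      Polynomial.C_mul, Polynomial.C_mul]
  have h4 (i : Fin n) : weightHom (lamWt n)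
      (C ((s : ℂ) * (s + 1)) * pderiv (Sum.inl i) (xVand n) ^ 2 -
        C (s : ℂ) * xVand n * pderiv (Sum.inl i) (pderiv (Sum.inl i) (xVand n))) =
      Polynomial.C (C ((s : ℂ) * (s + 1)) * pderiv (Sum.inl i) (xVand n) ^ 2 -
        C (s : ℂ) * xVand n * pderiv (Sum.inl i) (pderiv (Sum.inl i) (xVand n))) := by
    rw [map_sub, map_mul (weightHom (lamWt n)), map_mul (weightHom (lamWt n)),
      map_mul (weightHom (lamWt n)), map_pow, weightHom_lamWt_C, weightHom_lamWt_C,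
      weightHom_lamWt_xVand, weightHom_lamWt_pderiv_xVand, h2, Polynomial.C_sub, Polynomial.C_mul,
      Polynomial.C_mul, Polynomial.C_mul, Polynomial.C_pow]
  have h5 : weightHom (lamWt n) (∑ p ∈ pairs n, C (2 * (m : ℂ) * (m + 1)) * xVandErase p ^ 2) =
      Polynomial.C (∑ p ∈ pairs n, C (2 * (m : ℂ) * (m + 1)) * xVandErase p ^ 2) := by
    rw [map_sum, map_sum]
    refine Finset.sum_congr rfl fun p _ => ?_
    rw [map_mul, map_pow, weightHom_lamWt_C, weightHom_lamWt_xVandErase, Polynomial.C_mul,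
      Polynomial.C_pow]
  have h6 : weightHom (lamWt n) (xVand n ^ 2) = Polynomial.C (xVand n ^ 2) := by
    rw [map_pow, weightHom_lamWt_xVand, Polynomial.C_pow]
  rw [schrPolyZero, map_sub, Polynomial.coeff_sub, hmul h5, map_sum, Polynomial.finsetSum_coeff,
    schrPolyZero]
  congr 1
  refine Finset.sum_congr rfl fun i _ => ?_
  rw [map_add, map_sub, Polynomial.coeff_add, Polynomial.coeff_sub, hmul h6, hmul (h3 i),
    hmul (h4 i)]
  simp only [coeff_weightHom_lamWt_pderiv]

/-- The restriction of a polynomial in `x` to the line `t ↦ x + t λ`. -/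
noncomputable def lineHom {n : ℕ} (x lam : Fin n → ℂ) : XLPoly n →ₐ[ℂ] Polynomial ℂ :=
  aeval (Sum.elim (fun i => Polynomial.C (lam i) * Polynomial.X + Polynomial.C (x i))
    fun i => Polynomial.C (lam i))

theorem eval_zero_lineHom {n : ℕ} (x lam : Fin n → ℂ) (R : XLPoly n) :
    (lineHom x lam R).eval 0 = eval (Sum.elim x lam) R := by
  induction R using MvPolynomial.induction_on with
  | C c => simp [lineHom]
  | add p q hp hq => simp [hp, hq]
  | mul_X p v hp =>
    rw [map_mul, Polynomial.eval_mul, hp, map_mul, eval_X]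
    cases v <;> simp [lineHom]

theorem derivative_lineHom {n : ℕ} (x lam : Fin n → ℂ) (R : XLPoly n) :
    Polynomial.derivative (lineHom x lam R) =
      lineHom x lam (∑ i, X (Sum.inr i) * pderiv (Sum.inl i) R) := by
  induction R using MvPolynomial.induction_on with
  | C c => simp [lineHom]
  | add p q hp hq => simp only [map_add, hp, hq, mul_add, Finset.sum_add_distrib]
  | mul_X p v hp =>
    have hv : Polynomial.derivative (lineHom x lam (X v)) =
        lineHom x lam (∑ i, X (Sum.inr i) * pderiv (Sum.inl i) (X v)) := by
      cases v <;> simp [lineHom, pderiv_X, Pi.single_apply]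
    rw [map_mul, Polynomial.derivative_mul, hp, hv, ← map_mul, ← map_mul, ← map_add]
    congr 1
    simp only [Derivation.leibniz, smul_eq_mul, Finset.sum_mul, Finset.mul_sum, mul_add,
      Finset.sum_add_distrib]
    rw [add_comm]
    congr 1 <;> exact Finset.sum_congr rfl fun i _ => by ring

theorem natDegree_lineHom_le {n : ℕ} (x lam : Fin n → ℂ) {R : XLPoly n} {N : ℕ}
    (h : ∀ d ∈ R.support, ∑ i, d (Sum.inl i) ≤ N) : (lineHom x lam R).natDegree ≤ N := by
  rw [lineHom, aeval_def, eval₂_eq']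
  refine Polynomial.natDegree_sum_le_of_forall_le _ _ fun d hd => ?_
  refine (Polynomial.natDegree_C_mul_le _ _).trans ((Polynomial.natDegree_prod_le _ _).trans ?_)
  refine le_trans ?_ (h d hd)
  rw [Fintype.sum_sum_type]
  have h1 : ∑ i : Fin n, ((Polynomial.C (lam i)) ^ d (Sum.inr i)).natDegree = 0 := by
    exact Finset.sum_eq_zero fun i _ => by rw [← Polynomial.C_pow, Polynomial.natDegree_C]
  simp only [Sum.elim_inl, Sum.elim_inr, h1, add_zero]
  exact Finset.sum_le_sum fun i _ => Polynomial.natDegree_pow_le_of_le _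
    Polynomial.natDegree_linear_le |>.trans (by simp)

theorem natDegree_lineHom_xVand {n : ℕ} (x : Fin n → ℂ) {lam : Fin n → ℂ}
    (hl : Function.Injective lam) : (lineHom x lam (xVand n)).natDegree = n.choose 2 := by
  have h (p : Fin n × Fin n) : lineHom x lam (X (Sum.inl p.1) - X (Sum.inl p.2)) =
      Polynomial.C (lam p.1 - lam p.2) * Polynomial.X + Polynomial.C (x p.1 - x p.2) := by
    simp only [lineHom, map_sub, aeval_X, Sum.elim_inl]; ring
  have hne (p : Fin n × Fin n) (hp : p ∈ pairs n) : lam p.1 - lam p.2 ≠ 0 :=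
    sub_ne_zero.2 (hl.ne (mem_pairs.1 hp).ne)
  have hdeg (p : Fin n × Fin n) (hp : p ∈ pairs n) :
      (lineHom x lam (X (Sum.inl p.1) - X (Sum.inl p.2))).natDegree = 1 := by
    rw [h, Polynomial.natDegree_linear (hne p hp)]
  rw [xVand, vandA_eq_prod_pairs, map_prod, Polynomial.natDegree_prod _ _ fun p hp h0 => by
    have := hdeg p hp; rw [h0] at this; simp at this, Finset.sum_congr rfl hdeg]
  simp [card_pairs]

/-- Comparison of leading coefficients: if `q' / q = r a' / a` then `deg q = r deg a`. -/
theorem natDegree_eq_of_mul_derivative_eq {a q : Polynomial ℂ} (ha : a ≠ 0) (hq : q ≠ 0) (r : ℕ)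
    (h : a * Polynomial.derivative q = Polynomial.C (r : ℂ) * Polynomial.derivative a * q) :
    q.natDegree = r * a.natDegree := by
  have hX (p : Polynomial ℂ) (j : ℕ) :
      (Polynomial.X * Polynomial.derivative p).coeff j = j * p.coeff j := by
    cases j with
    | zero => simp
    | succ j => simp [Polynomial.coeff_X_mul, Polynomial.coeff_derivative, mul_comm]
  have hXd (p : Polynomial ℂ) :
      (Polynomial.X * Polynomial.derivative p).natDegree ≤ p.natDegree :=
    Polynomial.natDegree_le_iff_coeff_eq_zero.2 fun j hj => by
      rw [hX, Polynomial.coeff_eq_zero_of_natDegree_lt hj, mul_zero]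
  have h1 : a * (Polynomial.X * Polynomial.derivative q) =
      Polynomial.C (r : ℂ) * ((Polynomial.X * Polynomial.derivative a) * q) := by
    linear_combination Polynomial.X * h
  have h2 := congrArg (Polynomial.coeff · (a.natDegree + q.natDegree)) h1
  simp only [Polynomial.coeff_C_mul] at h2
  rw [Polynomial.coeff_mul_add_eq_of_natDegree_le le_rfl (hXd q),
    Polynomial.coeff_mul_add_eq_of_natDegree_le (hXd a) le_rfl, hX, hX] at h2
  have h3 : ((q.natDegree : ℂ) - r * a.natDegree) * (a.leadingCoeff * q.leadingCoeff) = 0 := by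
    simp only [Polynomial.leadingCoeff]
    linear_combination h2
  have h4 := (mul_eq_zero.1 h3).resolve_right
    (mul_ne_zero (Polynomial.leadingCoeff_ne_zero.2 ha) (Polynomial.leadingCoeff_ne_zero.2 hq))
  exact_mod_cast sub_eq_zero.1 h4

/-- A solution `R / A(x)^m · e^{(λ, x)}` with `deg_x R < m n(n-1)/2` vanishes: the leading
coefficient `R_J` of `R` in `λ` is such that `R_J / A(x)^m` is constant on the lines
`t ↦ x + t λ`, and tends to zero at infinity. -/
theorem eq_zero_of_schrPoly_eq_zero {n m : ℕ} {R : XLPoly n} (h : schrPoly m m R = 0)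
    (hdeg : ∀ d ∈ R.support, ∑ i, d (Sum.inl i) < m * n.choose 2) : R = 0 := by
  by_contra hR
  set χ := weightHom (lamWt n)
  have hχ : χ R ≠ 0 := fun h0 => hR (weightHom_injective (lamWt n) (by rw [map_zero]; exact h0))
  set J := (χ R).natDegree
  set RJ := (χ R).coeff J with hRJ
  have hRJ0 : RJ ≠ 0 := Polynomial.leadingCoeff_ne_zero.2 hχ
  have hzero : schrPolyZero m m (0 : XLPoly n) = 0 := by simp [schrPolyZero]
  -- The coefficient of degree `J + 1` in `λ` of the equation only involves `R_J`.
  have htop : ∑ i, X (Sum.inr i) * (2 * xVand n * (xVand n * pderiv (Sum.inl i) RJ -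
        C (m : ℂ) * pderiv (Sum.inl i) (xVand n) * RJ)) = 0 := by
    have h1 := congrArg (fun p => (χ p).coeff (J + 1)) h
    simp only [schrPoly_eq, map_add, map_zero, Polynomial.coeff_add, Polynomial.coeff_zero] at h1
    rw [coeff_weightHom_schrPolyZero,
      Polynomial.coeff_eq_zero_of_natDegree_lt (Nat.lt_succ_self _), hzero, zero_add, map_sum,
      Polynomial.finsetSum_coeff] at h1
    rw [← h1]
    refine Finset.sum_congr rfl fun i _ => ?_
    have h2 : (2 : Polynomial (XLPoly n)) = Polynomial.C 2 := (map_ofNat Polynomial.C 2).symm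
    rw [map_mul, map_mul, map_sub, map_mul, map_mul, map_mul, map_mul, weightHom_lamWt_inr,
      weightHom_lamWt_C, weightHom_lamWt_xVand, weightHom_lamWt_pderiv_xVand, map_ofNat, h2]
    have h3 : Polynomial.C (X (Sum.inr i)) * Polynomial.X * (Polynomial.C 2 *
        Polynomial.C (xVand n) * (Polynomial.C (xVand n) * χ (pderiv (Sum.inl i) R) -
          Polynomial.C (C (m : ℂ)) * Polynomial.C (pderiv (Sum.inl i) (xVand n)) * χ R)) =
        Polynomial.X * (Polynomial.C (X (Sum.inr i) * (2 * xVand n)) *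
          (Polynomial.C (xVand n) * χ (pderiv (Sum.inl i) R) -
          Polynomial.C (C (m : ℂ) * pderiv (Sum.inl i) (xVand n)) * χ R)) := by
      simp only [Polynomial.C_mul]; ring
    rw [h3, Polynomial.coeff_X_mul, Polynomial.coeff_C_mul, Polynomial.coeff_sub,
      Polynomial.coeff_C_mul, Polynomial.coeff_C_mul, coeff_weightHom_lamWt_pderiv, ← mul_assoc]
  have htop' : xVand n * ∑ i, X (Sum.inr i) * pderiv (Sum.inl i) RJ =
      C (m : ℂ) * (∑ i, X (Sum.inr i) * pderiv (Sum.inl i) (xVand n)) * RJ := by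
    have h2 : 2 * xVand n ≠ 0 := mul_ne_zero two_ne_zero (xVand_ne_zero n)
    refine mul_left_cancel₀ h2 (sub_eq_zero.1 ?_)
    rw [← htop]
    simp only [Finset.mul_sum, Finset.sum_mul]
    rw [← Finset.sum_sub_distrib]
    exact Finset.sum_congr rfl fun i _ => by ring
  have hsupp : ∀ d ∈ RJ.support, ∑ i, d (Sum.inl i) ≤ m * n.choose 2 - 1 := by
    intro d hd
    rw [mem_support_iff, hRJ, coeff_coeff_weightHom] at hd
    have := hdeg d (mem_support_iff.2 fun h0 => hd (by simp [h0]))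
    omega
  have hpos : 0 < m * n.choose 2 := by
    obtain ⟨d, hd⟩ := (support_nonempty.2 hR)
    exact (Nat.zero_le _).trans_lt (hdeg d hd)
  refine hRJ0 (eq_zero_of_eval_injective fun x lam hx hl => ?_)
  rw [← eval_zero_lineHom]
  suffices lineHom x lam RJ = 0 by rw [this, Polynomial.eval_zero]
  by_contra hq
  have ha : lineHom x lam (xVand n) ≠ 0 := fun h0 => by
    have h1 := eval_zero_lineHom x lam (xVand n)
    rw [h0, Polynomial.eval_zero, eval_xVand] at h1
    exact vandA_ne_zero_iff.2 hx h1.symm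
  have h1 := natDegree_eq_of_mul_derivative_eq ha hq m (by
    rw [derivative_lineHom, derivative_lineHom, ← map_mul, htop']
    simp [lineHom])
  rw [natDegree_lineHom_xVand x hl] at h1
  have h2 := natDegree_lineHom_le x lam hsupp
  omega

theorem gaugeDeriv_sub {n : ℕ} (s : ℕ) (i : Fin n) (R R' : XLPoly n) :
    gaugeDeriv s i (R - R') = gaugeDeriv s i R - gaugeDeriv s i R' := by
  simp only [gaugeDeriv, map_sub]
  ring

theorem schrPoly_sub {n : ℕ} (m s : ℕ) (R R' : XLPoly n) :
    schrPoly m s (R - R') = schrPoly m s R - schrPoly m s R' := by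
  simp only [schrPoly, gaugeDeriv_sub, Finset.sum_sub_distrib]
  ring

theorem IsBAPolynomial.eq {n m : ℕ} {P P' : XLPoly n} (h : IsBAPolynomial n m P)
    (h' : IsBAPolynomial n m P') : P = P' := by
  rw [← sub_eq_zero]
  refine eq_zero_of_schrPoly_eq_zero (m := m) ?_ fun d hd => ?_
  · rw [schrPoly_sub, schrodinger_iff.1 h.schrodinger, schrodinger_iff.1 h'.schrodinger, sub_zero]
  · have hd' : d ∈ (P - baLeading n m).support ∨ d ∈ (P' - baLeading n m).support := by
      by_contra! hcon
      rw [notMem_support_iff, notMem_support_iff] at hcon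
      rw [← sub_sub_sub_cancel_right P P' (baLeading n m), mem_support_iff, coeff_sub, hcon.1,
        hcon.2, sub_zero] at hd
      exact hd rfl
    exact hd'.elim (h.degree_x d) (h'.degree_x d)

/-! ### Torus integrals -/

section TorusIntegral

open MeasureTheory Set Metric

theorem continuous_torusMap {k : ℕ} (c : Fin k → ℂ) (R : Fin k → ℝ) :
    Continuous (torusMap c R) := by
  unfold torusMap
  fun_prop

theorem torusIntegrable_of_continuousOn {k : ℕ} {f : (Fin k → ℂ) → ℂ} {c : Fin k → ℂ}
    {R : Fin k → ℝ} (hf : ContinuousOn f (range (torusMap c R))) : TorusIntegrable f c R :=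
  ((hf.comp_continuous (continuous_torusMap c R) fun θ =>
    mem_range_self θ).continuousOn).integrableOn_compact isCompact_Icc

theorem torusIntegral_congr {k : ℕ} {f g : (Fin k → ℂ) → ℂ} {c : Fin k → ℂ} {R : Fin k → ℝ}
    (h : ∀ θ, f (torusMap c R θ) = g (torusMap c R θ)) :
    torusIntegral f c R = torusIntegral g c R := by
  simp only [torusIntegral, h]

/-- Differentiation of a torus integral with respect to a parameter. -/
theorem hasDerivAt_torusIntegral {k : ℕ} {F F' : ℂ → (Fin k → ℂ) → ℂ} {c : Fin k → ℂ}
    {R : Fin k → ℝ} {t₀ : ℂ} {W : Set (ℂ × (Fin k → ℂ))} (hW : IsOpen W)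
    (hsub : ∀ θ, (t₀, torusMap c R θ) ∈ W)
    (hF' : ContinuousOn (fun p : ℂ × (Fin k → ℂ) => F' p.1 p.2) W)
    (hF : ContinuousOn (fun p : ℂ × (Fin k → ℂ) => F p.1 p.2) W)
    (hd : ∀ p ∈ W, HasDerivAt (fun t => F t p.2) (F' p.1 p.2) p.1) :
    HasDerivAt (fun t => torusIntegral (F t) c R) (torusIntegral (F' t₀) c R) t₀ := by
  set T : Set (Fin k → ℂ) := torusMap c R '' Icc 0 fun _ => 2 * Real.pi with hT
  have hTc : IsCompact T := isCompact_Icc.image (continuous_torusMap c R)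
  obtain ⟨U, V, hU, -, htU, hTV, hUV⟩ := generalized_tube_lemma (isCompact_singleton (x := t₀))
    hTc hW (by
      rintro ⟨t, z⟩ ⟨ht, ⟨θ, -, rfl⟩⟩
      obtain rfl : t = t₀ := ht
      exact hsub θ)
  obtain ⟨r, hr, hrU⟩ := Metric.nhds_basis_closedBall.mem_iff.1 (hU.mem_nhds (htU rfl))
  have hK : closedBall t₀ r ×ˢ T ⊆ W := (prod_mono hrU hTV).trans hUV
  obtain ⟨M, hM⟩ := ((isCompact_closedBall t₀ r).prod hTc).exists_bound_of_continuousOn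
    (hF'.mono hK)
  have hcont (G : ℂ → (Fin k → ℂ) → ℂ)
      (hG : ContinuousOn (fun p : ℂ × (Fin k → ℂ) => G p.1 p.2) W) (t : ℂ)
      (ht : t ∈ closedBall t₀ r) : ContinuousOn
        (fun θ : Fin k → ℝ => (∏ i, R i * Complex.exp (θ i * Complex.I) * Complex.I : ℂ) •
          G t (torusMap c R θ)) (Icc 0 fun _ => 2 * Real.pi) := by
    have hc : Continuous fun θ : Fin k → ℝ =>
        (∏ i, R i * Complex.exp (θ i * Complex.I) * Complex.I : ℂ) := by fun_prop
    refine hc.continuousOn.smul ?_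
    have : ContinuousOn (fun θ => (t, torusMap c R θ)) (Icc 0 fun _ => 2 * Real.pi) :=
      (continuous_const.prodMk (continuous_torusMap c R)).continuousOn
    exact hG.comp this fun θ hθ => hK ⟨ht, ⟨θ, hθ, rfl⟩⟩
  have hball : ball t₀ r ⊆ closedBall t₀ r := ball_subset_closedBall
  unfold torusIntegral
  refine (hasDerivAt_integral_of_dominated_loc_of_deriv_le (ball_mem_nhds t₀ hr)
    (F := fun t θ => (∏ i, R i * Complex.exp (θ i * Complex.I) * Complex.I : ℂ) •
      F t (torusMap c R θ))
    (F' := fun t θ => (∏ i, R i * Complex.exp (θ i * Complex.I) * Complex.I : ℂ) •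
      F' t (torusMap c R θ)) (bound := fun _ => (∏ i, |R i|) * M) ?_ ?_ ?_ ?_ ?_ ?_).2
  · filter_upwards [ball_mem_nhds t₀ hr] with t ht
    exact (hcont F hF t (hball ht)).aestronglyMeasurable measurableSet_Icc
  · exact (hcont F hF t₀ (mem_closedBall_self hr.le)).integrableOn_compact isCompact_Icc
  · exact (hcont F' hF' t₀ (mem_closedBall_self hr.le)).aestronglyMeasurable measurableSet_Icc
  · refine (ae_restrict_iff' measurableSet_Icc).2 (Filter.Eventually.of_forall fun θ hθ t ht => ?_)
    rw [norm_smul, norm_prod]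
    refine mul_le_mul (le_of_eq (Finset.prod_congr rfl fun i _ => ?_))
      (hM (t, torusMap c R θ) ⟨hball ht, θ, hθ, rfl⟩) (norm_nonneg _)
      (Finset.prod_nonneg fun i _ => abs_nonneg _)
    simp [Complex.norm_exp_ofReal_mul_I]
  · exact integrableOn_const (measure_Icc_lt_top.ne)
  · refine (ae_restrict_iff' measurableSet_Icc).2 (Filter.Eventually.of_forall fun θ hθ t ht => ?_)
    exact (hd (t, torusMap c R θ) (hK ⟨hball ht, θ, hθ, rfl⟩)).fun_const_smul _

/-- The torus integral of a partial derivative vanishes. -/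
theorem torusIntegral_eq_zero_of_hasDerivAt {k : ℕ} {g g' : (Fin k → ℂ) → ℂ} {c : Fin k → ℂ}
    {R : Fin k → ℝ} {U : Set (Fin k → ℂ)} (hU : IsOpen U) (hsub : ∀ θ, torusMap c R θ ∈ U)
    (hg' : ContinuousOn g' U) (hg : ContinuousOn g U) (i : Fin k)
    (hd : ∀ z ∈ U, HasDerivAt (fun t => g (Function.update z i t)) (g' z) (z i)) :
    torusIntegral g' c R = 0 := by
  obtain _ | k := k
  · exact i.elim0
  -- The innermost integral, over `z_i`, is that of the derivative of a function of `z_i`.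
  rw [torusIntegral_succAbove (torusIntegrable_of_continuousOn
    (hg'.mono (range_subset_iff.2 hsub))) i]
  refine circleIntegral.integral_eq_zero_of_hasDerivWithinAt'
    (f := fun z => torusIntegral (fun y => g (i.insertNth z y)) (c ∘ i.succAbove)
      (R ∘ i.succAbove)) fun z hz => HasDerivAt.hasDerivWithinAt ?_
  have hcont : Continuous fun p : ℂ × (Fin k → ℂ) => (i.insertNth p.1 p.2 : Fin (k + 1) → ℂ) :=
    Continuous.finInsertNth (A := fun _ => ℂ) i continuous_fst continuous_snd
  refine hasDerivAt_torusIntegral (F := fun z y => g (i.insertNth z y))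
    (F' := fun z y => g' (i.insertNth z y))
    (W := (fun p : ℂ × (Fin k → ℂ) => (i.insertNth p.1 p.2 : Fin (k + 1) → ℂ)) ⁻¹' U)
    (hU.preimage hcont) (fun θ => ?_) (hg'.comp hcont.continuousOn fun p hp => hp)
    (hg.comp hcont.continuousOn fun p hp => hp) fun p hp => ?_
  · rw [← range_circleMap] at hz
    obtain ⟨φ, rfl⟩ := hz
    have : (i.insertNth (circleMap (c i) (R i) φ)
        (torusMap (c ∘ i.succAbove) (R ∘ i.succAbove) θ) : Fin (k + 1) → ℂ) =
        torusMap c R (i.insertNth φ θ) := by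
      funext j
      refine i.succAboveCases ?_ (fun j => ?_) j
      · simp [torusMap, circleMap]
      · simp [torusMap]
    rw [mem_preimage, this]
    exact hsub _
  · have := hd _ hp
    simpa only [Fin.insertNth_apply_same, Fin.update_insertNth] using this

/-- The torus integral of a product of functions of one variable. -/
theorem torusIntegral_prod {k : ℕ} (f : Fin k → ℂ → ℂ) (c : Fin k → ℂ) (R : Fin k → ℝ) :
    torusIntegral (fun z => ∏ i, f i (z i)) c R = ∏ i, circleIntegral (f i) (c i) (R i) := by
  simp only [circleIntegral_def_Icc, torusIntegral, smul_eq_mul, ← Finset.prod_mul_distrib]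
  rw [← integral_fintype_prod_eq_prod, volume_pi, ← Set.pi_univ_Icc, Measure.restrict_pi_pi]
  refine integral_congr_ae (Filter.Eventually.of_forall fun θ => ?_)
  refine Finset.prod_congr rfl fun i _ => ?_
  simp [torusMap, circleMap, deriv_circleMap]

theorem torusIntegrable_sum {k : ℕ} {ι : Type*} (s : Finset ι) {f : ι → (Fin k → ℂ) → ℂ}
    {c : Fin k → ℂ} {R : Fin k → ℝ} (hf : ∀ a ∈ s, TorusIntegrable (f a) c R) :
    TorusIntegrable (fun z => ∑ a ∈ s, f a z) c R :=
  integrable_finsetSum s hf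

theorem torusIntegral_sum {k : ℕ} {ι : Type*} (s : Finset ι) {f : ι → (Fin k → ℂ) → ℂ}
    {c : Fin k → ℂ} {R : Fin k → ℝ} (hf : ∀ a ∈ s, TorusIntegrable (f a) c R) :
    torusIntegral (fun z => ∑ a ∈ s, f a z) c R = ∑ a ∈ s, torusIntegral (f a) c R := by
  simp only [torusIntegral, Finset.smul_sum]
  exact integral_finsetSum s fun a ha => (hf a ha).function_integrable

theorem torusIntegral_mul_left {k : ℕ} (f : (Fin k → ℂ) → ℂ) (c : Fin k → ℂ) (R : Fin k → ℝ)
    (s : ℝ) :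
    torusIntegral f (fun i => s * c i) (fun i => s * R i) =
      s ^ k * torusIntegral (fun z => f fun i => s * z i) c R := by
  rw [← torusIntegral_const_mul]
  simp only [torusIntegral, smul_eq_mul]
  congr 1
  funext θ
  have : torusMap (fun i => (s : ℂ) * c i) (fun i => s * R i) θ =
      fun i => (s : ℂ) * torusMap c R θ i := by
    funext i; simp [torusMap]; ring
  rw [this]
  simp only [Complex.ofReal_mul, mul_assoc, Finset.prod_mul_distrib, Finset.prod_const,
    Finset.card_univ, Fintype.card_fin]
  ring

/-- **Cauchy's formula** for the successive derivatives `g 0, g 1, …` of a function. -/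
theorem circleIntegral_div_sub_pow {g : ℕ → ℂ → ℂ} {c w : ℂ} {ε : ℝ} (hw : w ∈ ball c ε)
    (hg : ∀ l, ∀ z ∈ closedBall c ε, HasDerivAt (g l) (g (l + 1) z) z) (m l : ℕ) :
    (∮ z in C(c, ε), g l z / (z - w) ^ (m + 1)) =
      2 * Real.pi * Complex.I / (m.factorial : ℂ) * g (l + m) w := by
  have hε : 0 < ε := dist_nonneg.trans_lt hw
  induction m generalizing l with
  | zero =>
    have h := DifferentiableOn.circleIntegral_sub_inv_smul
      (fun z hz => (hg l z hz).differentiableAt.differentiableWithinAt) hw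
    simp only [smul_eq_mul] at h
    simpa [div_eq_inv_mul] using h
  | succ m ih =>
    have hne (z : ℂ) (hz : z ∈ sphere c ε) : z - w ≠ 0 := by
      rintro h0
      rw [sub_eq_zero] at h0
      subst h0
      exact (mem_ball.1 hw).ne (mem_sphere.1 hz)
    have hcont (l r : ℕ) : ContinuousOn (fun z => g l z / (z - w) ^ r) (sphere c ε) :=
      ContinuousOn.div (fun z hz =>
        (hg l z (sphere_subset_closedBall hz)).continuousAt.continuousWithinAt)
        (by fun_prop) fun z hz => pow_ne_zero _ (hne z hz)
    have hint (l r : ℕ) : CircleIntegrable (fun z => g l z / (z - w) ^ r) c ε :=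
      (hcont l r).circleIntegrable hε.le
    -- Integration by parts lowers the order of the pole.
    have hzero : (∮ z in C(c, ε), (g (l + 1) z / (z - w) ^ (m + 1) -
        (m + 1 : ℂ) * (g l z / (z - w) ^ (m + 2)))) = 0 := by
      refine circleIntegral.integral_eq_zero_of_hasDerivWithinAt hε.le
        (f := fun z => g l z / (z - w) ^ (m + 1)) fun z hz => HasDerivAt.hasDerivWithinAt ?_
      have h1 := hg l z (sphere_subset_closedBall hz)
      have h2 : HasDerivAt (fun z => (z - w) ^ (m + 1)) ((m + 1 : ℂ) * (z - w) ^ m) z := by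
        simpa using ((hasDerivAt_id' z).sub_const w).fun_pow (m + 1)
      refine (h1.fun_div h2 (pow_ne_zero _ (hne z hz))).congr_deriv ?_
      have := hne z hz
      field_simp
      ring
    have hint' : CircleIntegrable (fun z => (m + 1 : ℂ) * (g l z / (z - w) ^ (m + 2))) c ε :=
      (continuousOn_const.mul (hcont _ _)).circleIntegrable hε.le
    rw [circleIntegral.integral_sub (hint _ _) hint', circleIntegral.integral_const_mul, ih,
      sub_eq_zero] at hzero
    have hm : (m + 1 : ℂ) ≠ 0 := by exact_mod_cast Nat.succ_ne_zero m
    rw [show m + 1 + 1 = m + 2 from rfl, ← mul_right_inj' hm, ← hzero, Nat.factorial_succ,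
      show l + 1 + m = l + (m + 1) by ring]
    push_cast
    have := Nat.factorial_ne_zero m
    field_simp

end TorusIntegral

/-! ### The kernel function -/

theorem sum_pairs_add_swap {M : Type*} [AddCommMonoid M] {n : ℕ} (f : Fin n → Fin n → M)
    (hf : ∀ i, f i i = 0) :
    ∑ p ∈ pairs n, (f p.1 p.2 + f p.2 p.1) = ∑ i, ∑ j, f i j := by
  have h1 : ∑ i, ∑ j, f i j = ∑ q : Fin n × Fin n,
      ((if q.1 < q.2 then f q.1 q.2 else 0) + (if q.2 < q.1 then f q.1 q.2 else 0)) := by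
    rw [← Fintype.sum_prod_type']
    refine Finset.sum_congr rfl fun q _ => ?_
    rcases lt_trichotomy q.1 q.2 with h | h | h
    · simp [h, h.not_gt]
    · simp [h, hf]
    · simp [h, h.not_gt]
  have h2 : ∑ q : Fin n × Fin n, (if q.2 < q.1 then f q.1 q.2 else 0) =
      ∑ q : Fin n × Fin n, (if q.1 < q.2 then f q.2 q.1 else 0) :=
    Fintype.sum_equiv (Equiv.prodComm _ _) _ _ fun q => rfl
  rw [h1, Finset.sum_add_distrib, Finset.sum_add_distrib, h2, pairs, Finset.sum_filter,
    Finset.sum_filter]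

theorem potential_eq {n : ℕ} (m : ℕ) (x : Fin n → ℂ) :
    ∑ i : Fin n, ∑ j ∈ Finset.Ioi i, 2 * (m : ℂ) * ((m : ℂ) + 1) / (x i - x j) ^ 2 =
      (m : ℂ) * (m + 1) * ∑ i, ∑ j, (x i - x j)⁻¹ ^ 2 := by
  rw [sum_Ioi_eq_sum_pairs fun i j => 2 * (m : ℂ) * ((m : ℂ) + 1) / (x i - x j) ^ 2,
    ← sum_pairs_add_swap (fun i j => (x i - x j)⁻¹ ^ 2) (by simp), Finset.mul_sum]
  refine Finset.sum_congr rfl fun p _ => ?_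
  rw [← neg_sub (x p.1) (x p.2), inv_neg, neg_sq, div_eq_mul_inv, inv_pow]
  ring

/-- The identity behind the kernel function: particles `y_i` with charges `s_i = ±1`. The terms
with `J = I` vanish since `0⁻¹ = 0`; the three-body terms cancel. -/
theorem sum_charge_identity {ι : Type*} [Fintype ι] {y s : ι → ℂ}
    (hy : Function.Injective y) (hs : ∀ i, s i ^ 2 = 1) (b l : ℂ) :
    ∑ I, s I * ((b * (∑ J, s J * (y I - y J)⁻¹) + l) ^ 2 -
        s I * b * ∑ J, s J * (y I - y J)⁻¹ ^ 2) =
      l ^ 2 * ∑ I, s I + (b ^ 2 - b) * ∑ I, ∑ J, s I * (y I - y J)⁻¹ ^ 2 := by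
  classical
  have hanti : ∑ I, ∑ J, s I * s J * (y I - y J)⁻¹ = 0 := by
    have h : ∑ I, ∑ J, s I * s J * (y I - y J)⁻¹ = -∑ I, ∑ J, s I * s J * (y I - y J)⁻¹ := by
      conv_lhs => rw [Finset.sum_comm]
      simp only [← Finset.sum_neg_distrib]
      refine Finset.sum_congr rfl fun I _ => Finset.sum_congr rfl fun J _ => ?_
      rw [← neg_sub (y I) (y J), inv_neg]; ring
    exact self_eq_neg.1 h
  have hswap : ∑ I, ∑ J, s J * (y I - y J)⁻¹ ^ 2 = ∑ I, ∑ J, s I * (y I - y J)⁻¹ ^ 2 := by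
    rw [Finset.sum_comm]
    refine Finset.sum_congr rfl fun I _ => Finset.sum_congr rfl fun J _ => ?_
    rw [← neg_sub (y I) (y J), inv_neg, neg_sq]
  -- For distinct indices the cyclic sum vanishes; the right side accounts for coincidences.
  have hcyc (I J K : ι) : (y I - y J)⁻¹ * (y I - y K)⁻¹ + (y J - y K)⁻¹ * (y J - y I)⁻¹ +
      (y K - y I)⁻¹ * (y K - y J)⁻¹ = (if J = K then (y I - y J)⁻¹ ^ 2 else 0) +
        (if K = I then (y J - y K)⁻¹ ^ 2 else 0) + (if I = J then (y K - y I)⁻¹ ^ 2 else 0) := by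
    have e (i j : ι) : (y j - y i)⁻¹ = -(y i - y j)⁻¹ := by rw [← neg_sub, inv_neg]
    rw [e K I, e I J, e J K]
    by_cases h1 : I = J
    · subst h1
      by_cases h2 : K = I
      · subst h2; simp
      · rw [if_neg (Ne.symm h2), if_neg h2, if_pos rfl, e K I, sub_self, inv_zero]; ring
    · by_cases h2 : J = K
      · subst h2
        rw [if_pos rfl, if_neg (Ne.symm h1), if_neg h1, e I J, sub_self, inv_zero]; ring
      · by_cases h3 : K = I
        · subst h3
          rw [if_neg h2, if_pos rfl, if_neg h1, e J K, sub_self, inv_zero]; ring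
        · have e1 := sub_ne_zero.2 (hy.ne h1)
          have e2 := sub_ne_zero.2 (hy.ne h2)
          have e3 := sub_ne_zero.2 (hy.ne h3)
          simp only [h1, h2, h3, if_false, add_zero]
          field_simp
          ring
  have hrot (f : ι → ι → ι → ℂ) : ∑ I, ∑ J, ∑ K, f J K I = ∑ I, ∑ J, ∑ K, f I J K := by
    rw [Finset.sum_comm]
    exact Finset.sum_congr rfl fun J _ => Finset.sum_comm
  have htriple : ∑ I, ∑ J, ∑ K, s I * s J * s K * ((y I - y J)⁻¹ * (y I - y K)⁻¹) =
      ∑ I, ∑ J, s I * (y I - y J)⁻¹ ^ 2 := by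
    set T := ∑ I, ∑ J, ∑ K, s I * s J * s K * ((y I - y J)⁻¹ * (y I - y K)⁻¹) with hT
    set D := ∑ I, ∑ J, s I * (y I - y J)⁻¹ ^ 2 with hD
    have h1 := hrot fun I J K => s I * s J * s K * ((y I - y J)⁻¹ * (y I - y K)⁻¹)
    have h2 := hrot fun I J K => s J * s K * s I * ((y J - y K)⁻¹ * (y J - y I)⁻¹)
    have d1 := hrot fun I J K => if J = K then s I * s J * s K * (y I - y J)⁻¹ ^ 2 else 0
    have d2 := hrot fun I J K => if K = I then s J * s K * s I * (y J - y K)⁻¹ ^ 2 else 0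
    have d0 : ∑ I, ∑ J, ∑ K, (if J = K then s I * s J * s K * (y I - y J)⁻¹ ^ 2 else 0) = D := by
      refine Finset.sum_congr rfl fun I _ => Finset.sum_congr rfl fun J _ => ?_
      rw [Finset.sum_ite_eq Finset.univ J]
      simp only [Finset.mem_univ, if_true]
      linear_combination s I * (y I - y J)⁻¹ ^ 2 * hs J
    have h3 : T + (∑ I, ∑ J, ∑ K, s J * s K * s I * ((y J - y K)⁻¹ * (y J - y I)⁻¹)) +
        (∑ I, ∑ J, ∑ K, s K * s I * s J * ((y K - y I)⁻¹ * (y K - y J)⁻¹)) =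
        (∑ I, ∑ J, ∑ K, (if J = K then s I * s J * s K * (y I - y J)⁻¹ ^ 2 else 0)) +
        (∑ I, ∑ J, ∑ K, (if K = I then s J * s K * s I * (y J - y K)⁻¹ ^ 2 else 0)) +
        (∑ I, ∑ J, ∑ K, (if I = J then s K * s I * s J * (y K - y I)⁻¹ ^ 2 else 0)) := by
      simp only [hT, ← Finset.sum_add_distrib]
      refine Finset.sum_congr rfl fun I _ => Finset.sum_congr rfl fun J _ =>
        Finset.sum_congr rfl fun K _ => ?_
      have e1 (p : Prop) [Decidable p] (u v : ℂ) :
          (if p then u * v else 0) = u * if p then v else 0 := by split_ifs <;> simp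
      rw [e1, e1, e1]
      linear_combination (s I * s J * s K) * hcyc I J K
    linear_combination (h3 - 2 * h1 - h2 + 2 * d1 + d2 + 3 * d0) / 3
  have hI (I : ι) : s I * ((b * (∑ J, s J * (y I - y J)⁻¹) + l) ^ 2 -
        s I * b * ∑ J, s J * (y I - y J)⁻¹ ^ 2) =
      b ^ 2 * (∑ J, ∑ K, s I * s J * s K * ((y I - y J)⁻¹ * (y I - y K)⁻¹)) +
      2 * b * l * (∑ J, s I * s J * (y I - y J)⁻¹) + l ^ 2 * s I -
      b * ∑ J, s J * (y I - y J)⁻¹ ^ 2 := by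
    have e1 : ∑ J, ∑ K, s I * s J * s K * ((y I - y J)⁻¹ * (y I - y K)⁻¹) =
        s I * (∑ J, s J * (y I - y J)⁻¹) ^ 2 := by
      rw [sq, Finset.sum_mul_sum, Finset.mul_sum]
      refine Finset.sum_congr rfl fun J _ => ?_
      rw [Finset.mul_sum]
      exact Finset.sum_congr rfl fun K _ => by ring
    have e2 : ∑ J, s I * s J * (y I - y J)⁻¹ = s I * ∑ J, s J * (y I - y J)⁻¹ := by
      rw [Finset.mul_sum]; exact Finset.sum_congr rfl fun J _ => by ring
    rw [e1, e2]
    linear_combination (-b * ∑ J, s J * (y I - y J)⁻¹ ^ 2) * hs I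
  simp only [hI, Finset.sum_add_distrib, Finset.sum_sub_distrib]
  rw [← Finset.mul_sum, ← Finset.mul_sum, ← Finset.mul_sum, ← Finset.mul_sum]
  rw [htriple, hanti, hswap]
  ring

/-- The charges `+1` of the particles `x_j` and `-1` of the particles `z_i`. -/
def charge (k : ℕ) : Fin (k + 1) ⊕ Fin k → ℂ := Sum.elim 1 (-1)

theorem charge_sq {k : ℕ} (v : Fin (k + 1) ⊕ Fin k) : charge k v ^ 2 = 1 := by
  cases v <;> simp [charge]

/-- The force `∑_w s_w / (y_v - y_w)` on the particle `v`. -/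
noncomputable def chargeSum {k : ℕ} (v : Fin (k + 1) ⊕ Fin k) (y : Fin (k + 1) ⊕ Fin k → ℂ) : ℂ :=
  ∑ w, charge k w * (y v - y w)⁻¹

/-- The kernel `A(x)^b A(z)^b / A(z, x)^b · e^{l (x̄ - z̄)}`, as a function of `y = (x, z)`. -/
noncomputable def kernelFn {k : ℕ} (b : ℕ) (l : ℂ) (y : Fin (k + 1) ⊕ Fin k → ℂ) : ℂ :=
  vandA (y ∘ Sum.inl) ^ b * vandA (y ∘ Sum.inr) ^ b / crossA (y ∘ Sum.inr) (y ∘ Sum.inl) ^ b *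
    Complex.exp (l * (∑ j, y (Sum.inl j) - ∑ i, y (Sum.inr i)))

/-- The partial derivative of `kernelFn` in the coordinate `v`. -/
noncomputable def kernelDeriv {k : ℕ} (b : ℕ) (l : ℂ) (v : Fin (k + 1) ⊕ Fin k)
    (y : Fin (k + 1) ⊕ Fin k → ℂ) : ℂ :=
  kernelFn b l y * (charge k v * (b * chargeSum v y + l))

/-- The second partial derivative of `kernelFn` in the coordinate `v`. -/
noncomputable def kernelDerivTwo {k : ℕ} (b : ℕ) (l : ℂ) (v : Fin (k + 1) ⊕ Fin k)
    (y : Fin (k + 1) ⊕ Fin k → ℂ) : ℂ :=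
  kernelFn b l y * ((b * chargeSum v y + l) ^ 2 -
    charge k v * b * ∑ w, charge k w * (y v - y w)⁻¹ ^ 2)

theorem hasDerivAt_update_apply {ι : Type*} [DecidableEq ι] (y : ι → ℂ) (v w : ι) (t : ℂ) :
    HasDerivAt (fun t => Function.update y v t w) (if w = v then 1 else 0) t := by
  by_cases h : w = v
  · subst h; simpa using hasDerivAt_id' t
  · simpa [h] using hasDerivAt_const t (y w)

theorem hasDerivAt_prod_of_log {ι : Type*} (s : Finset ι) {f : ι → ℂ → ℂ} {g : ι → ℂ} {t : ℂ}
    (h : ∀ i ∈ s, HasDerivAt (f i) (f i t * g i) t) :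
    HasDerivAt (fun t => ∏ i ∈ s, f i t) ((∏ i ∈ s, f i t) * ∑ i ∈ s, g i) t := by
  classical
  induction s using Finset.induction_on with
  | empty => simpa using hasDerivAt_const t (1 : ℂ)
  | insert i s hi ih =>
    simp only [Finset.prod_insert hi, Finset.sum_insert hi]
    refine ((h i (Finset.mem_insert_self _ _)).fun_mul
      (ih fun j hj => h j (Finset.mem_insert_of_mem hj))).congr_deriv ?_
    ring

theorem hasDerivAt_pow_of_log {f : ℂ → ℂ} {g t : ℂ} (b : ℕ) (h : HasDerivAt f (f t * g) t) :
    HasDerivAt (fun t => f t ^ b) (f t ^ b * (b * g)) t := by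
  simpa using hasDerivAt_prod_of_log (Finset.range b) (f := fun _ => f) (g := fun _ => g)
    fun _ _ => h

/-- Logarithmic derivative of `y_p - y_q` in the coordinate `v`. -/
theorem hasDerivAt_sub_update {ι : Type*} [DecidableEq ι] {y : ι → ℂ} (hy : Function.Injective y)
    (v : ι) {p q : ι} (hpq : p ≠ q) :
    HasDerivAt (fun t => Function.update y v t p - Function.update y v t q)
      ((Function.update y v (y v) p - Function.update y v (y v) q) *
        (((if p = v then 1 else 0) - (if q = v then 1 else 0)) * (y p - y q)⁻¹)) (y v) := by
  have := sub_ne_zero.2 (hy.ne hpq)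
  refine ((hasDerivAt_update_apply y v p (y v)).fun_sub
    (hasDerivAt_update_apply y v q (y v))).congr_deriv ?_
  rw [Function.update_eq_self]
  field_simp

theorem hasDerivAt_vandA_comp_update {ι : Type*} [DecidableEq ι] {n : ℕ} {y : ι → ℂ}
    (hy : Function.Injective y) (v : ι) {f : Fin n → ι} (hf : Function.Injective f) :
    HasDerivAt (fun t => vandA (Function.update y v t ∘ f))
      (vandA (Function.update y v (y v) ∘ f) *
        ∑ i, ∑ j, (if f i = v then (y (f i) - y (f j))⁻¹ else 0)) (y v) := by
  rw [← sum_pairs_add_swap (fun i j => if f i = v then (y (f i) - y (f j))⁻¹ else 0) (by simp)]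
  simp only [vandA_eq_prod_pairs]
  refine hasDerivAt_prod_of_log (pairs n) (f := fun p t => (Function.update y v t ∘ f) p.1 -
    (Function.update y v t ∘ f) p.2) fun p hp => ?_
  refine (hasDerivAt_sub_update hy v (hf.ne (mem_pairs.1 hp).ne)).congr_deriv ?_
  congr 1
  rw [← neg_sub (y (f p.1)) (y (f p.2)), inv_neg]
  split_ifs <;> ring

theorem hasDerivAt_crossA_comp_update {ι : Type*} [DecidableEq ι] {k l : ℕ} {y : ι → ℂ}
    (hy : Function.Injective y) (v : ι) {f : Fin k → ι} {g : Fin l → ι} (hfg : ∀ i j, f i ≠ g j) :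
    HasDerivAt (fun t => crossA (Function.update y v t ∘ f) (Function.update y v t ∘ g))
      (crossA (Function.update y v (y v) ∘ f) (Function.update y v (y v) ∘ g) *
        ∑ i, ∑ j, (((if f i = v then 1 else 0) - (if g j = v then 1 else 0)) *
          (y (f i) - y (g j))⁻¹)) (y v) := by
  unfold crossA
  exact hasDerivAt_prod_of_log _ fun i _ => hasDerivAt_prod_of_log _ fun j _ =>
    hasDerivAt_sub_update hy v (hfg i j)

theorem crossA_ne_zero {k : ℕ} {y : Fin (k + 1) ⊕ Fin k → ℂ} (hy : Function.Injective y) :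
    crossA (y ∘ Sum.inr) (y ∘ Sum.inl) ≠ 0 :=
  Finset.prod_ne_zero_iff.2 fun _ _ => Finset.prod_ne_zero_iff.2 fun _ _ =>
    sub_ne_zero.2 (hy.ne Sum.inr_ne_inl)

theorem hasDerivAt_kernelFn {k : ℕ} (b : ℕ) (l : ℂ) {y : Fin (k + 1) ⊕ Fin k → ℂ}
    (hy : Function.Injective y) (v : Fin (k + 1) ⊕ Fin k) :
    HasDerivAt (fun t => kernelFn b l (Function.update y v t)) (kernelDeriv b l v y) (y v) := by
  have h1 := hasDerivAt_pow_of_log b (hasDerivAt_vandA_comp_update hy v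
    (Sum.inl_injective (α := Fin (k + 1)) (β := Fin k)))
  have h2 := hasDerivAt_pow_of_log b (hasDerivAt_vandA_comp_update hy v
    (Sum.inr_injective (α := Fin (k + 1)) (β := Fin k)))
  have h3 := hasDerivAt_pow_of_log b (hasDerivAt_crossA_comp_update hy v
    (f := (Sum.inr : Fin k → Fin (k + 1) ⊕ Fin k))
    (g := (Sum.inl : Fin (k + 1) → Fin (k + 1) ⊕ Fin k)) fun _ _ => Sum.inr_ne_inl)
  have h4 : HasDerivAt (fun t => Complex.exp (l * (∑ j, Function.update y v t (Sum.inl j) -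
      ∑ i, Function.update y v t (Sum.inr i))))
      (Complex.exp (l * (∑ j, y (Sum.inl j) - ∑ i, y (Sum.inr i))) * (l * charge k v)) (y v) := by
    refine (HasDerivAt.cexp (HasDerivAt.const_mul l (HasDerivAt.fun_sub
      (HasDerivAt.fun_sum fun j _ => hasDerivAt_update_apply y v (Sum.inl j) (y v))
      (HasDerivAt.fun_sum fun i _ => hasDerivAt_update_apply y v (Sum.inr i) (y v))))).congr_deriv ?_
    rw [Function.update_eq_self]
    congr 2
    cases v <;> simp [charge]
  have hne : crossA (Function.update y v (y v) ∘ Sum.inr) (Function.update y v (y v) ∘ Sum.inl) ^ b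
      ≠ 0 := by
    rw [Function.update_eq_self]; exact pow_ne_zero _ (crossA_ne_zero hy)
  refine (((h1.fun_mul h2).fun_div h3 hne).fun_mul h4).congr_deriv ?_
  rw [Function.update_eq_self] at hne ⊢
  have key : charge k v * chargeSum v y =
      (∑ i, ∑ j, (if Sum.inl i = v then (y (Sum.inl i) - y (Sum.inl j))⁻¹ else 0)) +
      (∑ i, ∑ j, (if Sum.inr i = v then (y (Sum.inr i) - y (Sum.inr j))⁻¹ else 0)) -
      ∑ i, ∑ j, ((if Sum.inr i = v then 1 else 0) - (if Sum.inl j = v then 1 else 0)) *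
          (y (Sum.inr i) - y (Sum.inl j))⁻¹ := by
    rw [chargeSum, Fintype.sum_sum_type]
    rcases v with a | i
    · have (i : Fin k) : (y (Sum.inl a) - y (Sum.inr i))⁻¹ = -(y (Sum.inr i) - y (Sum.inl a))⁻¹ := by
        rw [← neg_sub, inv_neg]
      simp only [charge, Sum.elim_inl, Sum.elim_inr, Pi.one_apply, Pi.neg_apply, this,
        Sum.inl.injEq, reduceCtorEq, if_false, zero_sub, neg_mul, ite_mul, one_mul, zero_mul,
        Finset.sum_neg_distrib, Finset.sum_ite_eq', Finset.mem_univ, if_true, Finset.sum_const_zero,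
        mul_neg, neg_neg]
      rw [Finset.sum_comm]
      simp
    · simp only [charge, Sum.elim_inl, Sum.elim_inr, Pi.one_apply, Pi.neg_apply,
        Sum.inr.injEq, reduceCtorEq, if_false, sub_zero, neg_mul, ite_mul, one_mul, zero_mul,
        Finset.sum_neg_distrib, Finset.sum_const_zero]
      rw [Finset.sum_comm,
        Finset.sum_comm (s := Finset.univ (α := Fin k)) (t := Finset.univ (α := Fin (k + 1)))]
      simp only [Finset.sum_ite_eq', Finset.mem_univ, if_true]
      ring
  simp only [kernelDeriv, mul_add, mul_left_comm (charge k v) (b : ℂ), key]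
  rw [kernelFn]
  field_simp

theorem hasDerivAt_chargeSum {k : ℕ} {y : Fin (k + 1) ⊕ Fin k → ℂ}
    (hy : Function.Injective y) (v : Fin (k + 1) ⊕ Fin k) :
    HasDerivAt (fun t => chargeSum v (Function.update y v t))
      (-∑ w, charge k w * (y v - y w)⁻¹ ^ 2) (y v) := by
  rw [← Finset.sum_neg_distrib]
  refine HasDerivAt.fun_sum fun w _ => ?_
  by_cases h : w = v
  · subst h; simpa using hasDerivAt_const (y w) (0 : ℂ)
  · have h1 := hasDerivAt_sub_update hy v (Ne.symm h)
    have h0 := sub_ne_zero.2 (hy.ne (Ne.symm h))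
    refine ((h1.fun_inv (by rwa [Function.update_eq_self])).const_mul _).congr_deriv ?_
    rw [Function.update_eq_self]
    simp only [if_true, if_neg h]
    field_simp
    ring

theorem hasDerivAt_kernelDeriv {k : ℕ} (b : ℕ) (l : ℂ) {y : Fin (k + 1) ⊕ Fin k → ℂ}
    (hy : Function.Injective y) (v : Fin (k + 1) ⊕ Fin k) :
    HasDerivAt (fun t => kernelDeriv b l v (Function.update y v t))
      (kernelDerivTwo b l v y) (y v) := by
  refine ((hasDerivAt_kernelFn b l hy v).fun_mul
    ((((hasDerivAt_chargeSum hy v).const_mul (b : ℂ)).add_const l).const_mul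
      (charge k v))).congr_deriv ?_
  rw [Function.update_eq_self, kernelDeriv, kernelDerivTwo]
  linear_combination (kernelFn b l y * (b * chargeSum v y + l) ^ 2) * charge_sq v

/-- The kernel intertwines the operators with `k + 1` and `k` particles. -/
theorem sum_kernelDerivTwo {k : ℕ} (m : ℕ) (l : ℂ) {y : Fin (k + 1) ⊕ Fin k → ℂ}
    (hy : Function.Injective y) :
    ∑ a, kernelDerivTwo (m + 1) l (Sum.inl a) y - ∑ i, kernelDerivTwo (m + 1) l (Sum.inr i) y =
      kernelFn (m + 1) l y * (l ^ 2 + (m : ℂ) * (m + 1) *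
        ((∑ i, ∑ j, (y (Sum.inl i) - y (Sum.inl j))⁻¹ ^ 2) -
          ∑ i, ∑ j, (y (Sum.inr i) - y (Sum.inr j))⁻¹ ^ 2)) := by
  have h := sum_charge_identity hy charge_sq ((m + 1 : ℕ) : ℂ) l
  have hcross : ∑ i : Fin k, ∑ j : Fin (k + 1), (y (Sum.inr i) - y (Sum.inl j))⁻¹ ^ 2 =
      ∑ j : Fin (k + 1), ∑ i : Fin k, (y (Sum.inl j) - y (Sum.inr i))⁻¹ ^ 2 := by
    rw [Finset.sum_comm]
    refine Finset.sum_congr rfl fun _ _ => Finset.sum_congr rfl fun _ _ => ?_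
    rw [← neg_sub, inv_neg, neg_sq]
  simp only [Fintype.sum_sum_type (fun I => charge k I * (_ - _)),
    Fintype.sum_sum_type (fun I => ∑ J, charge k I * _),
    Fintype.sum_sum_type (fun J => charge k (Sum.inl _) * _),
    Fintype.sum_sum_type (fun J => charge k (Sum.inr _) * _),
    Fintype.sum_sum_type (charge k)] at h
  have hl : ∑ x : Fin (k + 1), charge k (Sum.inl x) + ∑ x : Fin k, charge k (Sum.inr x) = 1 := by
    simp [charge]
  rw [hl] at h
  simp only [kernelDerivTwo, ← Finset.mul_sum, ← mul_sub]
  congr 1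
  simp only [charge, Sum.elim_inl, Sum.elim_inr, Pi.one_apply, Pi.neg_apply, neg_mul, one_mul,
    Finset.sum_neg_distrib, Finset.sum_add_distrib, hcross] at h
  simp only [charge, Sum.elim_inl, Sum.elim_inr, Pi.one_apply, Pi.neg_apply, neg_mul, one_mul]
  simp only [chargeSum]
  rw [sub_eq_add_neg]
  refine h.trans ?_
  push_cast
  ring

/-! ### The Schrödinger equation for the integral -/

section Schrodinger

open Set Metric

theorem isOpen_setOf_injective {ι : Type*} [Finite ι] :
    IsOpen {y : ι → ℂ | Function.Injective y} := by
  have : {y : ι → ℂ | Function.Injective y} = ⋂ v, ⋂ w, {y | v ≠ w → y v ≠ y w} := by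
    ext y
    simp only [mem_ofPred_eq, mem_iInter]
    exact ⟨fun h v w hvw => h.ne hvw, fun h v w hvw => by
      by_contra hne; exact h v w hne hvw⟩
  rw [this]
  refine isOpen_iInter_of_finite fun v => isOpen_iInter_of_finite fun w => ?_
  by_cases h : v = w
  · simp [h]
  · simp only [ne_eq, h, not_false_eq_true, forall_const]
    exact isOpen_ne_fun (continuous_apply v) (continuous_apply w)

theorem continuousOn_inv_sub {ι : Type*} (v w : ι) :
    ContinuousOn (fun y : ι → ℂ => (y v - y w)⁻¹) {y | Function.Injective y} := by
  by_cases h : v = w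
  · simp [h, continuousOn_const]
  · exact ContinuousOn.inv₀ (by fun_prop) fun y hy => sub_ne_zero.2 (hy.ne h)

theorem continuous_vandA {n : ℕ} : Continuous (vandA : (Fin n → ℂ) → ℂ) := by
  unfold vandA; fun_prop

theorem continuous_crossA {X : Type*} [TopologicalSpace X] {k l : ℕ} {f : X → Fin k → ℂ}
    {g : X → Fin l → ℂ} (hf : Continuous f) (hg : Continuous g) :
    Continuous fun y => crossA (f y) (g y) := by
  unfold crossA; fun_prop

theorem continuousOn_kernelFn {k : ℕ} (b : ℕ) (l : ℂ) :
    ContinuousOn (kernelFn (k := k) b l) {y | Function.Injective y} := by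
  have h1 : Continuous fun y : Fin (k + 1) ⊕ Fin k → ℂ => y ∘ Sum.inl := by fun_prop
  have h2 : Continuous fun y : Fin (k + 1) ⊕ Fin k → ℂ => y ∘ Sum.inr := by fun_prop
  unfold kernelFn
  refine ContinuousOn.mul (ContinuousOn.div ?_ ?_ fun y hy => pow_ne_zero _ (crossA_ne_zero hy)) ?_
  · exact (((continuous_vandA.comp h1).pow b).mul ((continuous_vandA.comp h2).pow b)).continuousOn
  · exact ((continuous_crossA h2 h1).pow b).continuousOn
  · exact Continuous.continuousOn (by fun_prop)

theorem continuousOn_chargeSum {k : ℕ} (v : Fin (k + 1) ⊕ Fin k) :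
    ContinuousOn (chargeSum v) {y | Function.Injective y} :=
  continuousOn_finsetSum _ fun w _ => continuousOn_const.mul (continuousOn_inv_sub v w)

theorem continuousOn_kernelDeriv {k : ℕ} (b : ℕ) (l : ℂ) (v : Fin (k + 1) ⊕ Fin k) :
    ContinuousOn (kernelDeriv b l v) {y | Function.Injective y} :=
  (continuousOn_kernelFn b l).mul (continuousOn_const.mul
    ((continuousOn_const.mul (continuousOn_chargeSum v)).add continuousOn_const))

theorem continuousOn_kernelDerivTwo {k : ℕ} (b : ℕ) (l : ℂ) (v : Fin (k + 1) ⊕ Fin k) :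
    ContinuousOn (kernelDerivTwo b l v) {y | Function.Injective y} :=
  (continuousOn_kernelFn b l).mul
    ((((continuousOn_const.mul (continuousOn_chargeSum v)).add continuousOn_const).pow 2).sub
      (continuousOn_const.mul (continuousOn_finsetSum _ fun w _ =>
        continuousOn_const.mul ((continuousOn_inv_sub v w).pow 2))))

theorem continuousOn_gaugeFn {n : ℕ} (s : ℕ) (R : XLPoly n) (lam : Fin n → ℂ) :
    ContinuousOn (fun x => gaugeFn s R x lam) {x | Function.Injective x} := by
  have h1 : Continuous fun x : Fin n → ℂ => eval (Sum.elim x lam) R := by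
    have : Continuous fun x : Fin n → ℂ => (Sum.elim x lam : Fin n ⊕ Fin n → ℂ) :=
      continuous_pi fun v => by cases v <;> simp <;> fun_prop
    exact (MvPolynomial.continuous_eval R).comp this
  unfold gaugeFn
  refine ContinuousOn.mul (ContinuousOn.div h1.continuousOn (continuous_vandA.pow s).continuousOn
    fun x hx => pow_ne_zero _ (vandA_ne_zero_iff.2 hx)) (Continuous.continuousOn (by fun_prop))

/-- The function of `x` given by the integral of the kernel against `P / A(z)^m · e^{(λ', z)}`, over
a fixed torus. -/
noncomputable def kernelIntegral {k : ℕ} (m : ℕ) (P : XLPoly k) (lam : Fin k → ℂ) (l : ℂ)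
    (c : Fin k → ℂ) (ε : ℝ) (x : Fin (k + 1) → ℂ) : ℂ :=
  torusIntegral (fun z => kernelFn (m + 1) l (Sum.elim x z) * gaugeFn m P z lam) c fun _ => ε

theorem injective_of_injective_elim_right {ι κ : Type*} {x : ι → ℂ} {z : κ → ℂ}
    (h : Function.Injective (Sum.elim x z)) : Function.Injective z := by
  have := h.comp Sum.inr_injective
  rwa [Sum.elim_comp_inr] at this

/-- The hypothesis says that `x` stays away from the contour, whose points have distinct
coordinates, so that one can differentiate under the integral sign. -/
theorem iteratedDeriv_kernelIntegral {k m : ℕ} (P : XLPoly k) (lam : Fin k → ℂ) (l : ℂ)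
    {c : Fin k → ℂ} {ε : ℝ} (hε : 0 < ε) {x : Fin (k + 1) → ℂ}
    (hx : ∀ z : Fin k → ℂ, (∀ i, z i ∈ sphere (c i) ε) → Function.Injective (Sum.elim x z))
    (a : Fin (k + 1)) :
    iteratedDeriv 2 (fun t => kernelIntegral m P lam l c ε (Function.update x a t)) (x a) =
      torusIntegral (fun z => kernelDerivTwo (m + 1) l (Sum.inl a) (Sum.elim x z) *
        gaugeFn m P z lam) c fun _ => ε := by
  have hmap : Continuous fun p : ℂ × (Fin k → ℂ) => (Sum.elim (Function.update x a p.1) p.2 :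
      Fin (k + 1) ⊕ Fin k → ℂ) := by
    refine continuous_pi fun v => ?_
    rcases v with j | i
    · by_cases h : j = a
      · subst h; simpa using continuous_fst
      · simpa [h] using continuous_const
    · simp only [Sum.elim_inr]; fun_prop
  set W : Set (ℂ × (Fin k → ℂ)) :=
    {p | Function.Injective (Sum.elim (Function.update x a p.1) p.2)} with hWdef
  have hW : IsOpen W := isOpen_setOf_injective.preimage hmap
  have hsphere (θ : Fin k → ℝ) (i : Fin k) : torusMap c (fun _ => ε) θ i ∈ sphere (c i) ε := by
    simp [torusMap, Complex.norm_exp_ofReal_mul_I, abs_of_pos hε]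
  have hΨ : ContinuousOn (fun p : ℂ × (Fin k → ℂ) => gaugeFn m P p.2 lam) W :=
    (continuousOn_gaugeFn m P lam).comp continuous_snd.continuousOn
      fun p hp => injective_of_injective_elim_right hp
  have hcont {G : (Fin (k + 1) ⊕ Fin k → ℂ) → ℂ} (hG : ContinuousOn G {y | Function.Injective y}) :
      ContinuousOn (fun p : ℂ × (Fin k → ℂ) =>
        G (Sum.elim (Function.update x a p.1) p.2) * gaugeFn m P p.2 lam) W :=
    (hG.comp hmap.continuousOn fun p hp => hp).mul hΨ
  have hd {G G' : (Fin (k + 1) ⊕ Fin k → ℂ) → ℂ} (hG : ∀ y, Function.Injective y →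
      HasDerivAt (fun t => G (Function.update y (Sum.inl a) t)) (G' y) (y (Sum.inl a)))
      (p : ℂ × (Fin k → ℂ)) (hp : p ∈ W) :
      HasDerivAt (fun t => G (Sum.elim (Function.update x a t) p.2) * gaugeFn m P p.2 lam)
        (G' (Sum.elim (Function.update x a p.1) p.2) * gaugeFn m P p.2 lam) p.1 := by
    have := hG _ hp
    simp only [Sum.update_elim_inl, Function.update_idem, Sum.elim_inl, Function.update_self] at this
    exact this.mul_const _
  have hev : ∀ᶠ t in nhds (x a), ∀ θ, (t, torusMap c (fun _ => ε) θ) ∈ W := by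
    obtain ⟨U, V, hU, -, htU, hTV, hUV⟩ := generalized_tube_lemma
      (isCompact_singleton (x := x a)) (isCompact_univ_pi fun i => isCompact_sphere (c i) ε) hW (by
        rintro ⟨t, z⟩ ⟨ht, hz⟩
        obtain rfl : t = x a := ht
        simp only [hWdef, mem_ofPred_eq, Function.update_eq_self]
        exact hx z fun i => hz i (mem_univ i))
    refine Filter.eventually_of_mem (hU.mem_nhds (htU rfl)) fun t ht θ => hUV ⟨ht, hTV ?_⟩
    exact fun i _ => hsphere θ i
  refine iteratedDeriv_two_eq_of_hasDerivAt (f' := fun t => torusIntegral (fun z =>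
    kernelDeriv (m + 1) l (Sum.inl a) (Sum.elim (Function.update x a t) z) * gaugeFn m P z lam) c
    fun _ => ε) ?_ ?_
  · refine hev.mono fun t ht => ?_
    exact hasDerivAt_torusIntegral
      (F := fun t z => kernelFn (m + 1) l (Sum.elim (Function.update x a t) z) * gaugeFn m P z lam)
      (F' := fun t z => kernelDeriv (m + 1) l (Sum.inl a) (Sum.elim (Function.update x a t) z) *
        gaugeFn m P z lam) hW ht (hcont (continuousOn_kernelDeriv _ _ _))
      (hcont (continuousOn_kernelFn _ _)) (hd fun y hy => hasDerivAt_kernelFn _ _ hy _)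
  · have := hasDerivAt_torusIntegral
      (F := fun t z => kernelDeriv (m + 1) l (Sum.inl a) (Sum.elim (Function.update x a t) z) *
        gaugeFn m P z lam)
      (F' := fun t z => kernelDerivTwo (m + 1) l (Sum.inl a) (Sum.elim (Function.update x a t) z) *
        gaugeFn m P z lam) hW hev.self_of_nhds (hcont (continuousOn_kernelDerivTwo _ _ _))
      (hcont (continuousOn_kernelDeriv _ _ _)) (hd fun y hy => hasDerivAt_kernelDeriv _ _ hy _)
    simpa only [Function.update_eq_self] using this

/-- Green's identity on the torus: both second derivatives in `z_i`, of the kernel and of the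
function `P / A(z)^m · e^{(λ', z)}`, have the same integral, since the difference is the derivative
of a function that is holomorphic near the torus. -/
theorem torusIntegral_kernel_green {k m : ℕ} (P : XLPoly k) (lam : Fin k → ℂ) (l : ℂ)
    {c : Fin k → ℂ} {ε : ℝ} {x : Fin (k + 1) → ℂ}
    (hx : ∀ θ, Function.Injective (Sum.elim x (torusMap c (fun _ => ε) θ))) (i : Fin k) :
    torusIntegral (fun z => kernelDerivTwo (m + 1) l (Sum.inr i) (Sum.elim x z) *
      gaugeFn m P z lam - kernelFn (m + 1) l (Sum.elim x z) *
        gaugeFn (m + 2) (gaugeDeriv (m + 1) i (gaugeDeriv m i P)) z lam) c (fun _ => ε) = 0 := by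
  have hmap : Continuous fun z : Fin k → ℂ => (Sum.elim x z : Fin (k + 1) ⊕ Fin k → ℂ) :=
    continuous_pi fun v => by cases v <;> simp <;> fun_prop
  set U : Set (Fin k → ℂ) := {z | Function.Injective (Sum.elim x z)}
  have hU : IsOpen U := isOpen_setOf_injective.preimage hmap
  have hK {G : (Fin (k + 1) ⊕ Fin k → ℂ) → ℂ} (hG : ContinuousOn G {y | Function.Injective y}) :
      ContinuousOn (fun z => G (Sum.elim x z)) U := hG.comp hmap.continuousOn fun z hz => hz
  have hΨ (s : ℕ) (R : XLPoly k) : ContinuousOn (fun z => gaugeFn s R z lam) U :=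
    (continuousOn_gaugeFn s R lam).mono fun z hz => injective_of_injective_elim_right hz
  refine torusIntegral_eq_zero_of_hasDerivAt (g := fun z =>
    kernelDeriv (m + 1) l (Sum.inr i) (Sum.elim x z) * gaugeFn m P z lam -
      kernelFn (m + 1) l (Sum.elim x z) * gaugeFn (m + 1) (gaugeDeriv m i P) z lam) hU hx
    (((hK (continuousOn_kernelDerivTwo _ _ _)).mul (hΨ _ _)).sub
      ((hK (continuousOn_kernelFn _ _)).mul (hΨ _ _)))
    (((hK (continuousOn_kernelDeriv _ _ _)).mul (hΨ _ _)).sub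
      ((hK (continuousOn_kernelFn _ _)).mul (hΨ _ _))) i fun z hz => ?_
  have hz' : vandA (Function.update z i (z i)) ≠ 0 := by
    rw [Function.update_eq_self]
    exact vandA_ne_zero_iff.2 (injective_of_injective_elim_right hz)
  have h1 := hasDerivAt_kernelFn (m + 1) l hz (Sum.inr i)
  have h2 := hasDerivAt_kernelDeriv (m + 1) l hz (Sum.inr i)
  have h3 := hasDerivAt_gaugeFn m P z lam i (z i) hz'
  have h4 := hasDerivAt_gaugeFn (m + 1) (gaugeDeriv m i P) z lam i (z i) hz'
  simp only [Sum.update_elim_inr, Sum.elim_inr] at h1 h2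
  refine ((h2.fun_mul h3).fun_sub (h1.fun_mul h4)).congr_deriv ?_
  simp only [Function.update_eq_self]
  ring

/-- The integral of the kernel against an eigenfunction of the operator in `z` is an eigenfunction
of the operator in `x`. -/
theorem calogeroMoser_kernelIntegral {k m : ℕ} {P : XLPoly k} (hP : schrPoly m m P = 0)
    (lam : Fin k → ℂ) (l : ℂ) {c : Fin k → ℂ} {ε : ℝ} (hε : 0 < ε) {x : Fin (k + 1) → ℂ}
    (hx : ∀ z : Fin k → ℂ, (∀ i, z i ∈ sphere (c i) ε) → Function.Injective (Sum.elim x z)) :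
    calogeroMoser (k + 1) m (kernelIntegral m P lam l c ε) x =
      -((∑ i, lam i ^ 2) + l ^ 2) * kernelIntegral m P lam l c ε x := by
  have hx' (θ : Fin k → ℝ) : Function.Injective (Sum.elim x (torusMap c (fun _ => ε) θ)) :=
    hx _ fun i => by simp [torusMap, Complex.norm_exp_ofReal_mul_I, abs_of_pos hε]
  have hmap : Continuous fun z : Fin k → ℂ => (Sum.elim x z : Fin (k + 1) ⊕ Fin k → ℂ) :=
    continuous_pi fun v => by cases v <;> simp <;> fun_prop
  have hint {G : (Fin (k + 1) ⊕ Fin k → ℂ) → ℂ} (hG : ContinuousOn G {y | Function.Injective y})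
      (s : ℕ) (R : XLPoly k) :
      TorusIntegrable (fun z => G (Sum.elim x z) * gaugeFn s R z lam) c fun _ => ε := by
    refine torusIntegrable_of_continuousOn (ContinuousOn.mul
      (hG.comp hmap.continuousOn ?_) ((continuousOn_gaugeFn s R lam).mono ?_))
    · rintro _ ⟨θ, rfl⟩; exact hx' θ
    · rintro _ ⟨θ, rfl⟩; exact injective_of_injective_elim_right (hx' θ)
  set S : ℂ := (m : ℂ) * (m + 1) * ∑ i, ∑ j, (x i - x j)⁻¹ ^ 2 with hS
  have hlap : complexLaplacian (kernelIntegral m P lam l c ε) x =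
      ((∑ i, lam i ^ 2) + l ^ 2 + S) * kernelIntegral m P lam l c ε x := by
    have h1 : complexLaplacian (kernelIntegral m P lam l c ε) x = torusIntegral (fun z => ∑ a,
        kernelDerivTwo (m + 1) l (Sum.inl a) (Sum.elim x z) * gaugeFn m P z lam) c fun _ => ε := by
      rw [torusIntegral_sum _ fun a _ => hint (continuousOn_kernelDerivTwo _ _ _) m P]
      exact Finset.sum_congr rfl fun a _ => iteratedDeriv_kernelIntegral P lam l hε hx a
    have hgreen := Finset.sum_eq_zero fun i (_ : i ∈ Finset.univ) =>
      torusIntegral_kernel_green (m := m) P lam l hx' i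
    have hintg (i : Fin k) : TorusIntegrable (fun z => kernelDerivTwo (m + 1) l (Sum.inr i)
        (Sum.elim x z) * gaugeFn m P z lam - kernelFn (m + 1) l (Sum.elim x z) *
          gaugeFn (m + 2) (gaugeDeriv (m + 1) i (gaugeDeriv m i P)) z lam) c fun _ => ε :=
      (hint (continuousOn_kernelDerivTwo (m + 1) l (Sum.inr i)) m P).sub
      (hint (continuousOn_kernelFn (m + 1) l) (m + 2) (gaugeDeriv (m + 1) i (gaugeDeriv m i P)))
    rw [← torusIntegral_sum _ fun i _ => hintg i] at hgreen
    have hint' : TorusIntegrable (fun z => ((∑ i, lam i ^ 2) + l ^ 2 + S) *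
        kernelFn (m + 1) l (Sum.elim x z) * gaugeFn m P z lam) c fun _ => ε :=
      hint ((continuousOn_const (c := (∑ i, lam i ^ 2) + l ^ 2 + S)).mul
      (continuousOn_kernelFn (m + 1) l)) m P
    rw [h1, kernelIntegral, ← torusIntegral_const_mul]
    refine Eq.trans ?_ (add_zero _)
    rw [← hgreen]
    simp only [← mul_assoc]
    rw [← torusIntegral_add hint' (torusIntegrable_sum _ fun i _ => hintg i)]
    refine torusIntegral_congr fun θ => ?_
    have hxθ := hx' θ
    generalize torusMap c (fun _ => ε) θ = z at hxθ ⊢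
    have hz := injective_of_injective_elim_right hxθ
    have h2 := calogeroMoser_gaugeFn m m P lam hz
    rw [calogeroMoser, complexLaplacian_gaugeFn m P lam hz, potential_eq, hP] at h2
    have h3 := sum_kernelDerivTwo m l hxθ
    simp only [Sum.elim_inl, Sum.elim_inr] at h3
    have h0 : gaugeFn (m + 2) (0 : XLPoly k) z lam = 0 := by simp [gaugeFn]
    rw [h0] at h2
    rw [← Finset.sum_mul, Finset.sum_sub_distrib, ← Finset.sum_mul, ← Finset.mul_sum]
    linear_combination gaugeFn m P z lam * h3 - kernelFn (m + 1) l (Sum.elim x z) * h2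
  rw [calogeroMoser, potential_eq, hlap]
  ring

end Schrodinger

/-! ### Evaluation of the integral by residues -/

/-- The product `∏_{j ≠ i} (z - x_j)` as a polynomial in `z`. -/
noncomputable def otherFactors {k : ℕ} (i : Fin k) : Polynomial (XLPoly (k + 1)) :=
  ∏ j ∈ Finset.univ.erase i.castSucc, (Polynomial.X - Polynomial.C (X (Sum.inl j)))

/-- The difference `λ_i - λ_{k+1}`. -/
noncomputable def lamDiff {k : ℕ} (i : Fin k) : XLPoly (k + 1) :=
  X (Sum.inr i.castSucc) - X (Sum.inr (Fin.last k))

/-- The numerators of the successive derivatives in `z` of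
`z^α e^{(λ_i - λ_{k+1}) z} / ∏_{j ≠ i} (z - x_j)^{m+1}`: that of the `l`-th derivative has
denominator `∏_{j ≠ i} (z - x_j)^{m+1+l}`. -/
noncomputable def derivNumerator {k : ℕ} (m : ℕ) (i : Fin k) (α : ℕ) :
    ℕ → Polynomial (XLPoly (k + 1))
  | 0 => Polynomial.X ^ α
  | l + 1 => otherFactors i * Polynomial.derivative (derivNumerator m i α l) -
      ((m + 1 + l : ℕ) : Polynomial (XLPoly (k + 1))) *
        Polynomial.derivative (otherFactors i) * derivNumerator m i α l +
      Polynomial.C (lamDiff i) * otherFactors i * derivNumerator m i α l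

/-- The numerator of the residue at `z = x_i` of
`z^α e^{(λ_i - λ_{k+1}) z} / ∏_j (z - x_j)^{m+1}`. -/
noncomputable def residueNumerator {k : ℕ} (m : ℕ) (i : Fin k) (α : ℕ) : XLPoly (k + 1) :=
  (derivNumerator m i α m).eval (X (Sum.inl i.castSucc))

/-- The derivatives whose numerators are given by `derivNumerator`. -/
noncomputable def residueFn {k : ℕ} (m : ℕ) (i : Fin k) (α : ℕ) (x lam : Fin (k + 1) → ℂ) (l : ℕ)
    (z : ℂ) : ℂ :=
  ((derivNumerator m i α l).map (eval (Sum.elim x lam))).eval z /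
    (∏ j ∈ Finset.univ.erase i.castSucc, (z - x j)) ^ (m + 1 + l) *
      Complex.exp ((lam i.castSucc - lam (Fin.last k)) * z)

theorem eval_map_otherFactors {k : ℕ} (i : Fin k) (x lam : Fin (k + 1) → ℂ) (z : ℂ) :
    ((otherFactors i).map (eval (Sum.elim x lam))).eval z =
      ∏ j ∈ Finset.univ.erase i.castSucc, (z - x j) := by
  simp [otherFactors, Polynomial.map_prod, Polynomial.eval_prod]

theorem hasDerivAt_residueFn {k : ℕ} (m : ℕ) (i : Fin k) (α : ℕ) (x lam : Fin (k + 1) → ℂ) (l : ℕ)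
    {z : ℂ} (hz : ∀ j ≠ i.castSucc, z ≠ x j) :
    HasDerivAt (residueFn m i α x lam l) (residueFn m i α x lam (l + 1) z) z := by
  have hD : (∏ j ∈ Finset.univ.erase i.castSucc, (z - x j)) ≠ 0 :=
    Finset.prod_ne_zero_iff.2 fun j hj => sub_ne_zero.2 (hz j (Finset.ne_of_mem_erase hj))
  have h1 := ((derivNumerator m i α l).map (eval (Sum.elim x lam))).hasDerivAt z
  have h2 := (((otherFactors i).map (eval (Sum.elim x lam))).hasDerivAt z).fun_pow (m + 1 + l)
  have h3 : HasDerivAt (fun z => Complex.exp ((lam i.castSucc - lam (Fin.last k)) * z))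
      (Complex.exp ((lam i.castSucc - lam (Fin.last k)) * z) *
        (lam i.castSucc - lam (Fin.last k))) z :=
    (((hasDerivAt_id' z).const_mul _).cexp).congr_deriv (by rw [mul_one])
  simp only [eval_map_otherFactors] at h2
  have h4 := (h1.fun_div h2 (pow_ne_zero _ hD)).fun_mul h3
  refine h4.congr_deriv ?_
  rw [residueFn, derivNumerator]
  have hl : m + 1 + l - 1 = m + l := by omega
  rw [hl]
  simp only [Polynomial.map_add, Polynomial.map_sub, Polynomial.map_mul, Polynomial.map_natCast,
    Polynomial.eval_add, Polynomial.eval_sub, Polynomial.eval_mul, Polynomial.eval_natCast,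
    Polynomial.map_C, Polynomial.eval_C, eval_map_otherFactors, Polynomial.derivative_map, lamDiff,
    map_sub, eval_X, Sum.elim_inr]
  generalize (∏ j ∈ Finset.univ.erase i.castSucc, (z - x j)) = D at hD ⊢
  have e1 : D ^ (m + 1 + l) = D ^ (m + l) * D := by rw [← pow_succ]; congr 1; omega
  have e2 : D ^ (m + 1 + (l + 1)) = D ^ (m + l) * D * D := by
    rw [← pow_succ, ← pow_succ]; congr 1; omega
  rw [e1, e2]
  have hDp := pow_ne_zero (m + l) hD
  generalize D ^ (m + l) = E at hDp ⊢
  field_simp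

open Metric in
theorem circleIntegral_residue {k : ℕ} (m : ℕ) (i : Fin k) (α : ℕ) (x lam : Fin (k + 1) → ℂ)
    {c : ℂ} {ε : ℝ} (hi : x i.castSucc ∈ ball c ε) (hj : ∀ j ≠ i.castSucc, x j ∉ closedBall c ε) :
    (∮ z in C(c, ε), z ^ α * Complex.exp ((lam i.castSucc - lam (Fin.last k)) * z) /
      (∏ j, (z - x j)) ^ (m + 1)) =
      2 * Real.pi * Complex.I / (m.factorial : ℂ) *
        (eval (Sum.elim x lam) (residueNumerator m i α) /
          (∏ j ∈ Finset.univ.erase i.castSucc, (x i.castSucc - x j)) ^ (2 * m + 1) *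
          Complex.exp ((lam i.castSucc - lam (Fin.last k)) * x i.castSucc)) := by
  have h := circleIntegral_div_sub_pow hi (g := residueFn m i α x lam)
    (fun l z hz => hasDerivAt_residueFn m i α x lam l fun j hji hzj => hj j hji (hzj ▸ hz)) m 0
  have e : ((derivNumerator m i α m).map (eval (Sum.elim x lam))).eval (x i.castSucc) =
      eval (Sum.elim x lam) (residueNumerator m i α) := by
    rw [residueNumerator, ← Polynomial.eval_map_apply]
    simp
  rw [residueFn, zero_add, e, show m + 1 + m = 2 * m + 1 by ring] at h
  rw [← h]
  congr 1
  funext z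
  rw [residueFn, derivNumerator, ← Finset.mul_prod_erase _ _ (Finset.mem_univ i.castSucc), mul_pow]
  simp only [Polynomial.map_pow, Polynomial.map_X, Polynomial.eval_pow, Polynomial.eval_X, add_zero]
  simp only [div_eq_mul_inv, mul_inv]
  ring

/-- The polynomial `A(z) P(z, λ')` integrated against the remaining factors of the integrand. -/
noncomputable def integralNumerator {k : ℕ} (m : ℕ) (P : XLPoly k) : XLPoly (k + 1) :=
  ∑ d ∈ (xVand k * P).support, C (coeff d (xVand k * P)) *
    (∏ i, X (Sum.inr i.castSucc) ^ d (Sum.inr i)) * ∏ i, residueNumerator m i (d (Sum.inl i))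

theorem prod_prod_erase_castSucc {R : Type*} [CommRing R] {k : ℕ} (u : Fin (k + 1) → R) :
    ∏ i : Fin k, ∏ j ∈ Finset.univ.erase i.castSucc, (u i.castSucc - u j) =
      (-1) ^ k.choose 2 * vandA (fun i : Fin k => u i.castSucc) * vandA u := by
  have h (i : Fin k) : ∏ j ∈ Finset.univ.erase i.castSucc, (u i.castSucc - u j) =
      (∏ j ∈ Finset.univ.erase i, (u i.castSucc - u j.castSucc)) *
        (u i.castSucc - u (Fin.last k)) := by
    have he : Finset.univ.erase i.castSucc = Finset.cons (Fin.last k)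
        ((Finset.univ.erase i).map Fin.castSuccEmb) (by simp) := by
      ext j
      refine Fin.lastCases ?_ (fun j => ?_) j
      · simp [(Fin.castSucc_lt_last i).ne']
      · simp
    rw [he, Finset.prod_cons, Finset.prod_map, mul_comm]
    rfl
  simp only [h, Finset.prod_mul_distrib]
  rw [prod_prod_erase_sub fun i : Fin k => u i.castSucc, vandA_castSucc u]
  ring

/-- The integrand with the removable singularities at `z_i = z_j` cancelled, expanded into products
of functions of one variable. -/
theorem kernelFn_mul_gaugeFn {k : ℕ} (m : ℕ) (P : XLPoly k) (x lam : Fin (k + 1) → ℂ)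
    (z : Fin k → ℂ) :
    kernelFn (m + 1) (lam (Fin.last k)) (Sum.elim x z) * gaugeFn m P z (fun i => lam i.castSucc) =
      vandA x ^ (m + 1) * Complex.exp (lam (Fin.last k) * ∑ j, x j) *
        ∑ d ∈ (xVand k * P).support, (coeff d (xVand k * P) *
          (∏ i, lam i.castSucc ^ d (Sum.inr i))) * ∏ i, (z i ^ d (Sum.inl i) *
            Complex.exp ((lam i.castSucc - lam (Fin.last k)) * z i) /
              (∏ j, (z i - x j)) ^ (m + 1)) := by
  have h1 : ∑ d ∈ (xVand k * P).support, (coeff d (xVand k * P) *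
      (∏ i, lam i.castSucc ^ d (Sum.inr i))) * ∏ i, (z i ^ d (Sum.inl i) *
        Complex.exp ((lam i.castSucc - lam (Fin.last k)) * z i) / (∏ j, (z i - x j)) ^ (m + 1)) =
      vandA z * eval (Sum.elim z fun i => lam i.castSucc) P *
        (∏ i, Complex.exp ((lam i.castSucc - lam (Fin.last k)) * z i)) /
          crossA z x ^ (m + 1) := by
    rw [← eval_xVand z fun i => lam i.castSucc, ← map_mul, eval_eq', Finset.sum_mul,
      Finset.sum_div]
    refine Finset.sum_congr rfl fun d _ => ?_
    rw [Fintype.prod_sum_type, Finset.prod_div_distrib, Finset.prod_mul_distrib, Finset.prod_pow,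
      crossA]
    simp only [Sum.elim_inl, Sum.elim_inr]
    ring
  rw [h1, kernelFn, gaugeFn, ← Complex.exp_sum]
  simp only [Sum.elim_comp_inl, Sum.elim_comp_inr, Sum.elim_inl, Sum.elim_inr]
  have h2 : Complex.exp (lam (Fin.last k) * (∑ j, x j - ∑ i, z i)) *
      Complex.exp (∑ i : Fin k, lam i.castSucc * z i) =
      Complex.exp (lam (Fin.last k) * ∑ j, x j) *
        Complex.exp (∑ i : Fin k, (lam i.castSucc - lam (Fin.last k)) * z i) := by
    rw [← Complex.exp_add, ← Complex.exp_add]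
    congr 1
    simp only [sub_mul, Finset.sum_sub_distrib, ← Finset.mul_sum]
    ring
  by_cases hz : vandA z = 0
  · simp [hz]
  · have h3 : vandA z ^ (m + 1) = vandA z ^ m * vandA z := pow_succ _ _
    have h4 := pow_ne_zero m hz
    rw [h3]
    generalize vandA z ^ m = a at h4
    calc _ = vandA x ^ (m + 1) * (a * a⁻¹) * vandA z / crossA z x ^ (m + 1) *
          eval (Sum.elim z fun i => lam i.castSucc) P *
          (Complex.exp (lam (Fin.last k) * (∑ j, x j - ∑ i, z i)) *
            Complex.exp (∑ i : Fin k, lam i.castSucc * z i)) := by ring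
      _ = _ := by rw [h2, mul_inv_cancel₀ h4]; ring

/-- A torus `∏ {|z_i - c_i| = ε}` each of whose circles encloses `x_i`, and no other `x_j`. -/
structure IsContour {k : ℕ} (c : Fin k → ℂ) (ε : ℝ) (x : Fin (k + 1) → ℂ) : Prop where
  mem_ball : ∀ i : Fin k, x i.castSucc ∈ Metric.ball (c i) ε
  notMem_closedBall : ∀ (i : Fin k), ∀ j ≠ i.castSucc, x j ∉ Metric.closedBall (c i) ε

theorem IsContour.torusIntegrable_aux {k : ℕ} {c : Fin k → ℂ} {ε : ℝ} {x : Fin (k + 1) → ℂ}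
    (h : IsContour c ε x) (m : ℕ) (lam : Fin (k + 1) → ℂ) (a : ℂ) (d : Fin k → ℕ) :
    TorusIntegrable (fun z => a * ∏ i, (z i ^ d i *
      Complex.exp ((lam i.castSucc - lam (Fin.last k)) * z i) / (∏ j, (z i - x j)) ^ (m + 1))) c
      fun _ => ε := by
  refine torusIntegrable_of_continuousOn (continuousOn_const.mul
    (continuousOn_finsetProd _ fun i _ => ContinuousOn.div (Continuous.continuousOn (by fun_prop))
      (Continuous.continuousOn (by fun_prop)) ?_))
  rintro _ ⟨θ, rfl⟩
  have hε : 0 < ε := dist_nonneg.trans_lt (h.mem_ball i)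
  have hs : torusMap c (fun _ => ε) θ i ∈ Metric.sphere (c i) ε := by
    simp [torusMap, Complex.norm_exp_ofReal_mul_I, abs_of_pos hε]
  refine pow_ne_zero _ (Finset.prod_ne_zero_iff.2 fun j _ => sub_ne_zero.2 fun h0 => ?_)
  rw [h0] at hs
  by_cases hj : j = i.castSucc
  · subst hj
    exact (Metric.mem_ball.1 (h.mem_ball i)).ne (Metric.mem_sphere.1 hs)
  · exact h.notMem_closedBall i j hj (Metric.sphere_subset_closedBall hs)

theorem IsContour.torusIntegrable {k : ℕ} {c : Fin k → ℂ} {ε : ℝ} {x : Fin (k + 1) → ℂ}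
    (h : IsContour c ε x) (m : ℕ) (P : XLPoly k) (lam : Fin (k + 1) → ℂ) :
    TorusIntegrable (fun z => kernelFn (m + 1) (lam (Fin.last k)) (Sum.elim x z) *
      gaugeFn m P z fun i => lam i.castSucc) c fun _ => ε := by
  simp only [kernelFn_mul_gaugeFn, Finset.mul_sum, ← mul_assoc]
  exact torusIntegrable_sum _ fun d _ => h.torusIntegrable_aux m lam _ fun i => d (Sum.inl i)

/-- The numerator of the integral, with the denominator `A(x)^{3m+1}`. -/
noncomputable def gaugeNumerator {k : ℕ} (m : ℕ) (P : XLPoly k) : XLPoly (k + 1) :=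
  (∏ i : Fin k, (X (Sum.inl i.castSucc) - X (Sum.inl (Fin.last k)))) ^ (2 * m + 1) *
    integralNumerator m P

/-- The residues at the poles `z_i = x_i`. The denominators combine to `A(x)^{3m+1}` after the
numerator is multiplied by the power of `∏ (x_i - x_{k+1})` in `gaugeNumerator`. -/
theorem IsContour.kernelIntegral_eq {k : ℕ} {c : Fin k → ℂ} {ε : ℝ} {x : Fin (k + 1) → ℂ}
    (h : IsContour c ε x) (hx : Function.Injective x) (m : ℕ) (P : XLPoly k)
    (lam : Fin (k + 1) → ℂ) :
    kernelIntegral m P (fun i => lam i.castSucc) (lam (Fin.last k)) c ε x =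
      (-1) ^ k.choose 2 * (2 * Real.pi * Complex.I / (m.factorial : ℂ)) ^ k *
        gaugeFn (3 * m + 1) (gaugeNumerator m P) x lam := by
  have h1 : kernelIntegral m P (fun i => lam i.castSucc) (lam (Fin.last k)) c ε x =
      vandA x ^ (m + 1) * Complex.exp (lam (Fin.last k) * ∑ j, x j) *
        ((2 * Real.pi * Complex.I / (m.factorial : ℂ)) ^ k *
          (eval (Sum.elim x lam) (integralNumerator m P) /
            ((-1) ^ k.choose 2 * vandA (fun i : Fin k => x i.castSucc) * vandA x) ^ (2 * m + 1) *
            Complex.exp (∑ i : Fin k, (lam i.castSucc - lam (Fin.last k)) * x i.castSucc))) := by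
    simp only [kernelIntegral, kernelFn_mul_gaugeFn]
    rw [torusIntegral_const_mul, torusIntegral_sum _ fun d _ =>
      h.torusIntegrable_aux m lam _ fun i => d (Sum.inl i)]
    congr 1
    rw [integralNumerator, map_sum, Finset.sum_div, Finset.sum_mul, Finset.mul_sum]
    refine Finset.sum_congr rfl fun d _ => ?_
    rw [torusIntegral_const_mul, torusIntegral_prod fun i z => z ^ d (Sum.inl i) *
      Complex.exp ((lam i.castSucc - lam (Fin.last k)) * z) / (∏ j, (z - x j)) ^ (m + 1)]
    rw [Finset.prod_congr rfl fun i _ => circleIntegral_residue m i (d (Sum.inl i)) x lam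
      (h.mem_ball i) (h.notMem_closedBall i)]
    rw [Finset.prod_mul_distrib, Finset.prod_mul_distrib, Finset.prod_const, Finset.card_univ,
      Fintype.card_fin, Finset.prod_div_distrib, Finset.prod_pow, prod_prod_erase_castSucc,
      ← Complex.exp_sum]
    simp only [map_mul, eval_C, map_prod, map_pow, eval_X, Sum.elim_inr]
    ring
  have h2 : Complex.exp (lam (Fin.last k) * ∑ j, x j) *
      Complex.exp (∑ i : Fin k, (lam i.castSucc - lam (Fin.last k)) * x i.castSucc) =
      Complex.exp (∑ j, lam j * x j) := by
    rw [← Complex.exp_add, Fin.sum_univ_castSucc, Fin.sum_univ_castSucc]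
    congr 1
    simp only [sub_mul, Finset.sum_sub_distrib, ← Finset.mul_sum]
    ring
  have hA := vandA_ne_zero_iff.2 hx
  have hA' : vandA (fun i : Fin k => x i.castSucc) ≠ 0 :=
    vandA_ne_zero_iff.2 (hx.comp (Fin.castSucc_injective k))
  rw [h1, gaugeFn, gaugeNumerator, map_mul, map_pow, map_prod, ← h2]
  simp only [map_sub, eval_X, Sum.elim_inl]
  have hv := vandA_castSucc x
  generalize ∏ i : Fin k, (x i.castSucc - x (Fin.last k)) = p at hv ⊢
  generalize vandA (fun i : Fin k => x i.castSucc) = a at hv hA' ⊢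
  have hp : p ≠ 0 := by rintro rfl; rw [hv, mul_zero] at hA; exact hA rfl
  rw [hv]
  have hs : ((-1 : ℂ) ^ k.choose 2) ^ (2 * m) = 1 := by
    rw [← pow_mul, ← mul_assoc, mul_comm _ 2, mul_assoc, pow_mul]; norm_num
  have hs2 : ((-1 : ℂ) ^ k.choose 2) * ((-1 : ℂ) ^ k.choose 2) = 1 := by
    rw [← mul_pow]; norm_num
  have hs0 : ((-1 : ℂ) ^ k.choose 2) ≠ 0 := pow_ne_zero _ (by norm_num)
  generalize ((-1 : ℂ) ^ k.choose 2) = s at hs hs2 hs0 ⊢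
  simp only [mul_pow, pow_succ _ (2 * m), hs, one_mul]
  field_simp
  rw [sq s, hs2]
  ring

/-! ### The leading term in `λ` -/

/-- The polynomials whose degree in `λ` is less than `N`. -/
noncomputable def lamDegreeLT (n N : ℕ) : Submodule ℂ (XLPoly n) :=
  ((Polynomial.degreeLT (XLPoly n) N).restrictScalars ℂ).comap (weightHom (lamWt n)).toLinearMap

theorem mem_lamDegreeLT {n N : ℕ} {R : XLPoly n} :
    R ∈ lamDegreeLT n N ↔ (weightHom (lamWt n) R).degree < N := by
  simp [lamDegreeLT, Polynomial.mem_degreeLT]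

theorem mem_lamDegreeLT_iff {n N : ℕ} {R : XLPoly n} :
    R ∈ lamDegreeLT n N ↔ ∀ d ∈ R.support, ∑ i, d (Sum.inr i) < N := by
  rw [mem_lamDegreeLT, degree_weightHom_lt_iff]
  simp only [sum_mul_lamWt]

theorem lamDegreeLT_mono {n M N : ℕ} (h : M ≤ N) : lamDegreeLT n M ≤ lamDegreeLT n N :=
  fun _ hR => mem_lamDegreeLT.2 ((mem_lamDegreeLT.1 hR).trans_le (by exact_mod_cast h))

theorem mul_mem_lamDegreeLT {n M N : ℕ} {R R' : XLPoly n} (h : R ∈ lamDegreeLT n M)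
    (h' : R' ∈ lamDegreeLT n (N + 1)) : R * R' ∈ lamDegreeLT n (M + N) := by
  by_cases h0 : R * R' = 0
  · rw [h0]; exact Submodule.zero_mem _
  · have h1 : weightHom (lamWt n) R ≠ 0 := fun h1 => left_ne_zero_of_mul h0
      (weightHom_injective (lamWt n) (by rw [h1, map_zero]))
    have h2 : weightHom (lamWt n) R' ≠ 0 := fun h2 => right_ne_zero_of_mul h0
      (weightHom_injective (lamWt n) (by rw [h2, map_zero]))
    rw [mem_lamDegreeLT, Polynomial.degree_eq_natDegree h1, Nat.cast_lt] at h
    rw [mem_lamDegreeLT, Polynomial.degree_eq_natDegree h2, Nat.cast_lt] at h'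
    rw [mem_lamDegreeLT, map_mul, Polynomial.degree_eq_natDegree (mul_ne_zero h1 h2),
      Polynomial.natDegree_mul h1 h2, Nat.cast_lt]
    omega

theorem mul_mem_lamDegreeLT' {n M N : ℕ} {R R' : XLPoly n} (h : R ∈ lamDegreeLT n (M + 1))
    (h' : R' ∈ lamDegreeLT n N) : R * R' ∈ lamDegreeLT n (M + N) := by
  rw [mul_comm, add_comm]; exact mul_mem_lamDegreeLT h' h

theorem mem_lamDegreeLT_of_degree_le {n N : ℕ} {R : XLPoly n}
    (h : (weightHom (lamWt n) R).degree ≤ N) : R ∈ lamDegreeLT n (N + 1) :=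
  mem_lamDegreeLT.2 (h.trans_lt (by exact_mod_cast Nat.lt_succ_self N))

theorem C_mem_lamDegreeLT {n : ℕ} (c : ℂ) : (C c : XLPoly n) ∈ lamDegreeLT n 1 :=
  mem_lamDegreeLT_of_degree_le (by rw [weightHom_lamWt_C]; exact Polynomial.degree_C_le)

theorem X_inl_mem_lamDegreeLT {n : ℕ} (i : Fin n) :
    (X (Sum.inl i) : XLPoly n) ∈ lamDegreeLT n 1 :=
  mem_lamDegreeLT_of_degree_le (by rw [weightHom_lamWt_inl]; exact Polynomial.degree_C_le)

theorem X_inr_mem_lamDegreeLT {n : ℕ} (i : Fin n) :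
    (X (Sum.inr i) : XLPoly n) ∈ lamDegreeLT n 2 :=
  mem_lamDegreeLT_of_degree_le (by rw [weightHom_lamWt_inr]; simp)

theorem prod_mem_lamDegreeLT {n : ℕ} {ι : Type*} (s : Finset ι) {f : ι → XLPoly n} {a : ι → ℕ}
    (h : ∀ i ∈ s, f i ∈ lamDegreeLT n (a i + 1)) :
    ∏ i ∈ s, f i ∈ lamDegreeLT n (∑ i ∈ s, a i + 1) := by
  classical
  induction s using Finset.induction_on with
  | empty => simpa using C_mem_lamDegreeLT (n := n) 1
  | insert i s hi ih =>
    rw [Finset.prod_insert hi, Finset.sum_insert hi, add_assoc]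
    exact mul_mem_lamDegreeLT' (h i (Finset.mem_insert_self _ _))
      (ih fun j hj => h j (Finset.mem_insert_of_mem hj))

theorem prod_mem_lamDegreeLT_one {n : ℕ} {ι : Type*} (s : Finset ι) {f : ι → XLPoly n}
    (h : ∀ i ∈ s, f i ∈ lamDegreeLT n 1) : ∏ i ∈ s, f i ∈ lamDegreeLT n 1 := by
  simpa using prod_mem_lamDegreeLT s (a := fun _ => 0) h

theorem pow_mem_lamDegreeLT {n M : ℕ} {R : XLPoly n} (h : R ∈ lamDegreeLT n (M + 1)) (r : ℕ) :
    R ^ r ∈ lamDegreeLT n (r * M + 1) := by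
  simpa using prod_mem_lamDegreeLT (Finset.range r) (f := fun _ => R) (a := fun _ => M)
    fun _ _ => h

theorem prod_sub_prod_mem_lamDegreeLT {n M : ℕ} {ι : Type*} (s : Finset ι) {f g : ι → XLPoly n}
    (hfg : ∀ i ∈ s, f i - g i ∈ lamDegreeLT n M) (hg : ∀ i ∈ s, g i ∈ lamDegreeLT n (M + 1)) :
    ∏ i ∈ s, f i - ∏ i ∈ s, g i ∈ lamDegreeLT n (s.card * M) := by
  classical
  induction s using Finset.induction_on with
  | empty => simp
  | insert i s hi ih =>
    have hfg' := fun j hj => hfg j (Finset.mem_insert_of_mem hj)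
    have hg' := fun j hj => hg j (Finset.mem_insert_of_mem hj)
    have hf (j : ι) (hj : j ∈ insert i s) : f j ∈ lamDegreeLT n (M + 1) := by
      have := Submodule.add_mem _ (lamDegreeLT_mono (Nat.le_succ M) (hfg j hj)) (hg j hj)
      rwa [sub_add_cancel] at this
    have h1 : ∏ i ∈ s, f i ∈ lamDegreeLT n (s.card * M + 1) := by
      simpa using prod_mem_lamDegreeLT s (a := fun _ => M)
        fun j hj => hf j (Finset.mem_insert_of_mem hj)
    rw [Finset.prod_insert hi, Finset.prod_insert hi, Finset.card_insert_of_notMem hi,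
      show (s.card + 1) * M = M + s.card * M by ring]
    have e : f i * ∏ i ∈ s, f i - g i * ∏ i ∈ s, g i =
        (f i - g i) * ∏ i ∈ s, f i + g i * (∏ i ∈ s, f i - ∏ i ∈ s, g i) := by ring
    rw [e]
    exact Submodule.add_mem _ (mul_mem_lamDegreeLT (hfg i (Finset.mem_insert_self _ _)) h1)
      (mul_mem_lamDegreeLT' (hg i (Finset.mem_insert_self _ _)) (ih hfg' hg'))

theorem xVand_mem_lamDegreeLT (n : ℕ) : xVand n ∈ lamDegreeLT n 1 :=
  mem_lamDegreeLT_of_degree_le (by rw [weightHom_lamWt_xVand]; exact Polynomial.degree_C_le)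

theorem lamVand_mem_lamDegreeLT (n : ℕ) : lamVand n ∈ lamDegreeLT n (n.choose 2 + 1) := by
  rw [lamVand, vandA_eq_prod_pairs]
  simpa [card_pairs] using prod_mem_lamDegreeLT (pairs n) (a := fun _ => 1)
    (f := fun p => (X (Sum.inr p.1) - X (Sum.inr p.2) : XLPoly n)) fun p _ =>
      Submodule.sub_mem _ (X_inr_mem_lamDegreeLT p.1) (X_inr_mem_lamDegreeLT p.2)

theorem baLeading_mem_lamDegreeLT (n m : ℕ) :
    baLeading n m ∈ lamDegreeLT n (m * n.choose 2 + 1) := by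
  have h1 := pow_mem_lamDegreeLT (M := 0) (xVand_mem_lamDegreeLT n) m
  rw [baLeading_eq, ← zero_add (m * _ + 1)]
  exact mul_mem_lamDegreeLT' (by simpa using h1) (pow_mem_lamDegreeLT (lamVand_mem_lamDegreeLT n) m)

theorem mem_lamDegreeLT_of_xVand_pow_mul {n N : ℕ} (r : ℕ) {R : XLPoly n}
    (h : xVand n ^ r * R ∈ lamDegreeLT n N) : R ∈ lamDegreeLT n N := by
  rwa [mem_lamDegreeLT, map_mul, map_pow, weightHom_lamWt_xVand, ← Polynomial.C_pow,
    Polynomial.degree_C_mul (pow_ne_zero _ (xVand_ne_zero n)), ← mem_lamDegreeLT] at h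

/-- The polynomials in `z` whose coefficients have degree less than `N` in `λ`. -/
def CoeffLamDegreeLT {n : ℕ} (N : ℕ) (T : Polynomial (XLPoly n)) : Prop :=
  ∀ j, T.coeff j ∈ lamDegreeLT n N

namespace CoeffLamDegreeLT

variable {n M N : ℕ} {T U : Polynomial (XLPoly n)}

theorem add (h : CoeffLamDegreeLT N T) (h' : CoeffLamDegreeLT N U) :
    CoeffLamDegreeLT N (T + U) := fun j => by
  rw [Polynomial.coeff_add]; exact Submodule.add_mem _ (h j) (h' j)

theorem sub (h : CoeffLamDegreeLT N T) (h' : CoeffLamDegreeLT N U) :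
    CoeffLamDegreeLT N (T - U) := fun j => by
  rw [Polynomial.coeff_sub]; exact Submodule.sub_mem _ (h j) (h' j)

theorem mul (h : CoeffLamDegreeLT (M + 1) T) (h' : CoeffLamDegreeLT N U) :
    CoeffLamDegreeLT (M + N) (T * U) := fun j => by
  rw [Polynomial.coeff_mul]
  exact Submodule.sum_mem _ fun p _ => mul_mem_lamDegreeLT' (h p.1) (h' p.2)

theorem mul_one (h : CoeffLamDegreeLT 1 T) (h' : CoeffLamDegreeLT N U) :
    CoeffLamDegreeLT N (T * U) := by
  have := mul (M := 0) h h'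
  rwa [zero_add] at this

theorem derivative (h : CoeffLamDegreeLT N T) :
    CoeffLamDegreeLT N (Polynomial.derivative T) := fun j => by
  rw [Polynomial.coeff_derivative]
  have := mul_mem_lamDegreeLT (N := 0) (h (j + 1)) (C_mem_lamDegreeLT ((j : ℂ) + 1))
  simpa using this

theorem of_C {R : XLPoly n} (h : R ∈ lamDegreeLT n N) :
    CoeffLamDegreeLT N (Polynomial.C R) := fun j => by
  rw [Polynomial.coeff_C]
  split_ifs
  · exact h
  · exact Submodule.zero_mem _

theorem of_X : CoeffLamDegreeLT 1 (Polynomial.X : Polynomial (XLPoly n)) := fun j => by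
  rw [Polynomial.coeff_X]
  split_ifs
  · simpa using C_mem_lamDegreeLT (n := n) 1
  · exact Submodule.zero_mem _

theorem one : CoeffLamDegreeLT 1 (1 : Polynomial (XLPoly n)) := by
  rw [← Polynomial.C_1]
  exact of_C (by simpa using C_mem_lamDegreeLT (n := n) 1)

theorem pow_one (h : CoeffLamDegreeLT 1 T) (r : ℕ) : CoeffLamDegreeLT 1 (T ^ r) := by
  induction r with
  | zero => rw [pow_zero]; exact one
  | succ r ih => rw [pow_succ]; exact ih.mul_one h

theorem eval (h : CoeffLamDegreeLT N T) (i : Fin n) :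
    T.eval (X (Sum.inl i)) ∈ lamDegreeLT n N := by
  rw [Polynomial.eval_eq_sum_range]
  refine Submodule.sum_mem _ fun j _ => ?_
  have := mul_mem_lamDegreeLT (N := 0) (h j)
    (by simpa using pow_mem_lamDegreeLT (M := 0) (X_inl_mem_lamDegreeLT i) j)
  rwa [add_zero] at this

end CoeffLamDegreeLT

open CoeffLamDegreeLT in
theorem coeffLamDegreeLT_otherFactors {k : ℕ} (i : Fin k) :
    CoeffLamDegreeLT 1 (otherFactors i) := by
  unfold otherFactors
  induction Finset.univ.erase i.castSucc using Finset.induction_on with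
  | empty => simpa using one
  | insert j s hj ih =>
    rw [Finset.prod_insert hj]
    exact (of_X.sub (of_C (X_inl_mem_lamDegreeLT j))).mul_one ih

theorem lamDiff_mem_lamDegreeLT {k : ℕ} (i : Fin k) : lamDiff i ∈ lamDegreeLT (k + 1) 2 :=
  Submodule.sub_mem _ (X_inr_mem_lamDegreeLT _) (X_inr_mem_lamDegreeLT _)

/-- The term of highest degree in `λ` comes from differentiating only the exponential. -/
theorem derivNumerator_sub_mem {k : ℕ} (m : ℕ) (i : Fin k) (α l : ℕ) :
    CoeffLamDegreeLT l (derivNumerator m i α l -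
      Polynomial.C (lamDiff i ^ l) * (Polynomial.X ^ α * otherFactors i ^ l)) := by
  have hD := coeffLamDegreeLT_otherFactors i
  induction l with
  | zero =>
    intro j
    simp [derivNumerator]
  | succ l ih =>
    have hμ : lamDiff i ^ l ∈ lamDegreeLT (k + 1) (l + 1) := by
      simpa using pow_mem_lamDegreeLT (lamDiff_mem_lamDegreeLT i) l
    have hlead : CoeffLamDegreeLT (l + 1) (Polynomial.C (lamDiff i ^ l) *
        (Polynomial.X ^ α * otherFactors i ^ l)) := by
      rw [mul_comm]
      exact ((CoeffLamDegreeLT.of_X.pow_one α).mul_one (hD.pow_one l)).mul_one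
        (CoeffLamDegreeLT.of_C hμ)
    have hT : CoeffLamDegreeLT (l + 1) (derivNumerator m i α l) := by
      have := CoeffLamDegreeLT.add
        (fun j => lamDegreeLT_mono (Nat.le_succ l) (ih j)) hlead
      rwa [sub_add_cancel] at this
    have hn : CoeffLamDegreeLT 1 ((m + 1 + l : ℕ) : Polynomial (XLPoly (k + 1))) := by
      have := CoeffLamDegreeLT.of_C (C_mem_lamDegreeLT (n := k + 1) ((m + 1 + l : ℕ) : ℂ))
      simpa using this
    have e : derivNumerator m i α (l + 1) -
        Polynomial.C (lamDiff i ^ (l + 1)) * (Polynomial.X ^ α * otherFactors i ^ (l + 1)) =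
        (otherFactors i * Polynomial.derivative (derivNumerator m i α l) -
          ((m + 1 + l : ℕ) : Polynomial (XLPoly (k + 1))) *
            (Polynomial.derivative (otherFactors i) * derivNumerator m i α l)) +
        otherFactors i * (Polynomial.C (lamDiff i) * (derivNumerator m i α l -
          Polynomial.C (lamDiff i ^ l) * (Polynomial.X ^ α * otherFactors i ^ l))) := by
      rw [derivNumerator]
      simp only [Polynomial.C_pow]
      ring
    rw [e]
    refine ((hD.mul_one hT.derivative).sub (hn.mul_one (hD.derivative.mul_one hT))).add
      (hD.mul_one ?_)
    rw [add_comm l 1]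
    exact CoeffLamDegreeLT.mul (CoeffLamDegreeLT.of_C (lamDiff_mem_lamDegreeLT i)) ih

theorem eval_otherFactors {k : ℕ} (i : Fin k) :
    (otherFactors i).eval (X (Sum.inl i.castSucc)) =
      ∏ j ∈ Finset.univ.erase i.castSucc, (X (Sum.inl i.castSucc) - X (Sum.inl j)) := by
  simp [otherFactors, Polynomial.eval_prod]

theorem residueNumerator_sub_mem {k : ℕ} (m : ℕ) (i : Fin k) (α : ℕ) :
    residueNumerator m i α - lamDiff i ^ m * (X (Sum.inl i.castSucc) ^ α *
      (∏ j ∈ Finset.univ.erase i.castSucc, (X (Sum.inl i.castSucc) - X (Sum.inl j))) ^ m) ∈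
      lamDegreeLT (k + 1) m := by
  have := (derivNumerator_sub_mem m i α m).eval i.castSucc
  rw [residueNumerator]
  simpa [eval_otherFactors] using this

/-- The embedding of polynomials in the first `k` variables `x` and `λ`. -/
noncomputable def castSuccHom (k : ℕ) : XLPoly k →ₐ[ℂ] XLPoly (k + 1) :=
  aeval fun v => X (Sum.map Fin.castSucc Fin.castSucc v)

theorem castSuccHom_eq_sum {k : ℕ} (R : XLPoly k) :
    castSuccHom k R = ∑ d ∈ R.support, C (coeff d R) *
      (∏ i, X (Sum.inr i.castSucc) ^ d (Sum.inr i)) *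
        ∏ i, X (Sum.inl i.castSucc) ^ d (Sum.inl i) := by
  rw [castSuccHom, aeval_def, eval₂_eq']
  refine Finset.sum_congr rfl fun d _ => ?_
  rw [Fintype.prod_sum_type]
  simp only [Sum.map_inl, Sum.map_inr, algebraMap_eq]
  ring

theorem coeff_mul_prod_mem_lamDegreeLT {k N : ℕ} {R : XLPoly k} (h : R ∈ lamDegreeLT k N)
    {d : Fin k ⊕ Fin k →₀ ℕ} (hd : d ∈ R.support) :
    C (coeff d R) * (∏ i, X (Sum.inr i.castSucc) ^ d (Sum.inr i)) ∈ lamDegreeLT (k + 1) N := by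
  have h1 : ∏ i : Fin k, (X (Sum.inr i.castSucc) : XLPoly (k + 1)) ^ d (Sum.inr i) ∈
      lamDegreeLT (k + 1) (∑ i, d (Sum.inr i) + 1) :=
    prod_mem_lamDegreeLT _ fun i _ => by
      simpa using pow_mem_lamDegreeLT (X_inr_mem_lamDegreeLT i.castSucc) (d (Sum.inr i))
  have h2 := mul_mem_lamDegreeLT' (M := 0) (C_mem_lamDegreeLT (coeff d R)) h1
  rw [zero_add] at h2
  exact lamDegreeLT_mono (mem_lamDegreeLT_iff.1 h d hd) h2

theorem castSuccHom_mem_lamDegreeLT {k N : ℕ} {R : XLPoly k} (h : R ∈ lamDegreeLT k N) :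
    castSuccHom k R ∈ lamDegreeLT (k + 1) N := by
  rw [castSuccHom_eq_sum]
  refine Submodule.sum_mem _ fun d hd => ?_
  have h1 : ∏ i : Fin k, (X (Sum.inl i.castSucc) : XLPoly (k + 1)) ^ d (Sum.inl i) ∈
      lamDegreeLT (k + 1) 1 :=
    prod_mem_lamDegreeLT_one _ fun i _ => by
      simpa using pow_mem_lamDegreeLT (M := 0) (X_inl_mem_lamDegreeLT i.castSucc) (d (Sum.inl i))
  have h2 := mul_mem_lamDegreeLT (N := 0) (coeff_mul_prod_mem_lamDegreeLT h hd) h1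
  rwa [add_zero] at h2

theorem xVand_succ (k : ℕ) : xVand (k + 1) = castSuccHom k (xVand k) *
    ∏ i : Fin k, (X (Sum.inl i.castSucc) - X (Sum.inl (Fin.last k))) := by
  rw [xVand, vandA_castSucc, xVand, ← AlgHom.coe_toRingHom, map_vandA]
  simp [castSuccHom]

theorem lamVand_succ (k : ℕ) : lamVand (k + 1) = castSuccHom k (lamVand k) *
    ∏ i : Fin k, lamDiff i := by
  rw [lamVand, vandA_castSucc, lamVand, ← AlgHom.coe_toRingHom, map_vandA]
  simp [castSuccHom, lamDiff]

theorem mul_choose_succ (k m : ℕ) : m * (k + 1).choose 2 = m * k.choose 2 + k * m := by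
  rw [Nat.choose_succ_succ' k 1, Nat.choose_one_right]; ring

theorem integralNumerator_sub_mem {k m : ℕ} {P : XLPoly k}
    (hP : P ∈ lamDegreeLT k (m * k.choose 2 + 1)) :
    integralNumerator m P - (∏ i : Fin k, lamDiff i) ^ m *
      (∏ i : Fin k, ∏ j ∈ Finset.univ.erase i.castSucc,
        (X (Sum.inl i.castSucc) - X (Sum.inl j))) ^ m * castSuccHom k (xVand k * P) ∈
      lamDegreeLT (k + 1) (m * (k + 1).choose 2) := by
  have hW : xVand k * P ∈ lamDegreeLT k (m * k.choose 2 + 1) := by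
    have := mul_mem_lamDegreeLT' (M := 0) (xVand_mem_lamDegreeLT k) hP
    rwa [zero_add] at this
  rw [castSuccHom_eq_sum, integralNumerator, Finset.mul_sum, ← Finset.sum_sub_distrib,
    mul_choose_succ]
  refine Submodule.sum_mem _ fun d hd => ?_
  have h1 := prod_sub_prod_mem_lamDegreeLT Finset.univ
    (f := fun i => residueNumerator m i (d (Sum.inl i)))
    (g := fun i => lamDiff i ^ m * (X (Sum.inl i.castSucc) ^ d (Sum.inl i) *
      (∏ j ∈ Finset.univ.erase i.castSucc, (X (Sum.inl i.castSucc) - X (Sum.inl j))) ^ m))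
    (fun i _ => residueNumerator_sub_mem m i (d (Sum.inl i))) fun i _ => by
      have e1 : lamDiff i ^ m ∈ lamDegreeLT (k + 1) (m + 1) := by
        simpa using pow_mem_lamDegreeLT (lamDiff_mem_lamDegreeLT i) m
      have e2 : (X (Sum.inl i.castSucc) : XLPoly (k + 1)) ^ d (Sum.inl i) ∈
          lamDegreeLT (k + 1) 1 := by
        simpa using pow_mem_lamDegreeLT (M := 0) (X_inl_mem_lamDegreeLT i.castSucc) (d (Sum.inl i))
      have e3 : (∏ j ∈ Finset.univ.erase i.castSucc,
          (X (Sum.inl i.castSucc) - X (Sum.inl j) : XLPoly (k + 1))) ^ m ∈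
          lamDegreeLT (k + 1) (0 + 1) := by
        have := prod_mem_lamDegreeLT_one (Finset.univ.erase i.castSucc) fun j _ =>
          Submodule.sub_mem _ (X_inl_mem_lamDegreeLT i.castSucc) (X_inl_mem_lamDegreeLT j)
        simpa using pow_mem_lamDegreeLT (M := 0) this m
      exact mul_mem_lamDegreeLT (N := 0) e1 (mul_mem_lamDegreeLT (M := 1) (N := 0) e2 e3)
  rw [Finset.card_univ, Fintype.card_fin] at h1
  have h2 := mul_mem_lamDegreeLT' (coeff_mul_prod_mem_lamDegreeLT hW hd) h1
  convert h2 using 1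
  simp only [Finset.prod_mul_distrib, Finset.prod_pow]
  ring

/-- The leading term in `λ` of the numerator of the integral is, up to sign,
`A(x)^{3m+1} A(λ)^m`. -/
theorem gaugeNumerator_sub_mem {k m : ℕ} {P : XLPoly k}
    (hP : P - baLeading k m ∈ lamDegreeLT k (m * k.choose 2)) :
    gaugeNumerator m P - xVand (k + 1) ^ (2 * m + 1) *
      ((-1) ^ (m * k.choose 2) * baLeading (k + 1) m) ∈
        lamDegreeLT (k + 1) (m * (k + 1).choose 2) := by
  have hP1 : P ∈ lamDegreeLT k (m * k.choose 2 + 1) := by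
    have := Submodule.add_mem _ (lamDegreeLT_mono (Nat.le_succ _) hP)
      (baLeading_mem_lamDegreeLT k m)
    rwa [sub_add_cancel] at this
  have h1 := integralNumerator_sub_mem hP1
  set p : XLPoly (k + 1) := ∏ i : Fin k, (X (Sum.inl i.castSucc) - X (Sum.inl (Fin.last k)))
    with hp
  set D : XLPoly (k + 1) := ∏ i : Fin k, ∏ j ∈ Finset.univ.erase i.castSucc,
        (X (Sum.inl i.castSucc) - X (Sum.inl j)) with hD
  have hp1 : p ^ (2 * m + 1) ∈ lamDegreeLT (k + 1) (0 + 1) := by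
    have := prod_mem_lamDegreeLT_one Finset.univ fun (i : Fin k) _ =>
      Submodule.sub_mem _ (X_inl_mem_lamDegreeLT i.castSucc) (X_inl_mem_lamDegreeLT (Fin.last k))
    simpa using pow_mem_lamDegreeLT (M := 0) this (2 * m + 1)
  have hD1 : D ^ m ∈ lamDegreeLT (k + 1) (0 + 1) := by
    have := prod_mem_lamDegreeLT_one Finset.univ fun (i : Fin k) _ =>
      prod_mem_lamDegreeLT_one (Finset.univ.erase i.castSucc) fun j _ =>
        Submodule.sub_mem _ (X_inl_mem_lamDegreeLT i.castSucc) (X_inl_mem_lamDegreeLT j)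
    simpa using pow_mem_lamDegreeLT (M := 0) this m
  have hμ : (∏ i : Fin k, lamDiff i) ^ m ∈ lamDegreeLT (k + 1) (k * m + 1) := by
    have h2 : ∏ i : Fin k, lamDiff i ∈ lamDegreeLT (k + 1) (k + 1) := by
      simpa using prod_mem_lamDegreeLT Finset.univ (a := fun _ : Fin k => 1) fun i _ =>
        lamDiff_mem_lamDegreeLT i
    simpa [mul_comm] using pow_mem_lamDegreeLT h2 m
  have hx : castSuccHom k (xVand k) ∈ lamDegreeLT (k + 1) (0 + 1) :=
    castSuccHom_mem_lamDegreeLT (xVand_mem_lamDegreeLT k)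
  have h2 := castSuccHom_mem_lamDegreeLT hP
  have hDeq : D = (-1) ^ k.choose 2 * castSuccHom k (xVand k) * xVand (k + 1) := by
    rw [hD, prod_prod_erase_castSucc (R := XLPoly (k + 1)) fun j => X (Sum.inl j), xVand, xVand,
      ← AlgHom.coe_toRingHom, map_vandA]
    simp [castSuccHom]
  have e : gaugeNumerator m P - xVand (k + 1) ^ (2 * m + 1) *
      ((-1) ^ (m * k.choose 2) * baLeading (k + 1) m) =
      p ^ (2 * m + 1) * (integralNumerator m P -
        (∏ i : Fin k, lamDiff i) ^ m * D ^ m * castSuccHom k (xVand k * P)) +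
      p ^ (2 * m + 1) * (D ^ m * (castSuccHom k (xVand k) * ((∏ i : Fin k, lamDiff i) ^ m *
        castSuccHom k (P - baLeading k m)))) := by
    rw [gaugeNumerator, ← hp, baLeading_eq, baLeading_eq, lamVand_succ, hDeq, mul_pow, mul_pow,
      mul_pow, ← pow_mul, mul_comm (k.choose 2) m, xVand_succ, ← hp]
    simp only [map_mul, map_sub, map_pow]
    ring
  rw [e]
  refine Submodule.add_mem _ ?_ ?_
  · simpa using mul_mem_lamDegreeLT' hp1 h1
  · have h3 := mul_mem_lamDegreeLT' hp1 (mul_mem_lamDegreeLT' hD1 (mul_mem_lamDegreeLT' hx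
      (mul_mem_lamDegreeLT' hμ h2)))
    rw [mul_choose_succ, add_comm (m * _)]
    simpa only [zero_add] using h3

/-! ### Bihomogeneity -/

/-- The substitution `v ↦ s ^ (w v) v` of the variables. -/
noncomputable def scaleHom {σ : Type*} (w : σ → ℕ) (s : ℂ) :
    MvPolynomial σ ℂ →ₐ[ℂ] MvPolynomial σ ℂ :=
  aeval fun v => C (s ^ w v) * X v

theorem coeff_scaleHom {σ : Type*} [Fintype σ] (w : σ → ℕ) (s : ℂ) (R : MvPolynomial σ ℂ)
    (d : σ →₀ ℕ) : (scaleHom w s R).coeff d = s ^ (∑ v, d v * w v) * R.coeff d := by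
  classical
  induction R using MvPolynomial.induction_on' with
  | monomial u a =>
    have h : scaleHom w s (monomial u a) = monomial u (s ^ (∑ v, u v * w v) * a) := by
      rw [scaleHom, aeval_monomial, Finsupp.prod_fintype _ _ (by simp), monomial_eq,
        Finsupp.prod_fintype _ _ (by simp)]
      simp only [mul_pow, Finset.prod_mul_distrib, ← C_pow, ← map_prod, ← pow_mul,
        Finset.prod_pow_eq_pow_sum, C_mul, mul_comm (w _), algebraMap_eq]
      ring
    rw [h, coeff_monomial, coeff_monomial]
    split_ifs with hu
    · rw [hu]
    · rw [mul_zero]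
  | add p q hp hq => rw [map_add, coeff_add, hp, hq, coeff_add, mul_add]

theorem eval_scaleHom {σ : Type*} (w : σ → ℕ) (s : ℂ) (R : MvPolynomial σ ℂ) (y : σ → ℂ) :
    eval y (scaleHom w s R) = eval (fun v => s ^ w v * y v) R := by
  induction R using MvPolynomial.induction_on with
  | C c => simp [scaleHom]
  | add p q hp hq => simp only [map_add, hp, hq]
  | mul_X p v hp =>
    rw [map_mul, map_mul, hp, map_mul, eval_X]
    simp [scaleHom]

/-- Each monomial has the same degree in `x` as in `λ`. -/
def IsBalanced {n : ℕ} (R : XLPoly n) : Prop :=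
  ∀ d ∈ R.support, ∑ i, d (Sum.inl i) = ∑ i, d (Sum.inr i)

theorem eval_scaleHom_xWt {n : ℕ} (s : ℂ) (R : XLPoly n) (x lam : Fin n → ℂ) :
    eval (Sum.elim x lam) (scaleHom (xWt n) s R) = eval (Sum.elim (fun i => s * x i) lam) R := by
  rw [eval_scaleHom]
  congr 2
  funext v
  cases v <;> simp [xWt]

theorem eval_scaleHom_lamWt {n : ℕ} (s : ℂ) (R : XLPoly n) (x lam : Fin n → ℂ) :
    eval (Sum.elim x lam) (scaleHom (lamWt n) s R) = eval (Sum.elim x fun i => s * lam i) R := by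
  rw [eval_scaleHom]
  congr 2
  funext v
  cases v <;> simp [lamWt]

theorem IsBalanced.eval_eq {n : ℕ} {R : XLPoly n} (h : IsBalanced R) (s : ℂ) (x lam : Fin n → ℂ) :
    eval (Sum.elim (fun i => s * x i) lam) R = eval (Sum.elim x fun i => s * lam i) R := by
  rw [← eval_scaleHom_xWt, ← eval_scaleHom_lamWt]
  refine congrArg _ (MvPolynomial.ext _ _ fun d => ?_)
  rw [coeff_scaleHom, coeff_scaleHom, sum_mul_xWt, sum_mul_lamWt]
  by_cases hd : R.coeff d = 0
  · rw [hd, mul_zero, mul_zero]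
  · rw [h d (mem_support_iff.2 hd)]

/-- One scaling factor suffices, since the powers of `2` are distinct. -/
theorem isBalanced_of_eval_eq {n : ℕ} {R : XLPoly n}
    (h : ∀ x lam : Fin n → ℂ, Function.Injective x → Function.Injective lam →
      eval (Sum.elim (fun i => 2 * x i) lam) R = eval (Sum.elim x fun i => 2 * lam i) R) :
    IsBalanced R := by
  intro d hd
  have h1 : scaleHom (xWt n) 2 R - scaleHom (lamWt n) 2 R = 0 :=
    eq_zero_of_eval_injective fun x lam hx hl => by
      rw [map_sub, eval_scaleHom_xWt, eval_scaleHom_lamWt, h x lam hx hl, sub_self]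
  have h2 := congrArg (coeff d) (sub_eq_zero.1 h1)
  rw [coeff_scaleHom, coeff_scaleHom, sum_mul_xWt, sum_mul_lamWt] at h2
  have h3 := mul_right_cancel₀ (mem_support_iff.1 hd) h2
  exact Nat.pow_right_injective le_rfl (by exact_mod_cast h3)

theorem isBalanced_baLeading (n m : ℕ) : IsBalanced (baLeading n m) :=
  isBalanced_of_eval_eq fun x lam _ _ => by
    simp only [baLeading_eq, map_mul, map_pow, eval_xVand, eval_lamVand, vandA_mul_left]
    ring

theorem IsBalanced.sub {n : ℕ} {R R' : XLPoly n} (h : IsBalanced R) (h' : IsBalanced R') :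
    IsBalanced (R - R') :=
  isBalanced_of_eval_eq fun x lam _ _ => by rw [map_sub, map_sub, h.eval_eq, h'.eval_eq]

theorem IsBalanced.gaugeFn_mul_left {n : ℕ} {R : XLPoly n} (h : IsBalanced R) (m : ℕ) {s : ℂ}
    (hs : s ≠ 0) (x lam : Fin n → ℂ) :
    s ^ (m * n.choose 2) * gaugeFn m R (fun i => s * x i) lam =
      gaugeFn m R x fun i => s * lam i := by
  have h1 : ∑ i, lam i * (s * x i) = ∑ i, s * lam i * x i :=
    Finset.sum_congr rfl fun i _ => by ring
  have h2 : s ^ (m * n.choose 2) ≠ 0 := pow_ne_zero _ hs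
  rw [gaugeFn, gaugeFn, h.eval_eq, vandA_mul_left, h1, mul_pow, ← pow_mul, mul_comm (n.choose 2) m]
  rw [← mul_assoc, mul_div_assoc', mul_div_mul_left _ _ h2]

theorem add_choose_succ_two_add_choose_two (k : ℕ) :
    k + (k + 1).choose 2 + k.choose 2 = k * (k + 1) := by
  induction k with
  | zero => rfl
  | succ k ih =>
    have e1 := mul_choose_succ (k + 1) 1
    have e2 := mul_choose_succ k 1
    nlinarith

theorem kernelFn_mul_left {k : ℕ} (b : ℕ) (l : ℂ) {s : ℂ} (hs : s ≠ 0)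
    (x : Fin (k + 1) → ℂ) (z : Fin k → ℂ) :
    s ^ (b * k) * kernelFn b l (Sum.elim (fun i => s * x i) fun i => s * z i) =
      kernelFn b (s * l) (Sum.elim x z) := by
  have h1 : crossA (fun i => s * z i) (fun i => s * x i) = s ^ (k * (k + 1)) * crossA z x := by
    simp only [crossA, ← mul_sub, Finset.prod_mul_distrib, Finset.prod_const, Finset.card_univ,
      Fintype.card_fin, ← pow_mul, mul_comm]
  have h2 := add_choose_succ_two_add_choose_two k
  have h3 : s ^ (k * (k + 1) * b) ≠ 0 := pow_ne_zero _ hs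
  have h4 : l * (∑ i, s * x i - ∑ i, s * z i) = s * l * (∑ i, x i - ∑ i, z i) := by
    rw [← Finset.mul_sum, ← Finset.mul_sum]; ring
  simp only [kernelFn, Sum.elim_comp_inl, Sum.elim_comp_inr, Sum.elim_inl, Sum.elim_inr, h1, h4,
    vandA_mul_left, mul_pow, ← pow_mul]
  rw [← mul_assoc, mul_div_assoc', ← mul_div_mul_left _ (crossA z x ^ b) h3]
  congr 2
  rw [← h2]
  ring

/-- Scaling the points, the contour and the parameters. -/
theorem kernelIntegral_mul_left {k : ℕ} (m : ℕ) {P : XLPoly k} (hP : IsBalanced P)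
    (lam : Fin k → ℂ) (l : ℂ) (c : Fin k → ℂ) (ε : ℝ) {s : ℝ} (hs : s ≠ 0)
    (x : Fin (k + 1) → ℂ) :
    (s : ℂ) ^ (m * (k + 1).choose 2) *
      kernelIntegral m P lam l (fun i => s * c i) (s * ε) (fun i => s * x i) =
      kernelIntegral m P (fun i => s * lam i) (s * l) c ε x := by
  have hs' : (s : ℂ) ≠ 0 := by exact_mod_cast hs
  rw [kernelIntegral, torusIntegral_mul_left _ c fun _ => ε, ← mul_assoc,
    ← torusIntegral_const_mul, kernelIntegral]
  refine torusIntegral_congr fun θ => ?_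
  rw [← kernelFn_mul_left (m + 1) l hs', ← hP.gaugeFn_mul_left m hs', mul_choose_succ]
  ring

/-! ### Adding a particle -/

theorem calogeroMoser_congr {n m : ℕ} {f g : (Fin n → ℂ) → ℂ} {x : Fin n → ℂ}
    (h : f =ᶠ[nhds x] g) : calogeroMoser n m f x = calogeroMoser n m g x := by
  have h1 : complexLaplacian f x = complexLaplacian g x := by
    refine Finset.sum_congr rfl fun i _ => ?_
    have h2 : Filter.Tendsto (fun t => Function.update x i t) (nhds (x i)) (nhds x) := by
      have : Continuous fun t => Function.update x i t := by fun_prop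
      simpa using this.tendsto (x i)
    exact Filter.EventuallyEq.iteratedDeriv_eq 2 (h2.eventually h)
  rw [calogeroMoser, calogeroMoser, h1, h.eq_of_nhds]

theorem exists_pos_forall_lt_dist {ι : Type*} [Finite ι] {x : ι → ℂ} (hx : Function.Injective x) :
    ∃ ε : ℝ, 0 < ε ∧ ∀ i j, i ≠ j → 2 * ε < dist (x i) (x j) := by
  have h : ∀ᶠ ε : ℝ in nhdsWithin 0 (Set.Ioi 0), ∀ i j, i ≠ j → 2 * ε < dist (x i) (x j) := by
    refine Filter.eventually_all.2 fun i => Filter.eventually_all.2 fun j => ?_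
    by_cases hij : i = j
    · exact Filter.Eventually.of_forall fun _ h => absurd hij h
    · have h1 : Filter.Tendsto (fun ε : ℝ => 2 * ε) (nhds 0) (nhds 0) := by
        have : Continuous fun ε : ℝ => 2 * ε := by fun_prop
        simpa using this.tendsto 0
      have h2 : 0 < dist (x i) (x j) := dist_pos.2 (hx.ne hij)
      exact (Filter.Eventually.filter_mono nhdsWithin_le_nhds
        (h1.eventually (gt_mem_nhds h2))).mono fun _ h _ => h
  obtain ⟨ε, h1, h2⟩ := (h.and self_mem_nhdsWithin).exists
  exact ⟨ε, h2, h1⟩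

theorem eventually_isContour {k : ℕ} {c : Fin k → ℂ} {ε : ℝ} {x : Fin (k + 1) → ℂ}
    (h : IsContour c ε x) : ∀ᶠ y in nhds x, IsContour c ε y := by
  have h1 : ∀ᶠ y in nhds x, ∀ i : Fin k, y i.castSucc ∈ Metric.ball (c i) ε :=
    Filter.eventually_all.2 fun i => (continuous_apply i.castSucc).continuousAt.eventually
      (Metric.isOpen_ball.mem_nhds (h.mem_ball i))
  have h2 : ∀ᶠ y in nhds x, ∀ (i : Fin k) (j : Fin (k + 1)), j ≠ i.castSucc →
      y j ∉ Metric.closedBall (c i) ε := by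
    refine Filter.eventually_all.2 fun i => Filter.eventually_all.2 fun j => ?_
    by_cases hj : j = i.castSucc
    · exact Filter.Eventually.of_forall fun _ h => absurd hj h
    · exact ((continuous_apply j).continuousAt.eventually
        (Metric.isClosed_closedBall.isOpen_compl.mem_nhds
          (h.notMem_closedBall i j hj))).mono fun _ h _ => h
  filter_upwards [h1, h2] with y hy1 hy2 using ⟨hy1, hy2⟩

theorem isContour_of_lt_dist {k : ℕ} {ε : ℝ} {x : Fin (k + 1) → ℂ} (hε : 0 < ε)
    (h : ∀ (i : Fin k) (j : Fin (k + 1)), j ≠ i.castSucc → ε < dist (x j) (x i.castSucc)) :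
    IsContour (fun i : Fin k => x i.castSucc) ε x :=
  ⟨fun _ => Metric.mem_ball_self hε,
    fun i j hj hm => (h i j hj).not_ge (Metric.mem_closedBall.1 hm)⟩

theorem injective_elim_of_mem_sphere {k : ℕ} {ε : ℝ} {x : Fin (k + 1) → ℂ} (hε : 0 < ε)
    (hx : Function.Injective x) (h : ∀ i j, i ≠ j → 2 * ε < dist (x i) (x j)) {z : Fin k → ℂ}
    (hz : ∀ i : Fin k, z i ∈ Metric.sphere (x i.castSucc) ε) :
    Function.Injective (Sum.elim x z) := by
  refine hx.sumElim (fun i j hij => ?_) fun j i hji => ?_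
  · by_contra hne
    have h1 := h i.castSucc j.castSucc ((Fin.castSucc_injective k).ne hne)
    have h2 := dist_triangle_left (x i.castSucc) (x j.castSucc) (z i)
    have h3 := Metric.mem_sphere.1 (hz i)
    have h4 := Metric.mem_sphere.1 (hz j)
    rw [← hij] at h4
    linarith
  · have h1 := Metric.mem_sphere.1 (hz i)
    rw [← hji] at h1
    by_cases hj : j = i.castSucc
    · rw [hj, dist_self] at h1; linarith
    · linarith [h _ _ hj]

/-- The constant relating the integral to its numerator. -/
noncomputable def residueConst (k m : ℕ) : ℂ :=
  (-1) ^ k.choose 2 * (2 * Real.pi * Complex.I / (m.factorial : ℂ)) ^ k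

theorem residueConst_ne_zero (k m : ℕ) : residueConst k m ≠ 0 :=
  mul_ne_zero (pow_ne_zero _ (by norm_num)) (pow_ne_zero _ (div_ne_zero
    Complex.two_pi_I_ne_zero (by exact_mod_cast m.factorial_ne_zero)))

/-- The integral over a contour that is fixed while `x` varies solves the Schrödinger equation. -/
theorem schrPoly_gaugeNumerator {k m : ℕ} {P : XLPoly k} (hP : schrPoly m m P = 0) :
    schrPoly m (3 * m + 1) (gaugeNumerator m P) = 0 := by
  refine schrPoly_eq_zero_iff.2 fun x lam hx _ => ?_
  obtain ⟨ε, hε, h2ε⟩ := exists_pos_forall_lt_dist hx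
  have hc : IsContour (fun i : Fin k => x i.castSucc) ε x :=
    isContour_of_lt_dist hε fun i j hj => by linarith [h2ε _ _ hj]
  have h1 := calogeroMoser_kernelIntegral hP (fun i => lam i.castSucc) (lam (Fin.last k)) hε
    fun z hz => injective_elim_of_mem_sphere hε hx h2ε hz
  have h2 : kernelIntegral m P (fun i => lam i.castSucc) (lam (Fin.last k))
      (fun i : Fin k => x i.castSucc) ε =ᶠ[nhds x] fun y =>
        residueConst k m * gaugeFn (3 * m + 1) (gaugeNumerator m P) y lam := by
    filter_upwards [eventually_isContour hc, isOpen_setOf_injective.mem_nhds hx] with y hy hy'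
    exact hy.kernelIntegral_eq hy' m P lam
  rw [calogeroMoser_congr h2, calogeroMoser_const_mul, h2.eq_of_nhds] at h1
  refine mul_left_cancel₀ (residueConst_ne_zero k m) (h1.trans ?_)
  rw [Fin.sum_univ_castSucc (fun i => lam i ^ 2)]
  ring

/-- The integral at `(2x, λ)` over the contour scaled by `2` equals, up to a power of `2`, the
integral at `(x, 2λ)`. -/
theorem isBalanced_of_gaugeNumerator_eq {k m : ℕ} {P : XLPoly k} (hP : IsBalanced P)
    {Q : XLPoly (k + 1)} (h : gaugeNumerator m P = xVand (k + 1) ^ (2 * m + 1) * Q) :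
    IsBalanced Q := by
  refine isBalanced_of_eval_eq fun x lam hx _ => ?_
  have key {c : Fin k → ℂ} {ε : ℝ} {y μ : Fin (k + 1) → ℂ} (hy : Function.Injective y)
      (hc : IsContour c ε y) :
      kernelIntegral m P (fun i => μ i.castSucc) (μ (Fin.last k)) c ε y =
        residueConst k m * gaugeFn m Q y μ := by
    rw [hc.kernelIntegral_eq hy m P μ, h, show 3 * m + 1 = m + (2 * m + 1) by ring,
      gaugeFn_mul_xVand_pow _ _ _ _ hy, residueConst]
  obtain ⟨ε, hε, h2ε⟩ := exists_pos_forall_lt_dist hx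
  have hc : IsContour (fun i : Fin k => x i.castSucc) ε x :=
    isContour_of_lt_dist hε fun i j hj => by linarith [h2ε _ _ hj]
  have hc2 : IsContour (fun i : Fin k => ((2 : ℝ) : ℂ) * x i.castSucc) (2 * ε)
      fun i => ((2 : ℝ) : ℂ) * x i :=
    isContour_of_lt_dist (x := fun i => ((2 : ℝ) : ℂ) * x i) (by positivity) fun i j hj => by
      rw [Complex.dist_eq, ← mul_sub, norm_mul, ← Complex.dist_eq]
      have := h2ε _ _ hj
      simp only [Complex.ofReal_ofNat, Complex.norm_ofNat]
      linarith
  have h2x : Function.Injective fun i => ((2 : ℝ) : ℂ) * x i := fun i j hij =>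
    hx (mul_left_cancel₀ (by norm_num) hij)
  have h1 := kernelIntegral_mul_left m hP (fun i => lam i.castSucc) (lam (Fin.last k))
    (fun i : Fin k => x i.castSucc) ε (two_ne_zero (α := ℝ)) x
  rw [key h2x hc2, key (μ := fun i => ((2 : ℝ) : ℂ) * lam i) hx hc, mul_left_comm] at h1
  have h3 := mul_left_cancel₀ (residueConst_ne_zero k m) h1
  have h4 : ∑ i, lam i * (((2 : ℝ) : ℂ) * x i) = ∑ i, ((2 : ℝ) : ℂ) * lam i * x i :=
    Finset.sum_congr rfl fun i _ => by ring
  have hA := pow_ne_zero m (vandA_ne_zero_iff.2 hx)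
  have h5 : ((2 : ℝ) : ℂ) ^ (m * (k + 1).choose 2) ≠ 0 := pow_ne_zero _ (by norm_num)
  rw [gaugeFn, gaugeFn, h4, vandA_mul_left, mul_pow, ← pow_mul, mul_comm (Nat.choose _ _) m,
    ← mul_assoc, mul_div_assoc', mul_div_mul_left _ _ h5] at h3
  have h6 := mul_right_cancel₀ (Complex.exp_ne_zero _) h3
  simpa using (div_left_inj' hA).1 h6

/-- The integral turns the polynomial of the BA function with `k` particles into that of the BA
function with `k + 1` particles. -/
theorem exists_gaugeNumerator_eq {k m : ℕ} {P : XLPoly k} (hP : IsBAPolynomial k m P)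
    (hb : IsBalanced P) :
    ∃ Q : XLPoly (k + 1), IsBAPolynomial (k + 1) m Q ∧ IsBalanced Q ∧
      gaugeNumerator m P = xVand (k + 1) ^ (2 * m + 1) * ((-1) ^ (m * k.choose 2) * Q) := by
  have h1 := schrPoly_gaugeNumerator (schrodinger_iff.1 hP.schrodinger)
  rw [show 3 * m + 1 = m + (2 * m + 1) by ring] at h1
  obtain ⟨Q', hQ', hs⟩ := exists_eq_xVand_pow_mul _ h1
  have hC : ((-1) ^ (m * k.choose 2) : XLPoly (k + 1)) * (-1) ^ (m * k.choose 2) = 1 := by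
    rw [← mul_pow]; norm_num
  obtain ⟨Q, rfl⟩ : ∃ Q, Q' = (-1) ^ (m * k.choose 2) * Q :=
    ⟨(-1) ^ (m * k.choose 2) * Q', by rw [← mul_assoc, hC, one_mul]⟩
  have hsgn : ((-1) ^ (m * k.choose 2) : XLPoly (k + 1)) = C ((-1) ^ (m * k.choose 2)) := by simp
  have hb1 := isBalanced_of_gaugeNumerator_eq hb hQ'
  have hne : ((-1) ^ (m * k.choose 2) : ℂ) ≠ 0 := pow_ne_zero _ (by norm_num)
  have hb2 : IsBalanced Q := fun d hd => hb1 d (by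
    rw [mem_support_iff] at hd ⊢
    rw [hsgn, coeff_C_mul]
    exact mul_ne_zero hne hd)
  have hlam : Q - baLeading (k + 1) m ∈ lamDegreeLT (k + 1) (m * (k + 1).choose 2) := by
    have h2 := gaugeNumerator_sub_mem (mem_lamDegreeLT_iff.2 hP.degree_lam)
    rw [hQ', ← mul_sub, ← mul_sub] at h2
    have h3 := mem_lamDegreeLT_of_xVand_pow_mul _ h2
    rw [hsgn, ← smul_eq_C_mul] at h3
    exact (Submodule.smul_mem_iff _ hne).1 h3
  have hdeg := mem_lamDegreeLT_iff.1 hlam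
  refine ⟨Q, ⟨fun d hd => ?_, hdeg, schrodinger_iff.2 (schrPoly_eq_zero_iff.2 ?_)⟩, hb2, hQ'⟩
  · -- The degrees in `x` and in `λ` agree monomial by monomial.
    rw [(hb2.sub (isBalanced_baLeading (k + 1) m)) d hd]
    exact hdeg d hd
  · intro x lam hx hl
    have h2 := schrPoly_eq_zero_iff.1 hs x lam hx hl
    have h3 (y : Fin (k + 1) → ℂ) : gaugeFn m ((-1) ^ (m * k.choose 2) * Q) y lam =
        (-1) ^ (m * k.choose 2) * gaugeFn m Q y lam := by
      simp only [gaugeFn, hsgn, map_mul, eval_C]; ring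
    simp only [h3, calogeroMoser_const_mul] at h2
    exact mul_left_cancel₀ hne (by rw [h2]; ring)

theorem exists_isBAPolynomial (n m : ℕ) : ∃ P : XLPoly n, IsBAPolynomial n m P ∧ IsBalanced P := by
  induction n with
  | zero =>
    refine ⟨baLeading 0 m, ⟨by simp, by simp, ?_⟩, isBalanced_baLeading 0 m⟩
    intro x lam _ _
    simp [calogeroMoser, complexLaplacian]
  | succ k ih =>
    obtain ⟨P, hP, hb⟩ := ih
    obtain ⟨Q, hQ, hbQ, -⟩ := exists_gaugeNumerator_eq hP hb
    exact ⟨Q, hQ, hbQ⟩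

theorem addParticleIntegrand_eq {k : ℕ} (m : ℕ) (P : XLPoly k) (x lam : Fin (k + 1) → ℂ) :
    addParticleIntegrand m P x lam = fun z => (vandA (fun i : Fin k => lam i.castSucc) ^ m)⁻¹ *
      (kernelFn (m + 1) (lam (Fin.last k)) (Sum.elim x z) *
        gaugeFn m P z fun i => lam i.castSucc) := by
  funext z
  simp only [addParticleIntegrand, baFunction_eq_gaugeFn, kernelFn, Sum.elim_comp_inl,
    Sum.elim_comp_inr, Sum.elim_inl, Sum.elim_inr]
  ring

theorem torusIntegral_addParticleIntegrand {k m : ℕ} {P : XLPoly k} {Q : XLPoly (k + 1)}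
    (hP : IsBAPolynomial k m P) (hQ : IsBAPolynomial (k + 1) m Q) {x lam : Fin (k + 1) → ℂ}
    (hx : Function.Injective x) (hl : Function.Injective lam) {c : Fin k → ℂ} {ε : ℝ}
    (hc : IsContour c ε x) :
    torusIntegral (addParticleIntegrand m P x lam) c (fun _ => ε) =
      (-1) ^ ((m + 1) * k.choose 2) *
        ((2 * (Real.pi : ℂ) * Complex.I) ^ k / (m.factorial : ℂ) ^ k *
          ∏ i : Fin k, (lam i.castSucc - lam (Fin.last k)) ^ m) * baFunction m Q x lam := by
  obtain ⟨P₀, hP₀, hb⟩ := exists_isBAPolynomial k m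
  obtain rfl := IsBAPolynomial.eq hP hP₀
  obtain ⟨Q₀, hQ₀, -, hN⟩ := exists_gaugeNumerator_eq hP hb
  obtain rfl := IsBAPolynomial.eq hQ hQ₀
  have h1 := hc.kernelIntegral_eq hx m P lam
  have hA := vandA_ne_zero_iff.2 hl
  rw [kernelIntegral, hN, show 3 * m + 1 = m + (2 * m + 1) by ring,
    gaugeFn_mul_xVand_pow _ _ _ _ hx] at h1
  rw [addParticleIntegrand_eq, torusIntegral_const_mul, h1, baFunction_eq_gaugeFn,
    Finset.prod_pow]
  rw [vandA_castSucc] at hA ⊢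
  have hsgn : gaugeFn m ((-1) ^ (m * k.choose 2) * Q) x lam =
      (-1) ^ (m * k.choose 2) * gaugeFn m Q x lam := by
    simp only [gaugeFn, map_mul, map_pow, map_neg, map_one]; ring
  have hp := right_ne_zero_of_mul hA
  rw [hsgn, add_mul, one_mul, pow_add, mul_pow (vandA _), mul_inv, div_pow]
  field_simp

end BakerAkhiezer

theorem theorem1 (k m : ℕ) :
    (∃! P : XLPoly k, IsBAPolynomial k m P) ∧
    (∃! Q : XLPoly (k + 1), IsBAPolynomial (k + 1) m Q) ∧
    ∀ (P : XLPoly k) (Q : XLPoly (k + 1)), IsBAPolynomial k m P → IsBAPolynomial (k + 1) m Q →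
      ∀ x lam : Fin (k + 1) → ℂ, Function.Injective x → Function.Injective lam →
      ∀ ε : ℝ, 0 < ε →
        (∀ (i : Fin k) (j : Fin (k + 1)), j ≠ i.castSucc → ε < ‖x i.castSucc - x j‖) →
        TorusIntegrable (addParticleIntegrand m P x lam)
          (fun i : Fin k => x i.castSucc) (fun _ => ε) ∧
        torusIntegral (addParticleIntegrand m P x lam)
            (fun i : Fin k => x i.castSucc) (fun _ => ε) =
          (-1) ^ ((m + 1) * k.choose 2) *
            ((2 * (Real.pi : ℂ) * Complex.I) ^ k / (m.factorial : ℂ) ^ k *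
              ∏ i : Fin k, (lam i.castSucc - lam (Fin.last k)) ^ m) *
            baFunction m Q x lam := by
  obtain ⟨P₀, hP₀, -⟩ := BakerAkhiezer.exists_isBAPolynomial k m
  obtain ⟨Q₀, hQ₀, -⟩ := BakerAkhiezer.exists_isBAPolynomial (k + 1) m
  refine ⟨⟨P₀, hP₀, fun P hP => BakerAkhiezer.IsBAPolynomial.eq hP hP₀⟩,
    ⟨Q₀, hQ₀, fun Q hQ => BakerAkhiezer.IsBAPolynomial.eq hQ hQ₀⟩, ?_⟩
  intro P Q hP hQ x lam hx hl ε hε hsep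
  have hc : BakerAkhiezer.IsContour (fun i : Fin k => x i.castSucc) ε x :=
    BakerAkhiezer.isContour_of_lt_dist hε fun i j hj => by
      rw [dist_comm, Complex.dist_eq]; exact hsep i j hj
  refine ⟨?_, BakerAkhiezer.torusIntegral_addParticleIntegrand hP hQ hx hl hc⟩
  rw [BakerAkhiezer.addParticleIntegrand_eq]
  -- Multiplication by a constant preserves integrability of the pulled-back function.
  have h := hc.torusIntegrable m P lam
  exact MeasureTheory.Integrable.const_mul h _
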